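/- **Setting.** Let $B$ be a compact smooth Riemannian manifold (possibly with boundary), $h:B\to B$ a $C^2$ map with a $C^2$ inverse defined on its image, and $\Lambda\subset B$ a compact set in the interior of $B$ with $h(\Lambda)=\Lambda$. Suppose that $\Lambda$ is $(\lambda_-,\lambda,\mu_-,\mu)$-hyperbolic: $0\le\lambda_-\le\lambda<1$, $0\le\mu_-\le\mu<1$, and there is a $dh$-invariant splitting $TB|_\Lambda=E^s\oplus E^u$ with $\lambda_-|v|\le|dh\,v|\le\lambda|v|$ for $v\in E^s$ and $\mu_-|dh\,v|\le|v|\le\mu|dh\,v|$ for $v\in E^u$. Suppose that $E^s$ and $E^u$ are trivialized over $\Lambda$ by continuous fiberwise isometries $\varphi^s_b:\mathbb R^k\to E^s_b$ and $\varphi^u_b:\mathbb R^l\to E^u_b$ $(b\in\Lambda)$. Let $M$ be a compact smooth Riemannian manifold (possibly with boundary), $X=B\times M$, and let $\mathcal F(b,m)=(h(b),f_b(m))$ be a $C^1$ skew product on $X$ whose fiber maps $f_b:M\to M$ are $C^1$ with $C^1$ inverses on their images. Assume the modified dominated splitting condition $$\max\Bigl(\max(\lambda,\mu)+\Bigl\|\tfrac{\partial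 f_b^{\pm1}}{\partial b}\Bigr\|_{C^0},\ \Bigl\|\tfrac{\partial f_b^{\pm1}}{\partial m}\Bigr\|_{C^0}\Bigr)=:L<\min(\lambda^{-1},\mu^{-1}).$$ Fix a smooth embedding of $X$ in some $\mathbb R^N$, and measure $C^1$ distances of maps into $X$ through it. A $\rho$-perturbation of $\mathcal F$ is a $C^1$ map $\mathcal G:X\to X$ with a $C^1$ inverse on its image such that $d(\mathcal G,\mathcal F)_{C^1}<\rho$ and $d(\mathcal G^{-1},\mathcal F^{-1})_{C^1}<\rho$ (on the common domain of the inverses). For $\delta>0$ let $Q^s=Q^s(\delta)\subset\mathbb R^k$ and $Q^u=Q^u(\delta)\subset\mathbb R^l$ be the open balls of radius $\delta$ around $0$, and let $\varphi_b(x_s,x_u)=\exp_b(\varphi^s_bx_s+\varphi^u_bx_u)$ for $b\in\Lambda$. For $D>0$ let $\mathcal B^s$ be the space of maps $\beta:Q^s\times M\to Q^u$ with $\|\beta\|_{C^0}\le\delta/2$ and $\operatorname{Lip}\beta\le D\delta/2$ (for the sum metric on $Q^s\times M$), with the $C^0$ distance. The leaf over $b$ defined by $\beta$ is $W_b(\beta)=\{(\varphi_b(x_s,\beta(x_s,m)),m):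 x_s\in Q^s,\ m\in M\}$. Let $\Gamma^s$ be the space of center-stable laminations, that is, of continuous maps $S:\Lambda\to\mathcal B^s$, with the $C^0$ distance. A lamination $S$ is $\mathcal G$-invariant if $\mathcal G(W_b(S(b)))\subset W_{h(b)}(S(h(b)))$ for all $b\in\Lambda$. The pointwise graph transform $\mathfrak g_b$ sends $\beta$ to the map $\overline\beta$ with $W_b(\overline\beta)=\mathcal G^{-1}(W_{h(b)}(\beta))\cap(\varphi_b(Q^s\times Q^u)\times M)$, and the global graph transform $\mathfrak g$ is given by $\mathfrak g(S)(b)=\mathfrak g_b(S(h(b)))$. **Lemma.** There are positive constants $D,K,C,\rho_0$, depending only on the data above (not on $\rho$, $\delta$ or $\mathcal G$), such that for every $\rho\in(0,\rho_0)$ there is $\delta$ with $0<\delta\le K\rho$ and $\mu+C\delta<1$, for which $\varphi_b$ is an open embedding of $Q^s\times Q^u$ in $B$ for every $b\in\Lambda$ and the following holds for every $\rho$-perturbation $\mathcal G$ of $\mathcal F$. 1. For each $b\in\Lambda$ the graph transform $\mathfrak g_b$ is well defined on $\mathcal B^s$ and maps $\mathcal B^s$ into itself, and for all $\beta_0,\beta_1\in\mathcal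 B^s$ $$\|\mathfrak g_b(\beta_0)-\mathfrak g_b(\beta_1)\|_{C^0}\le(\mu+C\delta)\,\|\beta_0-\beta_1\|_{C^0}.$$ 2. The graph transform $\mathfrak g$ maps $\Gamma^s$ into itself, and for all $S_0,S_1\in\Gamma^s$ $$\|\mathfrak g(S_0)-\mathfrak g(S_1)\|_{C^0}\le(\mu+C\delta)\,\|S_0-S_1\|_{C^0}.$$ 3. Consequently $\mathfrak g$ has a unique fixed point in $\Gamma^s$, and there is a unique $\mathcal G$-invariant center-stable lamination in $\Gamma^s$. -/

import Mathlib

open Set Topology Bundle Manifold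
open scoped ContDiff ENNReal BoundedContinuousFunction

noncomputable section

namespace SkewProduct

/-! ### Geodesics and the exponential map -/

section Geodesics

variable {E : Type*} [NormedAddCommGroup E] [NormedSpace ℝ E]
  {H : Type*} [TopologicalSpace H] (I : ModelWithCorners ℝ E H)
  {B : Type*} [TopologicalSpace B] [ChartedSpace H B] [IsManifold I ∞ B]
  [RiemannianBundle (fun x : B => TangentSpace I x)]

/-- The coordinate expression `g_z(v, w)` of the Riemannian metric in the chart at `x₀`. -/
def chartMetric (x₀ : B) (z v w : E) : ℝ :=
  inner ℝ (mfderivWithin 𝓘(ℝ, E) I (extChartAt I x₀).symm (range I) z v)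
    (mfderivWithin 𝓘(ℝ, E) I (extChartAt I x₀).symm (range I) z w)

/-- Geodesics (in the interior of `B`) on an open set `s` of times, through the Euler-Lagrange
equations of the energy: in every chart, with `y` the coordinate expression of the curve,
`d/dt g_y(y', w) = (1/2) D_w g_y(y', y')` for each constant vector `w`. -/
structure IsGeodesicOn (c : ℝ → B) (s : Set ℝ) : Prop where
  isOpen : IsOpen s
  contMDiffOn : ContMDiffOn 𝓘(ℝ, ℝ) I 2 c s
  interior : ∀ t ∈ s, I.IsInteriorPoint (c t)
  euler_lagrange : ∀ t ∈ s, ∀ x₀ : B, c t ∈ (chartAt H x₀).source → ∀ w : E,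
    HasDerivAt
      (fun τ => chartMetric I x₀ (extChartAt I x₀ (c τ)) (deriv (extChartAt I x₀ ∘ c) τ) w)
      ((1 / 2) * fderiv ℝ
        (fun z => chartMetric I x₀ z (deriv (extChartAt I x₀ ∘ c) t)
          (deriv (extChartAt I x₀ ∘ c) t))
        (extChartAt I x₀ (c t)) w) t

/-- `p` is the time one position of a geodesic with initial position and velocity `ξ`. -/
def IsExp (ξ : TangentBundle I B) (p : B) : Prop :=
  ∃ (c : ℝ → B) (s : Set ℝ), Icc 0 1 ⊆ s ∧ IsGeodesicOn I c s ∧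
    (⟨c 0, mfderiv 𝓘(ℝ, ℝ) I c 0 (1 : ℝ)⟩ : TangentBundle I B) = ξ ∧ c 1 = p

open Classical in
/-- The Riemannian exponential map (with a junk value where the geodesic does not exist up to
time one). -/
def expMap (ξ : TangentBundle I B) : B :=
  if hξ : ∃ p, IsExp I ξ p then hξ.choose else ξ.1

end Geodesics

/-! ### Hyperbolic sets and trivialized splittings -/

/-- A `C^n` map with a `C^n` inverse (defined on the image). -/
def IsMorphism {E : Type*} [NormedAddCommGroup E] [NormedSpace ℝ E]
    {H : Type*} [TopologicalSpace H] (I : ModelWithCorners ℝ E H)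
    {X : Type*} [TopologicalSpace X] [ChartedSpace H X] (n : ℕ∞ω) (f : X → X) : Prop :=
  ContMDiff I I n f ∧ ∃ g : X → X, Function.LeftInverse g f ∧ ContMDiffOn I I n g (range f)

section Hyperbolic

variable {E : Type*} [NormedAddCommGroup E] [NormedSpace ℝ E]
  {H : Type*} [TopologicalSpace H] (I : ModelWithCorners ℝ E H)
  {B : Type*} [TopologicalSpace B] [ChartedSpace H B] [IsManifold I ∞ B]
  [RiemannianBundle (fun x : B => TangentSpace I x)]

/-- `Λ` is a `(lamm, lam, mum, mu)`-hyperbolic invariant set of `h` with stable and unstable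
bundles `Es` and `Eu` (only the values of `Es` and `Eu` over `Λ` matter). -/
structure IsHyperbolicSet (h : B → B) (Λ : Set B)
    (Es Eu : ∀ b : B, Submodule ℝ (TangentSpace I b)) (lamm lam mum mu : ℝ) : Prop where
  interior : ∀ b ∈ Λ, I.IsInteriorPoint b
  image_eq : h '' Λ = Λ
  lamm_nonneg : 0 ≤ lamm
  lamm_le : lamm ≤ lam
  lam_lt : lam < 1
  mum_nonneg : 0 ≤ mum
  mum_le : mum ≤ mu
  mu_lt : mu < 1
  isCompl : ∀ b ∈ Λ, IsCompl (Es b) (Eu b)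
  map_stable : ∀ b ∈ Λ, ∀ v ∈ Es b, mfderiv I I h b v ∈ Es (h b)
  map_unstable : ∀ b ∈ Λ, ∀ v ∈ Eu b, mfderiv I I h b v ∈ Eu (h b)
  stable_bounds : ∀ b ∈ Λ, ∀ v ∈ Es b,
    lamm * ‖v‖ ≤ ‖mfderiv I I h b v‖ ∧ ‖mfderiv I I h b v‖ ≤ lam * ‖v‖
  unstable_bounds : ∀ b ∈ Λ, ∀ v ∈ Eu b,
    mum * ‖mfderiv I I h b v‖ ≤ ‖v‖ ∧ ‖v‖ ≤ mu * ‖mfderiv I I h b v‖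

variable {I} in
theorem IsHyperbolicSet.mapsTo {h : B → B} {Λ : Set B}
    {Es Eu : ∀ b : B, Submodule ℝ (TangentSpace I b)} {lamm lam mum mu : ℝ}
    (hyp : IsHyperbolicSet I h Λ Es Eu lamm lam mum mu) : MapsTo h Λ Λ :=
  fun _ hb => hyp.image_eq ▸ mem_image_of_mem h hb

/-- A metric-preserving trivialization `Λ × ℝ^k → V` of a subbundle `V` of `TB` over `Λ`. -/
structure IsIsometricTrivialization (Λ : Set B) (V : ∀ b : B, Submodule ℝ (TangentSpace I b))
    {k : ℕ} (φ : ∀ b : Λ, EuclideanSpace ℝ (Fin k) →ₗᵢ[ℝ] TangentSpace I (b : B)) : Prop where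
  range_eq : ∀ b : Λ, (φ b).toLinearMap.range = V b
  continuous : Continuous fun p : Λ × EuclideanSpace ℝ (Fin k) =>
    (⟨p.1, φ p.1 p.2⟩ : TangentBundle I B)

/-- The coordinate chart `(x_s, x_u) ↦ exp_b (φs_b x_s + φu_b x_u)` of `B` around `b ∈ Λ`. -/
def baseChart {Λ : Set B} {k l : ℕ}
    (φs : ∀ b : Λ, EuclideanSpace ℝ (Fin k) →ₗᵢ[ℝ] TangentSpace I (b : B))
    (φu : ∀ b : Λ, EuclideanSpace ℝ (Fin l) →ₗᵢ[ℝ] TangentSpace I (b : B))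
    (b : Λ) (x : EuclideanSpace ℝ (Fin k) × EuclideanSpace ℝ (Fin l)) : B :=
  expMap I ⟨b, φs b x.1 + φu b x.2⟩

end Hyperbolic

/-! ### Skew products and their perturbations -/

section Skew

/-- The skew product `(b, m) ↦ (h b, f_b m)`. -/
def skew {B M : Type*} (h : B → B) (f : B → M → M) (x : B × M) : B × M := (h x.1, f x.1 x.2)

variable {E : Type*} [NormedAddCommGroup E] [NormedSpace ℝ E]
  {H : Type*} [TopologicalSpace H] (I : ModelWithCorners ℝ E H)
  {B : Type*} [TopologicalSpace B] [ChartedSpace H B] [IsManifold I ∞ B]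
  [RiemannianBundle (fun x : B => TangentSpace I x)]
  {E' : Type*} [NormedAddCommGroup E'] [NormedSpace ℝ E']
  {H' : Type*} [TopologicalSpace H'] (J : ModelWithCorners ℝ E' H')
  {M : Type*} [TopologicalSpace M] [ChartedSpace H' M] [IsManifold J ∞ M]
  [RiemannianBundle (fun x : M => TangentSpace J x)]

/-- The modified dominated splitting condition
`max (max (λ, μ) + ‖∂f_b^{±1}/∂b‖, ‖∂f_b^{±1}/∂m‖) =: L < min (λ⁻¹, μ⁻¹)`.
The derivatives of `f_b⁻¹` at the point `f_b m` are `∂f_b⁻¹/∂m = (∂f_b/∂m)⁻¹` and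
`∂f_b⁻¹/∂b = -(∂f_b/∂m)⁻¹ ∘ ∂f_b/∂b`. -/
def ModifiedDominatedSplitting (f : B → M → M) (lam mu : ℝ) : Prop :=
  ∃ L : ℝ, L * lam < 1 ∧ L * mu < 1 ∧ ∀ (b : B) (m : M),
    max lam mu + ‖mfderiv I J (fun b' => f b' m) b‖ ≤ L ∧
    ‖mfderiv J J (f b) m‖ ≤ L ∧
    max lam mu +
      ‖-((mfderiv J J (f b) m).inverse.comp (mfderiv I J (fun b' => f b' m) b))‖ ≤ L ∧
    ‖(mfderiv J J (f b) m).inverse‖ ≤ L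

/-- The norm `‖v‖ + ‖w‖` of a tangent vector of `B × M` with components `v` and `w`. -/
def tangentNorm (ξ : TangentBundle (I.prod J) (B × M)) : ℝ :=
  ‖mfderiv (I.prod J) I Prod.fst ξ.1 ξ.2‖ + ‖mfderiv (I.prod J) J Prod.snd ξ.1 ξ.2‖

/-- A smooth injective immersion of `B × M` in `ℝ^N`; an embedding when `B × M` is compact. -/
structure IsSmoothInjectiveImmersion {N : ℕ} (ι : B × M → EuclideanSpace ℝ (Fin N)) : Prop where
  contMDiff : ContMDiff (I.prod J) 𝓘(ℝ, EuclideanSpace ℝ (Fin N)) ∞ ι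
  injective : Function.Injective ι
  injective_mfderiv : ∀ x : B × M,
    Function.Injective (mfderiv (I.prod J) 𝓘(ℝ, EuclideanSpace ℝ (Fin N)) ι x)

/-- The image of a tangent vector under the differential of `ι`, as a vector of `ℝ^N`. -/
def pushVector {N : ℕ} (ι : B × M → EuclideanSpace ℝ (Fin N))
    (ξ : TangentBundle (I.prod J) (B × M)) : EuclideanSpace ℝ (Fin N) :=
  mfderiv (I.prod J) 𝓘(ℝ, EuclideanSpace ℝ (Fin N)) ι ξ.1 ξ.2

/-- `d(G, F)_{C¹} < ρ`, the `C¹` distance being measured in `ℝ^N` through the embedding `ι`. -/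
def C1DistLT {N : ℕ} (ι : B × M → EuclideanSpace ℝ (Fin N)) (G F : B × M → B × M)
    (ρ : ℝ) : Prop :=
  ∃ r < ρ, ∀ ξ : TangentBundle (I.prod J) (B × M),
    ‖ι (G ξ.1) - ι (F ξ.1)‖ ≤ r ∧
    ‖pushVector I J ι (tangentMap (I.prod J) (I.prod J) G ξ)
      - pushVector I J ι (tangentMap (I.prod J) (I.prod J) F ξ)‖ ≤ r * tangentNorm I J ξ

/-- `d(G⁻¹, F⁻¹)_{C¹} < ρ` on the common domain of `G⁻¹` and `F⁻¹`: a tangent vector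
`η = TG ξ = TF ξ'` has the images `ξ` and `ξ'` under `TG⁻¹` and `TF⁻¹`. -/
def C1InvDistLT {N : ℕ} (ι : B × M → EuclideanSpace ℝ (Fin N)) (G F : B × M → B × M)
    (ρ : ℝ) : Prop :=
  ∃ r < ρ, ∀ ξ ξ' : TangentBundle (I.prod J) (B × M),
    tangentMap (I.prod J) (I.prod J) G ξ = tangentMap (I.prod J) (I.prod J) F ξ' →
    ‖ι ξ.1 - ι ξ'.1‖ ≤ r ∧
    ‖pushVector I J ι ξ - pushVector I J ι ξ'‖
      ≤ r * tangentNorm I J (tangentMap (I.prod J) (I.prod J) G ξ)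

/-- `G` is a `ρ`-perturbation of `F`. -/
structure IsPerturbation {N : ℕ} (ι : B × M → EuclideanSpace ℝ (Fin N))
    (F : B × M → B × M) (ρ : ℝ) (G : B × M → B × M) : Prop where
  isMorphism : IsMorphism (I.prod J) 1 G
  dist_lt : C1DistLT I J ι G F ρ
  inv_dist_lt : C1InvDistLT I J ι G F ρ

end Skew

/-! ### Center-stable leaves, laminations and the graph transform -/

section Leaves

/-- The open ball `Q(δ)` of radius `δ` around the origin of `ℝ^k`. -/
abbrev Q (k : ℕ) (δ : ℝ) : Type := Metric.ball (0 : EuclideanSpace ℝ (Fin k)) δ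

/-- The space of maps `β : Q^s(δ) × M → ℝ^l` with `‖β‖ ≤ δ / 2` (so the values lie in `Q^u(δ)`
when `δ > 0`) and `Lip β ≤ D δ / 2`, where `Q^s(δ) × M` has the sum metric. It is a subspace of
the bounded continuous functions, and so carries the `C⁰` distance. -/
abbrev LeafSpace (k l : ℕ) (M : Type*) [EMetricSpace M] (D δ : ℝ) : Type _ :=
  {β : (Q k δ × M) →ᵇ EuclideanSpace ℝ (Fin l) //
    (∀ p, ‖β p‖ ≤ δ / 2) ∧
    ∀ p q, edist (β p) (β q) ≤ ENNReal.ofReal (D * δ / 2) * (edist p.1 q.1 + edist p.2 q.2)}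

variable {B M : Type*} [EMetricSpace M] {k l : ℕ} {D δ : ℝ} {Λ : Set B}

/-- The leaf over `b ∈ Λ` defined by `β`: its graph, embedded in `B × M` by the chart at `b`. -/
def leaf (φ : Λ → EuclideanSpace ℝ (Fin k) × EuclideanSpace ℝ (Fin l) → B) (b : Λ)
    (β : LeafSpace k l M D δ) : Set (B × M) :=
  range fun p : Q k δ × M => (φ b (p.1, β.1 p), p.2)

/-- The image `B_b(δ)` of `Q^s(δ) × Q^u(δ)` under the chart at `b`. -/
def chartDomain (φ : Λ → EuclideanSpace ℝ (Fin k) × EuclideanSpace ℝ (Fin l) → B) (δ : ℝ)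
    (b : Λ) : Set B :=
  range fun x : Q k δ × Q l δ => φ b (x.1, x.2)

/-- The charts at all points of `Λ` are open embeddings of `Q^s(δ) × Q^u(δ)` in `B`. -/
def IsAdmissibleRadius [TopologicalSpace B]
    (φ : Λ → EuclideanSpace ℝ (Fin k) × EuclideanSpace ℝ (Fin l) → B) (δ : ℝ) : Prop :=
  ∀ b : Λ, IsOpenEmbedding fun x : Q k δ × Q l δ => φ b (x.1, x.2)

/-- `β'` is the graph transform of `β` at `b`: the leaf over `b` defined by `β'` is the inverse
image under `G` of the leaf over `h b` defined by `β`, inside `B_b(δ) × M`. -/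
def IsGraphTransform (φ : Λ → EuclideanSpace ℝ (Fin k) × EuclideanSpace ℝ (Fin l) → B)
    (hΛ : Λ → Λ) (G : B × M → B × M) (b : Λ) (β β' : LeafSpace k l M D δ) : Prop :=
  G ⁻¹' leaf φ (hΛ b) β ∩ chartDomain φ δ b ×ˢ univ = leaf φ b β'

/-- The space of center-stable laminations: continuous maps from `Λ` to the space of leaves, with
the `C⁰` distance (when `Λ` is compact). -/
abbrev LaminationSpace [TopologicalSpace B] (Λ : Set B) (k l : ℕ) (M : Type*) [EMetricSpace M]
    (D δ : ℝ) : Type _ :=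
  C(Λ, LeafSpace k l M D δ)

/-- `G` maps the leaf over `b` into the leaf over `h b`, for each `b ∈ Λ`. -/
def IsInvariantLamination [TopologicalSpace B]
    (φ : Λ → EuclideanSpace ℝ (Fin k) × EuclideanSpace ℝ (Fin l) → B)
    (hΛ : Λ → Λ) (G : B × M → B × M) (S : LaminationSpace Λ k l M D δ) : Prop :=
  ∀ b : Λ, G '' leaf φ b (S b) ⊆ leaf φ (hΛ b) (S (hΛ b))

end Leaves

end SkewProduct

end

open SkewProduct

open Set Topology Bundle Manifold
open scoped ContDiff ENNReal BoundedContinuousFunction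

set_option maxSynthPendingDepth 3
set_option linter.unusedSectionVars false

namespace SkewProduct

/-! ### Second order equations with quadratic right-hand side -/

section Spray

variable {E : Type*} [NormedAddCommGroup E] [NormedSpace ℝ E]

/-- `y` solves `y'' = Γ(y)(y', y')` on `s`, with velocity `v`. -/
def IsSprayCurveOn (Γ : E → E →L[ℝ] E →L[ℝ] E) (y v : ℝ → E) (s : Set ℝ) : Prop :=
  ∀ t ∈ s, HasDerivAt y (v t) t ∧ HasDerivAt v (Γ (y t) (v t) (v t)) t

theorem norm_sub_le_of_hasDerivAt_Icc {f f' : ℝ → E} {C : ℝ}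
    (hf : ∀ t ∈ Icc (0 : ℝ) 1, HasDerivAt f (f' t) t) (hC : ∀ t ∈ Icc (0 : ℝ) 1, ‖f' t‖ ≤ C)
    {t : ℝ} (ht : t ∈ Icc (0 : ℝ) 1) : ‖f t - f 0‖ ≤ C := by
  have h0 : (0 : ℝ) ∈ Icc (0 : ℝ) 1 := ⟨le_rfl, zero_le_one⟩
  have h := (convex_Icc (0 : ℝ) 1).norm_image_sub_le_of_norm_hasDerivWithin_le
    (fun x hx => (hf x hx).hasDerivWithinAt) hC h0 ht
  have hC0 : 0 ≤ C := (norm_nonneg _).trans (hC 0 h0)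
  refine h.trans ?_
  rw [sub_zero, Real.norm_eq_abs, abs_of_nonneg ht.1]
  exact mul_le_of_le_one_right hC0 ht.2

theorem norm_quadratic_sub_le {Γ₁ Γ₂ : E →L[ℝ] E →L[ℝ] E} {v w : E} {C V d : ℝ}
    (hΓ : ‖Γ₁ - Γ₂‖ ≤ C * d) (hΓ₂ : ‖Γ₂‖ ≤ C) (hv : ‖v‖ ≤ V) (hw : ‖w‖ ≤ V) :
    ‖Γ₁ v v - Γ₂ w w‖ ≤ C * d * V * V + 2 * C * V * ‖v - w‖ := by
  have hV : 0 ≤ V := (norm_nonneg _).trans hv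
  have hC : 0 ≤ C := (norm_nonneg _).trans hΓ₂
  have hCd : 0 ≤ C * d := (norm_nonneg _).trans hΓ
  have e : Γ₁ v v - Γ₂ w w = (Γ₁ - Γ₂) v v + (Γ₂ (v - w) v + Γ₂ w (v - w)) := by
    simp only [map_sub, sub_apply]; abel
  rw [e]
  have h1 : ‖(Γ₁ - Γ₂) v v‖ ≤ C * d * V * V :=
    ((Γ₁ - Γ₂).le_opNorm₂ v v).trans (by gcongr)
  have h2 : ‖Γ₂ (v - w) v‖ ≤ C * ‖v - w‖ * V := (Γ₂.le_opNorm₂ _ _).trans (by gcongr)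
  have h3 : ‖Γ₂ w (v - w)‖ ≤ C * V * ‖v - w‖ := (Γ₂.le_opNorm₂ _ _).trans (by gcongr)
  calc _ ≤ _ := norm_add_le _ _
    _ ≤ C * d * V * V + (C * ‖v - w‖ * V + C * V * ‖v - w‖) :=
      add_le_add h1 ((norm_add_le _ _).trans (add_le_add h2 h3))
    _ = _ := by ring

theorem IsSprayCurveOn.norm_displacement_sub_le {Γ : E → E →L[ℝ] E →L[ℝ] E} {A : Set E}
    {C V : ℝ} {y₁ v₁ y₂ v₂ : ℝ → E}
    (hC : ∀ z ∈ A, ‖Γ z‖ ≤ C) (hL : ∀ z ∈ A, ∀ z' ∈ A, ‖Γ z - Γ z'‖ ≤ C * ‖z - z'‖)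
    (hCV : 6 * C * V ≤ 1) (hV1 : V ≤ 1)
    (h₁ : IsSprayCurveOn Γ y₁ v₁ (Icc 0 1)) (h₂ : IsSprayCurveOn Γ y₂ v₂ (Icc 0 1))
    (hy₁ : ∀ t ∈ Icc (0 : ℝ) 1, y₁ t ∈ A) (hy₂ : ∀ t ∈ Icc (0 : ℝ) 1, y₂ t ∈ A)
    (hv₁ : ∀ t ∈ Icc (0 : ℝ) 1, ‖v₁ t‖ ≤ V) (hv₂ : ∀ t ∈ Icc (0 : ℝ) 1, ‖v₂ t‖ ≤ V) :
    ‖(y₁ 1 - y₁ 0 - v₁ 0) - (y₂ 1 - y₂ 0 - v₂ 0)‖ ≤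
      6 * C * V * (‖y₁ 0 - y₂ 0‖ + ‖v₁ 0 - v₂ 0‖) := by
  have h0 : (0 : ℝ) ∈ Icc (0 : ℝ) 1 := ⟨le_rfl, zero_le_one⟩
  have h1 : (1 : ℝ) ∈ Icc (0 : ℝ) 1 := ⟨zero_le_one, le_rfl⟩
  have hV : 0 ≤ V := (norm_nonneg _).trans (hv₁ 0 h0)
  have hC0 : 0 ≤ C := (norm_nonneg _).trans (hC _ (hy₁ 0 h0))
  have hcont : ContinuousOn (fun t => ‖v₁ t - v₂ t‖) (Icc 0 1) := fun t ht =>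
    ((h₁ t ht).2.continuousAt.sub (h₂ t ht).2.continuousAt).norm.continuousWithinAt
  obtain ⟨t₀, ht₀, hmax⟩ := isCompact_Icc.exists_isMaxOn ⟨0, h0⟩ hcont
  set P := ‖v₁ t₀ - v₂ t₀‖ with hP
  have hPmax : ∀ t ∈ Icc (0 : ℝ) 1, ‖v₁ t - v₂ t‖ ≤ P := fun t ht => hmax ht
  set d := ‖y₁ 0 - y₂ 0‖ with hd
  have hd0 : 0 ≤ d := norm_nonneg _
  have hP0 : 0 ≤ P := norm_nonneg _
  have hdy : ∀ t ∈ Icc (0 : ℝ) 1, ‖y₁ t - y₂ t‖ ≤ d + P := by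
    intro t ht
    have := norm_sub_le_of_hasDerivAt_Icc (f := fun t => y₁ t - y₂ t)
      (fun t ht => (h₁ t ht).1.sub (h₂ t ht).1) hPmax ht
    calc ‖y₁ t - y₂ t‖ = ‖(y₁ 0 - y₂ 0) + ((y₁ t - y₂ t) - (y₁ 0 - y₂ 0))‖ := by congr 1; abel
      _ ≤ d + P := (norm_add_le _ _).trans (add_le_add le_rfl this)
  have hdv' : ∀ t ∈ Icc (0 : ℝ) 1,
      ‖Γ (y₁ t) (v₁ t) (v₁ t) - Γ (y₂ t) (v₂ t) (v₂ t)‖ ≤ 3 * C * V * (d + P) := by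
    intro t ht
    refine (norm_quadratic_sub_le (hL _ (hy₁ t ht) _ (hy₂ t ht)) (hC _ (hy₂ t ht))
      (hv₁ t ht) (hv₂ t ht)).trans ?_
    have a1 : C * ‖y₁ t - y₂ t‖ * V * V ≤ C * (d + P) * V * 1 := by gcongr; exact hdy t ht
    have a2 : 2 * C * V * ‖v₁ t - v₂ t‖ ≤ 2 * C * V * (d + P) := by
      gcongr; linarith [hPmax t ht]
    linarith
  have hdv : ∀ t ∈ Icc (0 : ℝ) 1,
      ‖(v₁ t - v₂ t) - (v₁ 0 - v₂ 0)‖ ≤ 3 * C * V * (d + P) := fun t ht =>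
    norm_sub_le_of_hasDerivAt_Icc (f := fun t => v₁ t - v₂ t)
      (fun t ht => (h₁ t ht).2.sub (h₂ t ht).2) hdv' ht
  set q := ‖v₁ 0 - v₂ 0‖ with hq
  have hPle : P ≤ q + 3 * C * V * (d + P) := by
    calc P = ‖(v₁ 0 - v₂ 0) + ((v₁ t₀ - v₂ t₀) - (v₁ 0 - v₂ 0))‖ := by rw [hP]; congr 1; abel
      _ ≤ _ := (norm_add_le _ _).trans (add_le_add le_rfl (hdv t₀ ht₀))
  have hP2 : P ≤ 2 * q + d := by
    have : 3 * C * V * (d + P) ≤ 1 / 2 * (d + P) := by gcongr; linarith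
    linarith
  have hfin := norm_sub_le_of_hasDerivAt_Icc
    (f := fun t => (y₁ t - y₂ t) - t • (v₁ 0 - v₂ 0))
    (f' := fun t => (v₁ t - v₂ t) - (v₁ 0 - v₂ 0)) (C := 3 * C * V * (d + P))
    (fun t ht => by
      have := ((h₁ t ht).1.sub (h₂ t ht).1).sub ((hasDerivAt_id t).smul_const (v₁ 0 - v₂ 0))
      simpa only [one_smul] using! this) hdv h1
  calc _ = ‖(y₁ 1 - y₂ 1 - (1 : ℝ) • (v₁ 0 - v₂ 0)) - (y₁ 0 - y₂ 0 - (0 : ℝ) • (v₁ 0 - v₂ 0))‖ := by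
        congr 1; simp only [one_smul, zero_smul, sub_zero]; abel
    _ ≤ 3 * C * V * (d + P) := hfin
    _ ≤ 3 * C * V * (d + (2 * q + d)) := by gcongr
    _ = _ := by ring

open ODE in
theorem exists_mem_closedBall_of_isPicardLindelof [CompleteSpace E] {f : ℝ → E → E}
    {tmin tmax : ℝ} {t₀ : Icc tmin tmax} {x₀ x : E} {a r L K : NNReal}
    (hf : IsPicardLindelof f t₀ x₀ a r L K) (hx : x ∈ Metric.closedBall x₀ r) :
    ∃ α : ℝ → E, α t₀ = x ∧ (∀ t, α t ∈ Metric.closedBall x₀ a) ∧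
      ∀ t ∈ Icc tmin tmax, HasDerivWithinAt α (f t (α t)) (Icc tmin tmax) t := by
  obtain ⟨α, hα⟩ := FunSpace.exists_isFixedPt_next hf hx
  refine ⟨α.compProj, by rw [FunSpace.compProj_val, ← hα, FunSpace.next_apply₀],
    fun t => α.compProj_mem_closedBall hf.mul_max_le, fun t ht ↦ ?_⟩
  apply hasDerivWithinAt_picard_Icc t₀.2 hf.continuousOn_uncurry
    α.continuous_compProj.continuousOn (fun _ ht' ↦ α.compProj_mem_closedBall hf.mul_max_le)
    x ht |>.congr_of_mem _ ht
  intro t' ht'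
  nth_rw 1 [← hα]
  rw [FunSpace.compProj_of_mem ht', FunSpace.next_apply]

/-- Uniform existence, near `z₀`, of solutions defined beyond time one. -/
theorem exists_isSprayCurveOn [CompleteSpace E] {Γ : E → E →L[ℝ] E →L[ℝ] E} {z₀ : E}
    (hΓ : ContDiffAt ℝ 1 Γ z₀) {U : Set E} (hU : U ∈ 𝓝 z₀) :
    ∃ r > 0, ∃ C > 0, ∃ y v : E → E → ℝ → E,
      (∀ z ∈ Metric.closedBall z₀ r, ∀ w ∈ Metric.closedBall (0 : E) r,
        y z w 0 = z ∧ v z w 0 = w ∧ (∀ t, y z w t ∈ U) ∧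
        IsSprayCurveOn Γ (y z w) (v z w) (Ioo (-1) 2)) ∧
      ∀ s ≤ r, ∀ z ∈ Metric.closedBall z₀ r, ∀ z' ∈ Metric.closedBall z₀ r,
        ∀ w ∈ Metric.closedBall (0 : E) s, ∀ w' ∈ Metric.closedBall (0 : E) s,
        ‖(y z w 1 - z - w) - (y z' w' 1 - z' - w')‖ ≤ C * s * (‖z - z'‖ + ‖w - w'‖) := by
  obtain ⟨K, t, ht, hK⟩ := hΓ.exists_lipschitzOnWith
  have hF : ContDiffAt ℝ 1 (fun p : E × E => (p.2, Γ p.1 p.2 p.2)) (z₀, 0) := by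
    have h1 : ContDiffAt ℝ 1 (fun p : E × E => Γ p.1) (z₀, 0) :=
      ContDiffAt.comp (z₀, (0 : E)) (by exact hΓ) contDiffAt_fst
    exact contDiffAt_snd.prodMk ((h1.clm_apply contDiffAt_snd).clm_apply contDiffAt_snd)
  obtain ⟨K', t', ht', hK'⟩ := hF.exists_lipschitzOnWith
  have ht2 : (Prod.fst ⁻¹' (t ∩ U) : Set (E × E)) ∩ t' ∈ 𝓝 (z₀, (0 : E)) :=
    Filter.inter_mem (continuousAt_fst.preimage_mem_nhds (Filter.inter_mem ht hU)) ht'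
  obtain ⟨a, ha, hasub⟩ := Metric.nhds_basis_closedBall.mem_iff.1 ht2
  set A := Metric.closedBall z₀ a with hA
  have hAsub : ∀ z ∈ A, z ∈ t ∧ z ∈ U := fun z hz => by
    have : (z, (0 : E)) ∈ Metric.closedBall (z₀, (0 : E)) a := by
      rw [← closedBall_prod_same]; exact ⟨hz, by simp [ha.le]⟩
    exact (hasub this).1
  -- a common bound for the norm and the Lipschitz constant of `Γ`
  set C : ℝ := max 1 (max K (‖Γ z₀‖ + K * a)) with hCdef
  have hC1 : 1 ≤ C := le_max_left _ _
  have hCK : (K : ℝ) ≤ C := (le_max_left _ _).trans (le_max_right _ _)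
  have hz₀ : z₀ ∈ A := Metric.mem_closedBall_self ha.le
  have hL : ∀ z ∈ A, ∀ z' ∈ A, ‖Γ z - Γ z'‖ ≤ C * ‖z - z'‖ := fun z hz z' hz' => by
    have := hK.dist_le_mul z (hAsub z hz).1 z' (hAsub z' hz').1
    rw [dist_eq_norm, dist_eq_norm] at this
    exact this.trans (by gcongr)
  have hC : ∀ z ∈ A, ‖Γ z‖ ≤ C := fun z hz => by
    have := hK.dist_le_mul z (hAsub z hz).1 z₀ (hAsub z₀ hz₀).1
    have hz' : dist z z₀ ≤ a := hz
    calc ‖Γ z‖ = ‖Γ z₀ + (Γ z - Γ z₀)‖ := by congr 1; abel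
      _ ≤ ‖Γ z₀‖ + K * a := by
        refine (norm_add_le _ _).trans (add_le_add le_rfl ?_)
        rw [← dist_eq_norm]
        exact this.trans (by gcongr)
      _ ≤ C := (le_max_right _ _).trans (le_max_right _ _)
  -- the rescaled first order system
  set Lb : ℝ := max 1 a * (1 + C * a) + a with hLb
  have hLb0 : 0 < Lb := by positivity
  have hFb : ∀ p ∈ Metric.closedBall (z₀, (0 : E)) a, ‖(p.2, Γ p.1 p.2 p.2)‖ ≤ Lb := by
    rintro ⟨z, w⟩ hp
    rw [← closedBall_prod_same] at hp
    have hw : ‖w‖ ≤ a := by simpa using hp.2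
    have h1 : ‖Γ z w w‖ ≤ C * a * a :=
      ((Γ z).le_opNorm₂ w w).trans (by gcongr; exact hC z hp.1)
    have h2 : C * a * a ≤ Lb := by
      have : a * (C * a) ≤ max 1 a * (1 + C * a) := by
        gcongr
        · exact le_max_right _ _
        · linarith
      rw [hLb]; nlinarith
    have h3 : a ≤ Lb := by
      have : 0 ≤ max 1 a * (1 + C * a) := by positivity
      linarith
    exact max_le (hw.trans h3) (h1.trans h2)
  set ε : ℝ := min (a / (4 * Lb)) (min (1 / (6 * C * a)) (1 / a)) with hε
  have hε0 : 0 < ε := by positivity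
  have hεL : ε * Lb * 2 ≤ a / 2 := by
    have : ε ≤ a / (4 * Lb) := min_le_left _ _
    calc ε * Lb * 2 ≤ a / (4 * Lb) * Lb * 2 := by gcongr
      _ = a / 2 := by field_simp; norm_num
  set V := ε * a with hVdef
  have hV1 : V ≤ 1 := by
    have : ε ≤ 1 / a := (min_le_right _ _).trans (min_le_right _ _)
    calc V ≤ 1 / a * a := by rw [hVdef]; gcongr
      _ = 1 := by field_simp
  have hCV : 6 * C * V ≤ 1 := by
    have : ε ≤ 1 / (6 * C * a) := (min_le_right _ _).trans (min_le_left _ _)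
    calc 6 * C * V ≤ 6 * C * (1 / (6 * C * a) * a) := by rw [hVdef]; gcongr
      _ = 1 := by field_simp
  have h00 : (0 : ℝ) ∈ Icc (-1 : ℝ) 2 := by constructor <;> norm_num
  have hPL : IsPicardLindelof (fun _ (p : E × E) => ε • ((p.2, Γ p.1 p.2 p.2) : E × E))
      (tmin := -1) (tmax := 2) ⟨0, h00⟩ (z₀, (0 : E))
      ⟨a, ha.le⟩ ⟨a / 2, by positivity⟩ ⟨ε * Lb, by positivity⟩ (Real.toNNReal ε * K') := by
    refine IsPicardLindelof.of_time_independent ?_ ?_ ?_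
    · intro p hp
      rw [norm_smul, Real.norm_eq_abs, abs_of_pos hε0]
      exact mul_le_mul_of_nonneg_left (hFb p hp) hε0.le
    · refine LipschitzOnWith.of_dist_le_mul fun p hp q hq => ?_
      rw [dist_smul₀, Real.norm_eq_abs, abs_of_pos hε0, NNReal.coe_mul,
        Real.coe_toNNReal _ hε0.le, mul_assoc]
      exact mul_le_mul_of_nonneg_left (hK'.dist_le_mul p (hasub hp).2 q (hasub hq).2) hε0.le
    · change ε * Lb * max ((2 : ℝ) - 0) (0 - -1) ≤ a - a / 2
      norm_num
      linarith
  have hsol : ∀ p ∈ Metric.closedBall (z₀, (0 : E)) (a / 2), ∃ α : ℝ → E × E, α 0 = p ∧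
      (∀ t, α t ∈ Metric.closedBall (z₀, (0 : E)) a) ∧
      ∀ t ∈ Ioo (-1 : ℝ) 2, HasDerivAt α (ε • ((α t).2, Γ (α t).1 (α t).2 (α t).2)) t := by
    intro p hp
    obtain ⟨α, h1, h2, h3⟩ := exists_mem_closedBall_of_isPicardLindelof hPL hp
    exact ⟨α, h1, h2, fun t ht => (h3 t (Ioo_subset_Icc_self ht)).hasDerivAt
      (Icc_mem_nhds ht.1 ht.2)⟩
  choose! α hα0 hαmem hαd using hsol
  set r : ℝ := min (a / 2) (ε * (a / 2)) with hr
  have hr0 : 0 < r := by positivity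
  have hmem : ∀ z ∈ Metric.closedBall z₀ r, ∀ w ∈ Metric.closedBall (0 : E) r,
      (z, ε⁻¹ • w) ∈ Metric.closedBall (z₀, (0 : E)) (a / 2) := by
    intro z hz w hw
    rw [← closedBall_prod_same]
    refine ⟨Metric.closedBall_subset_closedBall (min_le_left _ _) hz, ?_⟩
    have hw' : ‖w‖ ≤ ε * (a / 2) := by
      have := Metric.closedBall_subset_closedBall (min_le_right _ _) hw
      simpa using this
    rw [mem_closedBall_zero_iff, norm_smul, norm_inv, Real.norm_eq_abs, abs_of_pos hε0]
    rw [inv_mul_le_iff₀ hε0]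
    exact hw'
  have hmain : ∀ z ∈ Metric.closedBall z₀ r, ∀ w ∈ Metric.closedBall (0 : E) r,
      (α (z, ε⁻¹ • w) 0).1 = z ∧ ε • (α (z, ε⁻¹ • w) 0).2 = w ∧
      (∀ t, (α (z, ε⁻¹ • w) t).1 ∈ A ∧ ‖ε • (α (z, ε⁻¹ • w) t).2‖ ≤ V) ∧
      IsSprayCurveOn Γ (fun t => (α (z, ε⁻¹ • w) t).1) (fun t => ε • (α (z, ε⁻¹ • w) t).2)
        (Ioo (-1) 2) := by
    intro z hz w hw
    have hp := hmem z hz w hw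
    refine ⟨by rw [hα0 _ hp], by rw [hα0 _ hp, smul_inv_smul₀ hε0.ne'], fun t => ?_,
      fun t ht => ?_⟩
    · have := hαmem _ hp t
      rw [← closedBall_prod_same] at this
      refine ⟨this.1, ?_⟩
      rw [norm_smul, Real.norm_eq_abs, abs_of_pos hε0]
      exact mul_le_mul_of_nonneg_left (by simpa using this.2) hε0.le
    · have h := hαd _ hp t ht
      have h1 : HasDerivAt (fun t => (α (z, ε⁻¹ • w) t).1) (ε • (α (z, ε⁻¹ • w) t).2) t := by
        simpa using! (hasFDerivAt_fst (𝕜 := ℝ) (p := α (z, ε⁻¹ • w) t)).comp_hasDerivAt t h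
      have h2 : HasDerivAt (fun t => (α (z, ε⁻¹ • w) t).2)
          (ε • Γ (α (z, ε⁻¹ • w) t).1 (α (z, ε⁻¹ • w) t).2 (α (z, ε⁻¹ • w) t).2) t := by
        simpa using! (hasFDerivAt_snd (𝕜 := ℝ) (p := α (z, ε⁻¹ • w) t)).comp_hasDerivAt t h
      refine ⟨h1, ?_⟩
      simpa only [map_smul, smul_apply] using! h2.const_smul ε
  have hI : Icc (0 : ℝ) 1 ⊆ Ioo (-1) 2 := fun t ht => ⟨by linarith [ht.1], by linarith [ht.2]⟩
  -- the velocity at most doubles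
  have hdouble : ∀ z ∈ Metric.closedBall z₀ r, ∀ w ∈ Metric.closedBall (0 : E) r,
      ∀ t ∈ Icc (0 : ℝ) 1, ‖ε • (α (z, ε⁻¹ • w) t).2‖ ≤ 2 * ‖w‖ := by
    intro z hz w hw
    obtain ⟨e1, e2, e3, e4⟩ := hmain z hz w hw
    set v := fun t => ε • (α (z, ε⁻¹ • w) t).2 with hv
    have h0 : (0 : ℝ) ∈ Icc (0 : ℝ) 1 := ⟨le_rfl, zero_le_one⟩
    obtain ⟨t₀, ht₀, hmax⟩ := isCompact_Icc.exists_isMaxOn ⟨0, h0⟩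
      (f := fun t => ‖v t‖) (fun t ht => (e4 t (hI ht)).2.continuousAt.norm.continuousWithinAt)
    have hm : ∀ t ∈ Icc (0 : ℝ) 1, ‖v t‖ ≤ ‖v t₀‖ := fun t ht => hmax ht
    have hd := norm_sub_le_of_hasDerivAt_Icc (f := v) (fun t ht => (e4 t (hI ht)).2)
      (C := C * V * ‖v t₀‖) (fun t ht => by
        refine ((Γ _).le_opNorm₂ _ _).trans ?_
        have := hC _ (e3 t).1
        have h2 := (e3 t).2
        gcongr
        exact hm t ht) ht₀
    have h5 : ‖v t₀‖ ≤ ‖w‖ + C * V * ‖v t₀‖ := by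
      calc ‖v t₀‖ = ‖v 0 + (v t₀ - v 0)‖ := by congr 1; abel
        _ ≤ _ := (norm_add_le _ _).trans (add_le_add (by rw [← e2]) hd)
    have h6 : C * V * ‖v t₀‖ ≤ 1 / 2 * ‖v t₀‖ := by gcongr; linarith
    intro t ht
    exact (hm t ht).trans (by linarith)
  refine ⟨r, hr0, 12 * C, by positivity, fun z w t => (α (z, ε⁻¹ • w) t).1,
    fun z w t => ε • (α (z, ε⁻¹ • w) t).2, fun z hz w hw => ?_, ?_⟩
  · obtain ⟨e1, e2, e3, e4⟩ := hmain z hz w hw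
    exact ⟨e1, e2, fun t => (hAsub _ (e3 t).1).2, e4⟩
  · intro s hs z hz z' hz' w hw w' hw'
    have hsr : Metric.closedBall (0 : E) s ⊆ Metric.closedBall 0 r :=
      Metric.closedBall_subset_closedBall hs
    obtain ⟨e1, e2, e3, e4⟩ := hmain z hz w (hsr hw)
    obtain ⟨f1, f2, f3, f4⟩ := hmain z' hz' w' (hsr hw')
    have hws : ‖w‖ ≤ s := by simpa using hw
    have hws' : ‖w'‖ ≤ s := by simpa using hw'
    have hs0 : 0 ≤ s := (norm_nonneg _).trans hws
    have hsV : 2 * s ≤ V := by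
      have : s ≤ ε * (a / 2) := hs.trans (min_le_right _ _)
      rw [hVdef]; linarith
    have := IsSprayCurveOn.norm_displacement_sub_le (V := 2 * s) hC hL
      (by
        have : 6 * C * (2 * s) ≤ 6 * C * V := by gcongr
        linarith) (hsV.trans hV1)
      (fun t ht => e4 t (hI ht)) (fun t ht => f4 t (hI ht))
      (fun t _ => (e3 t).1) (fun t _ => (f3 t).1)
      (fun t ht => (hdouble z hz w (hsr hw) t ht).trans (by linarith))
      (fun t ht => (hdouble z' hz' w' (hsr hw') t ht).trans (by linarith))
    simp only [e1, e2, f1, f2] at this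
    exact this.trans (le_of_eq (by ring))

end Spray

/-! ### The metric in a chart -/

section Metric

variable {E : Type*} [NormedAddCommGroup E] [NormedSpace ℝ E]
  {H : Type*} [TopologicalSpace H] (I : ModelWithCorners ℝ E H)
  {B : Type*} [TopologicalSpace B] [ChartedSpace H B] [IsManifold I ∞ B]
  [RiemannianBundle (fun x : B => TangentSpace I x)]

theorem chartMetric_comm (x₀ : B) (z v w : E) :
    chartMetric I x₀ z v w = chartMetric I x₀ z w v :=
  real_inner_comm _ _

theorem chartMetric_self_pos {x₀ : B} {z v : E} (hz : z ∈ (extChartAt I x₀).target)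
    (hv : v ≠ 0) : 0 < chartMetric I x₀ z v v := by
  refine real_inner_self_pos.2 fun h => hv ?_
  obtain ⟨e, he⟩ := isInvertible_mfderivWithin_extChartAt_symm (I := I) hz
  rw [← he] at h
  exact e.map_eq_zero_iff.1 h

theorem chartMetric_add_right (x₀ : B) (z v w w' : E) :
    chartMetric I x₀ z v (w + w') = chartMetric I x₀ z v w + chartMetric I x₀ z v w' :=
  (congrArg (fun y : TangentSpace I ((extChartAt I x₀).symm z) => inner ℝ
    (mfderivWithin 𝓘(ℝ, E) I (extChartAt I x₀).symm (range I) z v) y)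
    (ContinuousLinearMap.map_add _ w w')).trans (inner_add_right (𝕜 := ℝ)
      (E := TangentSpace I ((extChartAt I x₀).symm z)) _ _ _)

theorem chartMetric_smul_right (x₀ : B) (z v : E) (a : ℝ) (w : E) :
    chartMetric I x₀ z v (a • w) = a • chartMetric I x₀ z v w :=
  (congrArg (fun y : TangentSpace I ((extChartAt I x₀).symm z) => inner ℝ
    (mfderivWithin 𝓘(ℝ, E) I (extChartAt I x₀).symm (range I) z v) y)
    (ContinuousLinearMap.map_smul _ a w)).trans (real_inner_smul_right
      (F := TangentSpace I ((extChartAt I x₀).symm z)) _ _ _)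

variable [FiniteDimensional ℝ E]

/-- The metric in the chart at `x₀` as a function with values in the bilinear forms. -/
noncomputable def chartMetricCLM (x₀ : B) (z : E) : E →L[ℝ] E →L[ℝ] ℝ :=
  LinearMap.toContinuousLinearMap
    ((LinearMap.toContinuousLinearMap : (E →ₗ[ℝ] ℝ) ≃ₗ[ℝ] (E →L[ℝ] ℝ)).toLinearMap ∘ₗ
      LinearMap.mk₂ ℝ (chartMetric I x₀ z)
        (fun a b c => by
          rw [chartMetric_comm I x₀ z (a + b) c, chartMetric_add_right,
            chartMetric_comm I x₀ z c a, chartMetric_comm I x₀ z c b])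
        (fun _ _ _ => by
          rw [chartMetric_comm, chartMetric_smul_right, chartMetric_comm])
        (chartMetric_add_right I x₀ z) (fun a v w => chartMetric_smul_right I x₀ z v a w))

theorem contMDiffOn_mfderivWithin_extChartAt_symm (x₀ : B) (v : E) :
    ContMDiffOn 𝓘(ℝ, E) I.tangent ∞ (fun z => (⟨(extChartAt I x₀).symm z,
      mfderivWithin 𝓘(ℝ, E) I (extChartAt I x₀).symm (range I) z v⟩ : TangentBundle I B))
      (interior (extChartAt I x₀).target) := by
  set S := interior (extChartAt I x₀).target with hS
  have hSr : S ⊆ interior (range I) := interior_mono (extChartAt_target_subset_range x₀)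
  have h1 : ContMDiffOn 𝓘(ℝ, E) I ∞ (extChartAt I x₀).symm S :=
    (contMDiffOn_extChartAt_symm x₀).mono interior_subset
  have h2 := h1.contMDiffOn_tangentMapWithin (m := ∞) (by simp) isOpen_interior.uniqueMDiffOn
  have h3 : ContMDiff 𝓘(ℝ, E) (𝓘(ℝ, E)).tangent ∞
      (fun z : E => (⟨z, v⟩ : TangentBundle 𝓘(ℝ, E) E)) := by
    rw [contMDiff_vectorSpace_iff_contDiff (V := fun _ => v)]
    exact contDiff_const
  have h4 := h2.comp (h3.contMDiffOn (s := S)) (fun z hz => hz)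
  refine h4.congr fun z hz => ?_
  simp only [Function.comp, tangentMapWithin]
  congr 1
  rw [mfderivWithin_of_isOpen isOpen_interior hz, mfderivWithin_of_mem_nhds
    (mem_interior_iff_mem_nhds.1 (hSr hz))]

theorem contDiffOn_chartMetricCLM
    [IsContMDiffRiemannianBundle I ∞ E (fun x : B => TangentSpace I x)] (x₀ : B) :
    ContDiffOn ℝ ∞ (chartMetricCLM I x₀) (interior (extChartAt I x₀).target) := by
  rw [contDiffOn_clm_apply]
  intro v
  rw [contDiffOn_clm_apply]
  intro w
  rw [← contMDiffOn_iff_contDiffOn]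
  exact ContMDiffOn.inner_bundle (E := fun x : B => TangentSpace I x)
    (contMDiffOn_mfderivWithin_extChartAt_symm I x₀ v)
    (contMDiffOn_mfderivWithin_extChartAt_symm I x₀ w)

end Metric

/-! ### The geodesic spray -/

section Christoffel

variable {E : Type*} [NormedAddCommGroup E] [NormedSpace ℝ E] [FiniteDimensional ℝ E]

/-- `(v, v', w) ↦ A(w, v, v')`, as a continuous linear function of the trilinear form `A`. -/
noncomputable def rotateCLM :
    (E →L[ℝ] E →L[ℝ] E →L[ℝ] ℝ) →L[ℝ] (E →L[ℝ] E →L[ℝ] E →L[ℝ] ℝ) :=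
  (ContinuousLinearMap.compL ℝ E (E →L[ℝ] E →L[ℝ] ℝ) (E →L[ℝ] E →L[ℝ] ℝ)
    (ContinuousLinearMap.flipₗᵢ ℝ E E ℝ).toContinuousLinearEquiv.toContinuousLinearMap) ∘L
    (ContinuousLinearMap.flipₗᵢ ℝ E E (E →L[ℝ] ℝ)).toContinuousLinearEquiv.toContinuousLinearMap

/-- The quadratic right-hand side `Γ` of the geodesic equation `y'' = Γ(y)(y', y')` of a metric
`g` on a vector space. -/
noncomputable def spray (g : E → E →L[ℝ] E →L[ℝ] ℝ) (z : E) : E →L[ℝ] E →L[ℝ] E :=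
  ContinuousLinearMap.compL ℝ E (E →L[ℝ] ℝ) E (g z).inverse ∘L
    ((1 / 2 : ℝ) • rotateCLM (fderiv ℝ g z) - fderiv ℝ g z)

theorem isInvertible_of_pos {g : E →L[ℝ] E →L[ℝ] ℝ} (hg : ∀ v, v ≠ 0 → 0 < g v v) :
    g.IsInvertible := by
  have hinj : Function.Injective g := by
    rw [injective_iff_map_eq_zero]
    intro v hv
    by_contra h
    have := hg v h
    rw [hv] at this
    simp at this
  have hd : Module.finrank ℝ E = Module.finrank ℝ (E →L[ℝ] ℝ) := by
    rw [← (LinearMap.toContinuousLinearMap : (E →ₗ[ℝ] ℝ) ≃ₗ[ℝ] (E →L[ℝ] ℝ)).finrank_eq]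
    exact (Subspace.dual_finrank_eq (K := ℝ) (V := E)).symm
  exact ⟨(LinearEquiv.ofInjectiveOfFinrankEq g.toLinearMap hinj hd).toContinuousLinearEquiv,
    by ext; rfl⟩

theorem metric_spray_apply {g : E → E →L[ℝ] E →L[ℝ] ℝ} {z : E}
    (hg : ∀ v, v ≠ 0 → 0 < g z v v) (v w : E) :
    g z (spray g z v v) w = 1 / 2 * fderiv ℝ g z w v v - fderiv ℝ g z v v w := by
  obtain ⟨e, he⟩ := isInvertible_of_pos hg
  have h1 : spray g z v v =
      (g z).inverse ((1 / 2 : ℝ) • rotateCLM (fderiv ℝ g z) v v - fderiv ℝ g z v v) := rfl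
  rw [h1, ← he, ContinuousLinearMap.inverse_equiv]
  have h2 : (e : E →L[ℝ] E →L[ℝ] ℝ) (e.symm ((1 / 2 : ℝ) • rotateCLM (fderiv ℝ g z) v v -
      fderiv ℝ g z v v)) = (1 / 2 : ℝ) • rotateCLM (fderiv ℝ g z) v v -
      fderiv ℝ g z v v := e.apply_symm_apply _
  change (e : E →L[ℝ] E →L[ℝ] ℝ) (e.symm _) w = _
  rw [h2]
  rfl

theorem contDiffAt_spray {g : E → E →L[ℝ] E →L[ℝ] ℝ} {z : E} (hgs : ContDiffAt ℝ 2 g z)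
    (hg : ∀ v, v ≠ 0 → 0 < g z v v) : ContDiffAt ℝ 1 (spray g) z := by
  have h1 : ContDiffAt ℝ 1 (fderiv ℝ g) z := hgs.fderiv_right (m := 1) (by norm_num)
  obtain ⟨e, he⟩ := isInvertible_of_pos hg
  have h2 : ContDiffAt ℝ 1 (fun z => (g z).inverse) z := by
    refine ContDiffAt.comp z (g := ContinuousLinearMap.inverse) ?_
      (hgs.of_le (by norm_num))
    rw [← he]
    exact contDiffAt_map_inverse e
  have h3 : ContDiffAt ℝ 1 (fun z => ContinuousLinearMap.compL ℝ E (E →L[ℝ] ℝ) E (g z).inverse) z :=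
    (ContinuousLinearMap.compL ℝ E (E →L[ℝ] ℝ) E).contDiff.contDiffAt.comp z h2
  have h4 : ContDiffAt ℝ 1
      (fun z => (1 / 2 : ℝ) • rotateCLM (fderiv ℝ g z) - fderiv ℝ g z) z :=
    ((rotateCLM.contDiff.contDiffAt.comp z h1).const_smul (1 / 2 : ℝ)).sub h1
  exact h3.clm_comp h4

end Christoffel

/-! ### Euler-Lagrange equations -/

section EulerLagrange

variable {E : Type*} [NormedAddCommGroup E] [NormedSpace ℝ E]
  {g : E → E →L[ℝ] E →L[ℝ] ℝ}

theorem fderiv_bilin_apply {z : E} (hg : DifferentiableAt ℝ g z) (a b w : E) :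
    fderiv ℝ (fun z => g z a b) z w = fderiv ℝ g z w a b := by
  have h := ((hg.hasFDerivAt.clm_apply (hasFDerivAt_const a z)).clm_apply
    (hasFDerivAt_const b z)).fderiv
  rw [h]
  simp

theorem hasDerivAt_bilin_apply {y v w : ℝ → E} {y' v' w' : E} {t : ℝ}
    (hg : DifferentiableAt ℝ g (y t)) (hy : HasDerivAt y y' t) (hv : HasDerivAt v v' t)
    (hw : HasDerivAt w w' t) :
    HasDerivAt (fun τ => g (y τ) (v τ) (w τ))
      (fderiv ℝ g (y t) y' (v t) (w t) + g (y t) v' (w t) + g (y t) (v t) w') t := by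
  have h1 : HasDerivAt (fun τ => g (y τ)) (fderiv ℝ g (y t) y') t :=
    hg.hasFDerivAt.comp_hasDerivAt t hy
  have h2 := (h1.clm_apply hv).clm_apply hw
  simpa using! h2

theorem hasDerivAt_spray_of_momentum [FiniteDimensional ℝ E] {y v : ℝ → E} {t : ℝ}
    (hg : DifferentiableAt ℝ g (y t)) (hpos : ∀ a, a ≠ 0 → 0 < g (y t) a a)
    (hy : HasDerivAt y (v t) t) (hv : DifferentiableAt ℝ v t)
    (h : ∀ w, HasDerivAt (fun τ => g (y τ) (v τ) w)
      (1 / 2 * fderiv ℝ g (y t) w (v t) (v t)) t) :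
    HasDerivAt v (spray g (y t) (v t) (v t)) t := by
  have hv' := hv.hasDerivAt
  suffices deriv v t = spray g (y t) (v t) (v t) by rwa [this] at hv'
  obtain ⟨e, he⟩ := isInvertible_of_pos hpos
  apply e.injective
  change (e : E →L[ℝ] E →L[ℝ] ℝ) _ = (e : E →L[ℝ] E →L[ℝ] ℝ) _
  rw [he]
  ext w
  have h1 := (hasDerivAt_bilin_apply hg hy hv' (hasDerivAt_const t w)).unique (h w)
  rw [metric_spray_apply hpos]
  simp only [map_zero, add_zero] at h1
  linarith

/-- The Euler-Lagrange equations in the coordinates `z`, where `y = τ(z)`, follow from those in the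
coordinates `y`. -/
theorem hasDerivAt_momentum_change [FiniteDimensional ℝ E] {g₁ : E → E →L[ℝ] E →L[ℝ] ℝ}
    {τ : E → E} {z u y v : ℝ → E} {t : ℝ} (hτ : ContDiffAt ℝ 2 τ (z t))
    (hg : DifferentiableAt ℝ g (τ (z t)))
    (hsymm : ∀ a b, g (τ (z t)) a b = g (τ (z t)) b a)
    (hpos : ∀ a, a ≠ 0 → 0 < g (τ (z t)) a a)
    (hg₁ : ∀ᶠ x in 𝓝 (z t), ∀ a b, g₁ x a b = g (τ x) (fderiv ℝ τ x a) (fderiv ℝ τ x b))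
    (hy : ∀ᶠ s in 𝓝 t, y s = τ (z s)) (hv : ∀ᶠ s in 𝓝 t, v s = fderiv ℝ τ (z s) (u s))
    (hz : HasDerivAt z (u t) t)
    (hyd : HasDerivAt y (v t) t) (hvd : HasDerivAt v (spray g (y t) (v t) (v t)) t) (w : E) :
    HasDerivAt (fun s => g₁ (z s) (u s) w)
      (1 / 2 * fderiv ℝ (fun x => g₁ x (u t) (u t)) (z t) w) t := by
  have hyt := hy.self_of_nhds
  have hvt := hv.self_of_nhds
  have hD : DifferentiableAt ℝ (fderiv ℝ τ) (z t) :=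
    (hτ.fderiv_right (m := 1) (by norm_num)).differentiableAt (by norm_num)
  have hW : HasDerivAt (fun s => fderiv ℝ τ (z s) w) (fderiv ℝ (fderiv ℝ τ) (z t) (u t) w) t := by
    have := (hD.hasFDerivAt.comp_hasDerivAt t hz).clm_apply (hasDerivAt_const t w)
    simpa using! this
  have hg' : DifferentiableAt ℝ g (y t) := by rwa [hyt]
  have h1 := hasDerivAt_bilin_apply hg' hyd hvd hW
  have h2 : HasDerivAt (fun s => g₁ (z s) (u s) w) _ t := h1.congr_of_eventuallyEq (by
    filter_upwards [hz.continuousAt.eventually hg₁, hy, hv] with s hs1 hs2 hs3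
    rw [hs1, hs2, hs3])
  refine h2.congr_deriv ?_
  have hτd : HasFDerivAt τ (fderiv ℝ τ (z t)) (z t) :=
    (hτ.differentiableAt (by norm_num)).hasFDerivAt
  have h3 : HasFDerivAt (fun x => g (τ x)) (fderiv ℝ g (τ (z t)) ∘L fderiv ℝ τ (z t)) (z t) :=
    hg.hasFDerivAt.comp _ hτd
  have h4 : HasFDerivAt (fun x => fderiv ℝ τ x (u t)) _ (z t) :=
    hD.hasFDerivAt.clm_apply (hasFDerivAt_const (u t) (z t))
  have h5 := (h3.clm_apply h4).clm_apply h4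
  have h6 : HasFDerivAt (fun x => g₁ x (u t) (u t)) _ (z t) := h5.congr_of_eventuallyEq (by
    filter_upwards [hg₁] with x hx
    exact hx _ _)
  rw [h6.fderiv, metric_spray_apply (by rwa [hyt])]
  have hs : fderiv ℝ (fderiv ℝ τ) (z t) (u t) w = fderiv ℝ (fderiv ℝ τ) (z t) w (u t) :=
    (hτ.isSymmSndFDerivAt (by simp)).eq _ _
  rw [hs, hyt, hvt]
  simp only [ContinuousLinearMap.comp_apply, add_apply, ContinuousLinearMap.flip_apply,
    zero_apply, map_zero, zero_add]
  rw [hsymm (fderiv ℝ (fderiv ℝ τ) (z t) w (u t))]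
  ring

end EulerLagrange

/-! ### Geodesics in charts -/

section Geodesic

variable {E : Type*} [NormedAddCommGroup E] [NormedSpace ℝ E]
  {H : Type*} [TopologicalSpace H] (I : ModelWithCorners ℝ E H)
  {B : Type*} [TopologicalSpace B] [ChartedSpace H B] [IsManifold I ∞ B]
  [RiemannianBundle (fun x : B => TangentSpace I x)]

theorem chartMetric_mfderiv_extChartAt {x₀ p : B} (hp : p ∈ (extChartAt I x₀).source)
    (ξ ξ' : TangentSpace I p) :
    chartMetric I x₀ (extChartAt I x₀ p) (mfderiv I 𝓘(ℝ, E) (extChartAt I x₀) p ξ)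
      (mfderiv I 𝓘(ℝ, E) (extChartAt I x₀) p ξ') = inner ℝ ξ ξ' := by
  obtain ⟨z, hz, rfl⟩ : ∃ z ∈ (extChartAt I x₀).target, p = (extChartAt I x₀).symm z :=
    ⟨extChartAt I x₀ p, (extChartAt I x₀).map_source hp, ((extChartAt I x₀).left_inv hp).symm⟩
  have h := mfderivWithin_extChartAt_symm_comp_mfderiv_extChartAt (I := I) hz
  have h' : ∀ η : TangentSpace I ((extChartAt I x₀).symm z),
      mfderivWithin 𝓘(ℝ, E) I (extChartAt I x₀).symm (range I) z
        (mfderiv I 𝓘(ℝ, E) (extChartAt I x₀) ((extChartAt I x₀).symm z) η) = η := fun η =>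
    DFunLike.congr_fun h η
  rw [(extChartAt I x₀).right_inv hz]
  exact congrArg₂ (fun a b : TangentSpace I ((extChartAt I x₀).symm z) => inner ℝ a b) (h' ξ) (h' ξ')

theorem extChartAt_mem_interior_target {x₀ p : B} (hp : p ∈ (extChartAt I x₀).source)
    (hi : I.IsInteriorPoint p) : extChartAt I x₀ p ∈ interior (extChartAt I x₀).target := by
  rw [extChartAt_source] at hp
  exact (I.isInteriorPoint_iff_of_mem_atlas (n := ∞) (by simp) (chart_mem_atlas H x₀) hp).1 hi

theorem isInteriorPoint_extChartAt_symm {x₀ : B} {z : E}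
    (hz : z ∈ interior (extChartAt I x₀).target) :
    I.IsInteriorPoint ((extChartAt I x₀).symm z) := by
  have hz' := interior_subset hz
  have hp := (extChartAt I x₀).map_target hz'
  rw [extChartAt_source] at hp
  rw [I.isInteriorPoint_iff_of_mem_atlas (n := ∞) (by simp) (chart_mem_atlas H x₀) hp]
  change extChartAt I x₀ _ ∈ interior (extChartAt I x₀).target
  rwa [(extChartAt I x₀).right_inv hz']

theorem contDiffAt_extChartAt_comp_symm {x₀ x₁ : B} {z : E}
    (hz : z ∈ interior (extChartAt I x₁).target)
    (hs : (extChartAt I x₁).symm z ∈ (extChartAt I x₀).source) :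
    ContDiffAt ℝ ∞ (extChartAt I x₀ ∘ (extChartAt I x₁).symm) z := by
  rw [← contMDiffAt_iff_contDiffAt]
  refine ContMDiffAt.comp (I' := I) z ?_ ((contMDiffOn_extChartAt_symm x₁).contMDiffAt
    (mem_interior_iff_mem_nhds.1 hz))
  rw [extChartAt_source] at hs
  exact contMDiffAt_extChartAt' hs

theorem fderiv_extChartAt_comp_symm {x₀ x₁ : B} {z : E}
    (hz : z ∈ interior (extChartAt I x₁).target)
    (hs : (extChartAt I x₁).symm z ∈ (extChartAt I x₀).source) (v : E) :
    fderiv ℝ (extChartAt I x₀ ∘ (extChartAt I x₁).symm) z v =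
      mfderiv I 𝓘(ℝ, E) (extChartAt I x₀) ((extChartAt I x₁).symm z)
        (mfderivWithin 𝓘(ℝ, E) I (extChartAt I x₁).symm (range I) z v) := by
  have hr : range I ∈ 𝓝 z := Filter.mem_of_superset (mem_interior_iff_mem_nhds.1 hz)
    (extChartAt_target_subset_range x₁)
  rw [extChartAt_source] at hs
  rw [← mfderiv_eq_fderiv, mfderivWithin_of_mem_nhds hr]
  have h1 := (mdifferentiableWithinAt_extChartAt_symm (interior_subset hz)).mdifferentiableAt hr
  rw [mfderiv_comp z (mdifferentiableAt_extChartAt hs) h1]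
  rfl

theorem chartMetric_change {x₀ x₁ : B} {z : E}
    (hz : z ∈ interior (extChartAt I x₁).target)
    (hs : (extChartAt I x₁).symm z ∈ (extChartAt I x₀).source) (v w : E) :
    chartMetric I x₁ z v w =
      chartMetric I x₀ ((extChartAt I x₀ ∘ (extChartAt I x₁).symm) z)
        (fderiv ℝ (extChartAt I x₀ ∘ (extChartAt I x₁).symm) z v)
        (fderiv ℝ (extChartAt I x₀ ∘ (extChartAt I x₁).symm) z w) := by
  rw [fderiv_extChartAt_comp_symm I hz hs, fderiv_extChartAt_comp_symm I hz hs]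
  exact (chartMetric_mfderiv_extChartAt I hs _ _).symm

end Geodesic

theorem two_le_smooth : (2 : ℕ∞ω) ≤ (∞ : ℕ∞ω) := by
  exact ENat.LEInfty.out

theorem one_le_smooth : (1 : ℕ∞ω) ≤ (∞ : ℕ∞ω) := by
  exact ENat.LEInfty.out

section Geodesic

variable {E : Type*} [NormedAddCommGroup E] [NormedSpace ℝ E] [FiniteDimensional ℝ E]
  {H : Type*} [TopologicalSpace H] (I : ModelWithCorners ℝ E H)
  {B : Type*} [TopologicalSpace B] [ChartedSpace H B] [IsManifold I ∞ B]
  [RiemannianBundle (fun x : B => TangentSpace I x)]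
  [IsContMDiffRiemannianBundle I ∞ E (fun x : B => TangentSpace I x)]

theorem differentiableAt_chartMetricCLM {x₀ : B} {z : E}
    (hz : z ∈ interior (extChartAt I x₀).target) :
    DifferentiableAt ℝ (chartMetricCLM I x₀) z :=
  ((contDiffOn_chartMetricCLM I x₀).contDiffAt (isOpen_interior.mem_nhds hz)).differentiableAt
    (by simp)

theorem contDiffAt_spray_chartMetricCLM {x₀ : B} {z : E}
    (hz : z ∈ interior (extChartAt I x₀).target) :
    ContDiffAt ℝ 1 (spray (chartMetricCLM I x₀)) z :=
  contDiffAt_spray (((contDiffOn_chartMetricCLM I x₀).contDiffAt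
    (isOpen_interior.mem_nhds hz)).of_le two_le_smooth)
    (fun _ ha => chartMetric_self_pos I (interior_subset hz) ha)

theorem contDiffOn_two_of_isSprayCurveOn {Γ : E → E →L[ℝ] E →L[ℝ] E} {y v : ℝ → E} {s : Set ℝ}
    {U : Set E} (hs : IsOpen s) (hΓ : ContinuousOn Γ U) (hy : IsSprayCurveOn Γ y v s)
    (hU : ∀ t ∈ s, y t ∈ U) : ContDiffOn ℝ 2 y s := by
  have hyc : ContinuousOn y s := fun t ht => (hy t ht).1.continuousAt.continuousWithinAt
  have hvc : ContinuousOn v s := fun t ht => (hy t ht).2.continuousAt.continuousWithinAt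
  have hac : ContinuousOn (fun t => Γ (y t) (v t) (v t)) s :=
    ((hΓ.comp hyc hU).clm_apply hvc).clm_apply hvc
  have hv1 : ContDiffOn ℝ 1 v s := by
    rw [show (1 : ℕ∞ω) = 0 + 1 from rfl, contDiffOn_succ_iff_deriv_of_isOpen hs]
    refine ⟨fun t ht => (hy t ht).2.differentiableAt.differentiableWithinAt, by simp, ?_⟩
    rw [contDiffOn_zero]
    exact hac.congr fun t ht => (hy t ht).2.deriv
  rw [show (2 : ℕ∞ω) = 1 + 1 from rfl, contDiffOn_succ_iff_deriv_of_isOpen hs]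
  exact ⟨fun t ht => (hy t ht).1.differentiableAt.differentiableWithinAt, by simp,
    hv1.congr fun t ht => (hy t ht).1.deriv⟩

variable {x₀ : B} {y v : ℝ → E} {s : Set ℝ}

theorem isGeodesicOn_of_isSprayCurveOn (hs : IsOpen s)
    (hy : IsSprayCurveOn (spray (chartMetricCLM I x₀)) y v s)
    (hmem : ∀ t ∈ s, y t ∈ interior (extChartAt I x₀).target) :
    IsGeodesicOn I (fun t => (extChartAt I x₀).symm (y t)) s := by
  have hyC : ContDiffOn ℝ 2 y s := contDiffOn_two_of_isSprayCurveOn hs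
    (fun z hz => (contDiffAt_spray_chartMetricCLM I hz).continuousAt.continuousWithinAt) hy hmem
  refine ⟨hs, ?_, fun t ht => isInteriorPoint_extChartAt_symm I (hmem t ht), ?_⟩
  · have hmem' : s ⊆ y ⁻¹' (extChartAt I x₀).target := fun t ht => interior_subset (s := (extChartAt I x₀).target) (hmem t ht)
    exact ContMDiffOn.comp (t := (extChartAt I x₀).target)
      ((contMDiffOn_extChartAt_symm (n := ∞) x₀).of_le two_le_smooth)
      hyC.contMDiffOn hmem'
  intro t ht x₁ hx₁ w
  rw [← extChartAt_source I] at hx₁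
  set e₀ := extChartAt I x₀ with he₀
  set e₁ := extChartAt I x₁ with he₁
  set σ := e₁ ∘ e₀.symm with hσ
  set τ := e₀ ∘ e₁.symm with hτ
  have hzt : σ (y t) ∈ interior e₁.target := extChartAt_mem_interior_target I hx₁
    (isInteriorPoint_extChartAt_symm I (hmem t ht))
  have hback : e₁.symm (σ (y t)) ∈ e₀.source := by
    simp only [hσ, Function.comp]
    rw [e₁.left_inv hx₁]
    exact e₀.map_target (interior_subset (hmem t ht))
  have hσC : ContDiffAt ℝ ∞ σ (y t) := contDiffAt_extChartAt_comp_symm I (hmem t ht) hx₁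
  have hτC : ContDiffAt ℝ ∞ τ (σ (y t)) := contDiffAt_extChartAt_comp_symm I hzt hback
  have hτσ : ∀ᶠ x in 𝓝 (y t), τ (σ x) = x := by
    have h1 : ∀ᶠ x in 𝓝 (y t), x ∈ interior e₀.target := isOpen_interior.mem_nhds (hmem t ht)
    have h2 : ∀ᶠ x in 𝓝 (y t), e₀.symm x ∈ e₁.source :=
      (continuousAt_extChartAt_symm'' (interior_subset (hmem t ht))).preimage_mem_nhds
        ((isOpen_extChartAt_source x₁).mem_nhds hx₁)
    filter_upwards [h1, h2] with x hx1 hx2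
    simp only [hτ, hσ, Function.comp]
    rw [e₁.left_inv hx2, e₀.right_inv (interior_subset hx1)]
  have hτσt : τ (σ (y t)) = y t := hτσ.self_of_nhds
  have hyc : ContinuousAt y t := (hy t ht).1.continuousAt
  have hσd : ∀ᶠ x in 𝓝 (y t), DifferentiableAt ℝ σ x := by
    have := (hσC.of_le one_le_smooth).eventually (by simp)
    exact this.mono fun x hx => hx.differentiableAt (by simp)
  have hτd : ∀ᶠ x in 𝓝 (σ (y t)), DifferentiableAt ℝ τ x := by
    have := (hτC.of_le one_le_smooth).eventually (by simp)
    exact this.mono fun x hx => hx.differentiableAt (by simp)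
  have hs' : ∀ᶠ r in 𝓝 t, r ∈ s := hs.mem_nhds ht
  -- the coordinates in the chart at `x₁`
  have hzd : ∀ᶠ r in 𝓝 t, HasDerivAt (fun r => σ (y r)) (fderiv ℝ σ (y r) (v r)) r := by
    filter_upwards [hyc.eventually hσd, hs'] with r hr1 hr2
    exact hr1.hasFDerivAt.comp_hasDerivAt r (hy r hr2).1
  have hzc : ContinuousAt (fun r => σ (y r)) t := hzd.self_of_nhds.continuousAt
  have hzderiv : (fun r => deriv (e₁ ∘ fun t => e₀.symm (y t)) r) =ᶠ[𝓝 t]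
      fun r => fderiv ℝ σ (y r) (v r) := hzd.mono fun r hr => hr.deriv
  have hveq : ∀ᶠ r in 𝓝 t, v r = fderiv ℝ τ (σ (y r)) (fderiv ℝ σ (y r) (v r)) := by
    filter_upwards [hyc.eventually hσd, hzc.eventually hτd, hyc.eventually hτσ.eventually_nhds]
      with r hr1 hr2 hr3
    have h1 : HasFDerivAt (fun x => τ (σ x)) (fderiv ℝ τ (σ (y r)) ∘L fderiv ℝ σ (y r)) (y r) :=
      hr2.hasFDerivAt.comp _ hr1.hasFDerivAt
    have h2 : HasFDerivAt (fun x => τ (σ x)) (ContinuousLinearMap.id ℝ E) (y r) :=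
      (hasFDerivAt_id _).congr_of_eventuallyEq hr3
    exact (DFunLike.congr_fun (h1.unique h2) (v r)).symm
  have hmetric : ∀ᶠ x in 𝓝 (σ (y t)), ∀ a b, chartMetricCLM I x₁ x a b =
      chartMetricCLM I x₀ (τ x) (fderiv ℝ τ x a) (fderiv ℝ τ x b) := by
    have h1 : ∀ᶠ x in 𝓝 (σ (y t)), x ∈ interior e₁.target := isOpen_interior.mem_nhds hzt
    have h2 : ∀ᶠ x in 𝓝 (σ (y t)), e₁.symm x ∈ e₀.source :=
      (continuousAt_extChartAt_symm'' (interior_subset hzt)).preimage_mem_nhds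
        ((isOpen_extChartAt_source x₀).mem_nhds hback)
    filter_upwards [h1, h2] with x hx1 hx2 a b
    exact chartMetric_change I hx1 hx2 a b
  have hmain := hasDerivAt_momentum_change (g := chartMetricCLM I x₀) (g₁ := chartMetricCLM I x₁)
    (τ := τ) (z := fun r => σ (y r)) (u := fun r => fderiv ℝ σ (y r) (v r)) (y := y) (v := v)
    (t := t) (hτC.of_le two_le_smooth)
    (by rw [hτσt]; exact differentiableAt_chartMetricCLM I (hmem t ht))
    (fun a b => chartMetric_comm I _ _ _ _)
    (fun a ha => by
      rw [hτσt]; exact chartMetric_self_pos I (interior_subset (hmem t ht)) ha)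
    hmetric ((hyc.eventually hτσ).mono fun r hr => hr.symm) hveq hzd.self_of_nhds
    (hy t ht).1 (hy t ht).2 w
  have hzt' : deriv (e₁ ∘ fun t => e₀.symm (y t)) t = fderiv ℝ σ (y t) (v t) :=
    hzderiv.self_of_nhds
  rw [hzt']
  refine hmain.congr_of_eventuallyEq ?_
  filter_upwards [hzderiv] with r hr
  rw [hr]
  rfl

theorem mfderiv_extChartAt_symm_comp {t : ℝ} {y' : E} (hy : HasDerivAt y y' t)
    (hmem : y t ∈ interior (extChartAt I x₀).target) :
    mfderiv I 𝓘(ℝ, E) (extChartAt I x₀) ((extChartAt I x₀).symm (y t))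
      (mfderiv 𝓘(ℝ, ℝ) I (fun t => (extChartAt I x₀).symm (y t)) t (1 : ℝ)) = y' := by
  have hr : range I ∈ 𝓝 (y t) := Filter.mem_of_superset (mem_interior_iff_mem_nhds.1 hmem)
    (extChartAt_target_subset_range x₀)
  have h1 := (mdifferentiableWithinAt_extChartAt_symm (interior_subset hmem)).mdifferentiableAt hr
  have h2 : mfderiv 𝓘(ℝ, ℝ) I (fun t => (extChartAt I x₀).symm (y t)) t =
      (mfderiv 𝓘(ℝ, E) I (extChartAt I x₀).symm (y t)).comp (mfderiv 𝓘(ℝ, ℝ) 𝓘(ℝ, E) y t) :=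
    mfderiv_comp t h1 hy.differentiableAt.mdifferentiableAt
  rw [h2, mfderiv_eq_fderiv, ← mfderivWithin_of_mem_nhds hr]
  have h3 := mfderiv_extChartAt_comp_mfderivWithin_extChartAt_symm (I := I)
    (interior_subset hmem)
  have h4 := DFunLike.congr_fun h3 (fderiv ℝ y t 1)
  refine h4.trans ?_
  change fderiv ℝ y t 1 = y'
  rw [fderiv_apply_one_eq_deriv, hy.deriv]

theorem IsGeodesicOn.isSprayCurveOn {c : ℝ → B} (hc : IsGeodesicOn I c s) :
    IsSprayCurveOn (spray (chartMetricCLM I x₀)) (extChartAt I x₀ ∘ c)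
      (deriv (extChartAt I x₀ ∘ c)) (s ∩ c ⁻¹' (extChartAt I x₀).source) := by
  have hcc : ContinuousOn c s := hc.contMDiffOn.continuousOn
  have hopen : IsOpen (s ∩ c ⁻¹' (extChartAt I x₀).source) :=
    hcc.isOpen_inter_preimage hc.isOpen (isOpen_extChartAt_source x₀)
  have hC : ContDiffOn ℝ 2 (extChartAt I x₀ ∘ c) (s ∩ c ⁻¹' (extChartAt I x₀).source) := by
    rw [← contMDiffOn_iff_contDiffOn]
    refine ContMDiffOn.comp (t := (chartAt H x₀).source)
      ((contMDiffOn_extChartAt (n := ∞)).of_le two_le_smooth)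
      (hc.contMDiffOn.mono inter_subset_left) fun t ht => ?_
    have := ht.2
    rwa [mem_preimage, extChartAt_source] at this
  intro t ht
  have hint : (extChartAt I x₀ ∘ c) t ∈ _root_.interior (extChartAt I x₀).target :=
    extChartAt_mem_interior_target I ht.2 (hc.interior t ht.1)
  have hyd : HasDerivAt (extChartAt I x₀ ∘ c) (deriv (extChartAt I x₀ ∘ c) t) t :=
    ((hC.differentiableOn (by norm_num)).differentiableAt (hopen.mem_nhds ht)).hasDerivAt
  refine ⟨hyd, ?_⟩
  have hd : DifferentiableAt ℝ (deriv (extChartAt I x₀ ∘ c)) t := by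
    rw [show (2 : ℕ∞ω) = 1 + 1 from rfl, contDiffOn_succ_iff_deriv_of_isOpen hopen] at hC
    exact (hC.2.2.differentiableOn (by norm_num)).differentiableAt (hopen.mem_nhds ht)
  have hg := differentiableAt_chartMetricCLM I hint
  refine hasDerivAt_spray_of_momentum hg
    (fun a ha => chartMetric_self_pos I (interior_subset hint) ha) hyd hd fun w => ?_
  have hx := ht.2
  rw [mem_preimage, extChartAt_source] at hx
  refine (hc.euler_lagrange t ht.1 x₀ hx w).congr_deriv ?_
  rw [← fderiv_bilin_apply hg]
  rfl

theorem IsGeodesicOn.hasDerivAt_mfderiv {c : ℝ → B} (hc : IsGeodesicOn I c s) {t : ℝ} (ht : t ∈ s)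
    (hx : c t ∈ (extChartAt I x₀).source) :
    mfderiv I 𝓘(ℝ, E) (extChartAt I x₀) (c t) (mfderiv 𝓘(ℝ, ℝ) I c t (1 : ℝ)) =
      deriv (extChartAt I x₀ ∘ c) t := by
  rw [extChartAt_source] at hx
  have h1 : MDifferentiableAt 𝓘(ℝ, ℝ) I c t :=
    (hc.contMDiffOn.contMDiffAt (hc.isOpen.mem_nhds ht)).mdifferentiableAt (by norm_num)
  have h2 := mfderiv_comp t (mdifferentiableAt_extChartAt hx) h1
  rw [← fderiv_apply_one_eq_deriv, ← mfderiv_eq_fderiv, h2]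
  rfl

theorem spray_curve_unique {Γ : E → E →L[ℝ] E →L[ℝ] E} {y₁ v₁ y₂ v₂ : ℝ → E} {t : ℝ}
    (hΓ : ContDiffAt ℝ 1 Γ (y₁ t)) {s₁ s₂ : Set ℝ} (hs₁ : s₁ ∈ 𝓝 t) (hs₂ : s₂ ∈ 𝓝 t)
    (h₁ : IsSprayCurveOn Γ y₁ v₁ s₁) (h₂ : IsSprayCurveOn Γ y₂ v₂ s₂)
    (hy : y₁ t = y₂ t) (hv : v₁ t = v₂ t) :
    ∀ᶠ r in 𝓝 t, y₁ r = y₂ r ∧ v₁ r = v₂ r := by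
  have hF : ContDiffAt ℝ 1 (fun p : E × E => (p.2, Γ p.1 p.2 p.2)) (y₁ t, v₁ t) := by
    have h1 : ContDiffAt ℝ 1 (fun p : E × E => Γ p.1) (y₁ t, v₁ t) :=
      ContDiffAt.comp (y₁ t, v₁ t) (by exact hΓ) contDiffAt_fst
    exact contDiffAt_snd.prodMk ((h1.clm_apply contDiffAt_snd).clm_apply contDiffAt_snd)
  obtain ⟨K, U, hU, hK⟩ := hF.exists_lipschitzOnWith
  have aux : ∀ (y v : ℝ → E) (s : Set ℝ), s ∈ 𝓝 t → IsSprayCurveOn Γ y v s →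
      U ∈ 𝓝 (y t, v t) → ∀ᶠ r in 𝓝 t,
      HasDerivAt (fun r => (y r, v r)) ((y r, v r).2, Γ (y r, v r).1 (y r, v r).2 (y r, v r).2) r ∧
        (y r, v r) ∈ U := by
    intro y v s hs h hUm
    have hc : ContinuousAt (fun r => (y r, v r)) t :=
      (h t (mem_of_mem_nhds hs)).1.continuousAt.prodMk (h t (mem_of_mem_nhds hs)).2.continuousAt
    filter_upwards [hs, hc.preimage_mem_nhds hUm] with r hr1 hr2
    exact ⟨(h r hr1).1.prodMk (h r hr1).2, hr2⟩
  have := ODE_solution_unique_of_eventually (v := fun _ (p : E × E) => (p.2, Γ p.1 p.2 p.2))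
    (s := fun _ => U) (K := K) (f := fun r => (y₁ r, v₁ r)) (g := fun r => (y₂ r, v₂ r)) (t₀ := t)
    (Filter.Eventually.of_forall fun _ => hK) (aux y₁ v₁ s₁ hs₁ h₁ hU)
    (aux y₂ v₂ s₂ hs₂ h₂ (by rwa [← hy, ← hv])) (by simp only [hy, hv])
  exact this.mono fun r hr => by simpa using! hr

variable [T2Space B]

/-- A geodesic with the initial data of a solution in a chart coincides with this solution. -/
theorem IsGeodesicOn.eq_of_isSprayCurveOn {c : ℝ → B} (hc : IsGeodesicOn I c s)
    {s' : Set ℝ} (hs' : IsOpen s') (h01 : Icc 0 1 ⊆ s) (h01' : Icc 0 1 ⊆ s')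
    (hy : IsSprayCurveOn (spray (chartMetricCLM I x₀)) y v s')
    (hmem : ∀ t ∈ s', y t ∈ _root_.interior (extChartAt I x₀).target)
    (h0 : c 0 = (extChartAt I x₀).symm (y 0))
    (h0' : deriv (extChartAt I x₀ ∘ c) 0 = v 0) :
    c 1 = (extChartAt I x₀).symm (y 1) := by
  set e := extChartAt I x₀ with he
  have hcc : ∀ t ∈ Icc (0 : ℝ) 1, ContinuousAt c t := fun t ht =>
    hc.contMDiffOn.continuousOn.continuousAt (hc.isOpen.mem_nhds (h01 ht))
  have hyc : ∀ t ∈ Icc (0 : ℝ) 1, ContinuousAt (fun t => e.symm (y t)) t := fun t ht =>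
    (continuousAt_extChartAt_symm'' (interior_subset (hmem t (h01' ht)))).comp
      (hy t (h01' ht)).1.continuousAt
  have hsp := hc.isSprayCurveOn I (x₀ := x₀)
  have hopen : IsOpen (s ∩ c ⁻¹' e.source) :=
    hc.contMDiffOn.continuousOn.isOpen_inter_preimage hc.isOpen (isOpen_extChartAt_source x₀)
  have hmemc : ∀ t ∈ Icc (0 : ℝ) 1, c t = e.symm (y t) → t ∈ s ∩ c ⁻¹' e.source := by
    intro t ht hct
    refine ⟨h01 ht, ?_⟩
    rw [mem_preimage, hct]
    exact e.map_target (interior_subset (hmem t (h01' ht)))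
  set T : Set ℝ := {t | c t = e.symm (y t) ∧ deriv (e ∘ c) t = v t} with hT
  have hclosed : IsClosed (T ∩ Icc 0 1) := by
    refine isClosed_of_closure_subset fun t ht => ?_
    have htI : t ∈ Icc (0 : ℝ) 1 := by
      have := closure_mono (inter_subset_right (s := T) (t := Icc (0 : ℝ) 1)) ht
      rwa [isClosed_Icc.closure_eq] at this
    have hne : (𝓝[T ∩ Icc 0 1] t).NeBot := mem_closure_iff_nhdsWithin_neBot.1 ht
    have h1 : c t = e.symm (y t) := by
      refine tendsto_nhds_unique_of_eventuallyEq (l := 𝓝[T ∩ Icc 0 1] t)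
        ((hcc t htI).mono_left nhdsWithin_le_nhds) ((hyc t htI).mono_left nhdsWithin_le_nhds) ?_
      filter_upwards [self_mem_nhdsWithin] with r hr
      exact hr.1.1
    refine ⟨⟨h1, ?_⟩, htI⟩
    have h2 := (hsp t (hmemc t htI h1)).2.continuousAt
    refine tendsto_nhds_unique_of_eventuallyEq (l := 𝓝[T ∩ Icc 0 1] t)
      (h2.mono_left nhdsWithin_le_nhds)
      ((hy t (h01' htI)).2.continuousAt.mono_left nhdsWithin_le_nhds) ?_
    filter_upwards [self_mem_nhdsWithin] with r hr
    exact hr.1.2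
  have hsub : Icc (0 : ℝ) 1 ⊆ T := by
    refine hclosed.Icc_subset_of_forall_mem_nhdsWithin ⟨h0, h0'⟩ fun t ht => ?_
    have htI : t ∈ Icc (0 : ℝ) 1 := Ico_subset_Icc_self ht.2
    have htm := hmemc t htI ht.1.1
    have hyt : (e ∘ c) t = y t := by
      rw [Function.comp, ht.1.1, e.right_inv (interior_subset (hmem t (h01' htI)))]
    have := spray_curve_unique (by
        rw [hyt]; exact contDiffAt_spray_chartMetricCLM I (hmem t (h01' htI)))
      (hopen.mem_nhds htm) (hs'.mem_nhds (h01' htI)) hsp hy hyt ht.1.2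
    refine mem_nhdsWithin_of_mem_nhds ?_
    filter_upwards [this, hopen.mem_nhds htm] with r hr1 hr2
    refine ⟨?_, hr1.2⟩
    rw [← hr1.1, Function.comp, e.left_inv hr2.2]
  exact (hsub ⟨zero_le_one, le_rfl⟩).1

/-- The coordinates of a tangent vector in the chart at `x₀`. -/
noncomputable def chartVec (x₀ : B) (ξ : TangentBundle I B) : E :=
  mfderiv I 𝓘(ℝ, E) (extChartAt I x₀) ξ.1 ξ.2

theorem eq_of_chartVec_eq {ξ η : TangentBundle I B} (hξ : ξ.1 ∈ (extChartAt I x₀).source)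
    (h : η.1 = ξ.1) (h' : chartVec I x₀ η = chartVec I x₀ ξ) : η = ξ := by
  obtain ⟨p, a⟩ := ξ
  obtain ⟨q, b⟩ := η
  obtain rfl : q = p := h
  have hinj : Function.Injective (mfderiv I 𝓘(ℝ, E) (extChartAt I x₀) q) := by
    obtain ⟨L, hL⟩ := isInvertible_mfderiv_extChartAt (I := I) hξ
    rw [← hL]
    exact L.injective
  congr 1
  exact hinj h'

/-- First order expansion of the exponential map, in a chart. -/
theorem exists_expMap_expansion (x₀ : B) (hx₀ : I.IsInteriorPoint x₀) :
    ∃ r > 0, ∃ C > 0, ∃ R : E → E → E,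
      (∀ s ≤ r, ∀ z ∈ Metric.closedBall (extChartAt I x₀ x₀) r,
        ∀ z' ∈ Metric.closedBall (extChartAt I x₀ x₀) r,
        ∀ w ∈ Metric.closedBall (0 : E) s, ∀ w' ∈ Metric.closedBall (0 : E) s,
        ‖R z w - R z' w'‖ ≤ C * s * (‖z - z'‖ + ‖w - w'‖)) ∧
      (∀ z ∈ Metric.closedBall (extChartAt I x₀ x₀) r, R z 0 = 0) ∧
      ∀ ξ : TangentBundle I B, ξ.1 ∈ (extChartAt I x₀).source →
        extChartAt I x₀ ξ.1 ∈ Metric.closedBall (extChartAt I x₀ x₀) r →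
        ‖chartVec I x₀ ξ‖ ≤ r →
        expMap I ξ ∈ (extChartAt I x₀).source ∧
        extChartAt I x₀ (expMap I ξ) = extChartAt I x₀ ξ.1 +
          chartVec I x₀ ξ +
          R (extChartAt I x₀ ξ.1) (chartVec I x₀ ξ) := by
  set e := extChartAt I x₀ with he
  have hint : e x₀ ∈ interior e.target :=
    extChartAt_mem_interior_target I (mem_extChartAt_source x₀) hx₀
  obtain ⟨r, hr, C, hC, y, v, hyv, hR⟩ := exists_isSprayCurveOn
    (contDiffAt_spray_chartMetricCLM I hint) (isOpen_interior.mem_nhds hint)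
  have hI : Icc (0 : ℝ) 1 ⊆ Ioo (-1) 2 := fun t ht => ⟨by linarith [ht.1], by linarith [ht.2]⟩
  have h0r : (0 : E) ∈ Metric.closedBall (0 : E) r := by simp [hr.le]
  refine ⟨r, hr, C, hC, fun z w => y z w 1 - z - w, hR, fun z hz => ?_, fun ξ hξ hξz hξv => ?_⟩
  · -- both `y z 0` and the constant curve are solutions
    obtain ⟨e1, e2, e3, e4⟩ := hyv z hz 0 h0r
    have hvz : ∀ t ∈ Icc (0 : ℝ) 1, v z 0 t = 0 ∧ y z 0 t = z := by
      set T : Set ℝ := {t | v z 0 t = 0 ∧ y z 0 t = z}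
      have hcl : IsClosed (T ∩ Icc 0 1) := by
        have hv : ContinuousOn (fun t => (v z 0 t, y z 0 t)) (Icc 0 1) := fun t ht =>
          ((e4 t (hI ht)).2.continuousAt.prodMk (e4 t (hI ht)).1.continuousAt).continuousWithinAt
        have := hv.preimage_isClosed_of_isClosed isClosed_Icc (isClosed_singleton (x := ((0 : E), z)))
        convert this using 1
        ext t
        simp [T, and_comm]
      refine hcl.Icc_subset_of_forall_mem_nhdsWithin ⟨e2, e1⟩ fun t ht => ?_
      have htI : t ∈ Ioo (-1 : ℝ) 2 := hI (Ico_subset_Icc_self ht.2)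
      have hsp : IsSprayCurveOn (spray (chartMetricCLM I x₀)) (fun _ => z) (fun _ => 0) univ := by
        intro t _
        refine ⟨hasDerivAt_const _ _, ?_⟩
        simpa using! hasDerivAt_const t (0 : E)
      refine mem_nhdsWithin_of_mem_nhds ?_
      filter_upwards [spray_curve_unique (contDiffAt_spray_chartMetricCLM I (e3 t))
        (isOpen_Ioo.mem_nhds htI) Filter.univ_mem e4 hsp ht.1.2 ht.1.1] with r hr
      exact ⟨hr.2, hr.1⟩
    beta_reduce
    rw [(hvz 1 ⟨zero_le_one, le_rfl⟩).2]
    simp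
  · set w : E := chartVec I x₀ ξ with hw
    obtain ⟨e1, e2, e3, e4⟩ := hyv (e ξ.1) hξz w (by simpa using! hξv)
    set Y := y (e ξ.1) w with hY
    set c : ℝ → B := fun t => e.symm (Y t) with hcdef
    have hc : IsGeodesicOn I c (Ioo (-1) 2) :=
      isGeodesicOn_of_isSprayCurveOn I isOpen_Ioo e4 (fun t _ => e3 t)
    have h0 : (0 : ℝ) ∈ Ioo (-1 : ℝ) 2 := by constructor <;> norm_num
    have hc0 : c 0 = ξ.1 := by rw [hcdef]; simp only; rw [e1, e.left_inv hξ]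
    have hcv : chartVec I x₀ ⟨c 0, mfderiv 𝓘(ℝ, ℝ) I c 0 (1 : ℝ)⟩ = w := by
      have := mfderiv_extChartAt_symm_comp I (x₀ := x₀) (e4 0 h0).1 (e3 0)
      rw [e2] at this
      exact this
    have hexp : IsExp I ξ (c 1) := by
      refine ⟨c, Ioo (-1) 2, hI, hc, ?_, rfl⟩
      exact eq_of_chartVec_eq I hξ hc0 hcv
    have huniq : ∀ p, IsExp I ξ p → p = c 1 := by
      rintro p ⟨c', s', hs01, hc', hini, rfl⟩
      have h00 : (0 : ℝ) ∈ s' := hs01 ⟨le_rfl, zero_le_one⟩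
      have hc'0 : c' 0 = ξ.1 := congrArg TotalSpace.proj hini
      have hd : deriv (e ∘ c') 0 = w := by
        refine (hc'.hasDerivAt_mfderiv I h00 (by rw [hc'0]; exact hξ)).symm.trans ?_
        exact congrArg (chartVec I x₀) hini
      exact hc'.eq_of_isSprayCurveOn I isOpen_Ioo hs01 hI e4 (fun t _ => e3 t)
        (by rw [hc'0]; exact hc0.symm) (by rw [hd]; exact e2.symm)
    have hex : ∃ p, IsExp I ξ p := ⟨_, hexp⟩
    have hval : expMap I ξ = e.symm (Y 1) := by
      rw [expMap, dif_pos hex]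
      exact huniq _ hex.choose_spec
    rw [hval]
    refine ⟨e.map_target (interior_subset (e3 1)), ?_⟩
    rw [e.right_inv (interior_subset (e3 1))]
    change Y 1 = e ξ.1 + w + (Y 1 - e ξ.1 - w)
    abel

end Geodesic

theorem exists_forall_of_eventually {X : Type*} [TopologicalSpace X] [CompactSpace X]
    {P : ℝ → X → Prop} (mono : ∀ x c c', c ≤ c' → P c x → P c' x)
    (loc : ∀ x₀, ∃ c, ∀ᶠ x in 𝓝 x₀, P c x) : ∃ c, 1 ≤ c ∧ ∀ x, P c x := by
  choose c hc using loc
  obtain ⟨t, -, ht⟩ := isCompact_univ.elim_nhds_subcover (fun x₀ => {x | P (c x₀) x})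
    (fun x₀ _ => hc x₀)
  obtain ⟨m, hm⟩ := (t.image c).exists_le
  refine ⟨max 1 m, le_max_left _ _, fun x => ?_⟩
  obtain ⟨x₀, hx₀, hx⟩ := mem_iUnion₂.1 (ht (mem_univ x))
  exact mono x _ _ ((hm _ (Finset.mem_image_of_mem c hx₀)).trans (le_max_right _ _)) hx

/-! ### The charts adapted to the splitting -/

section Charts

variable {E : Type*} [NormedAddCommGroup E] [NormedSpace ℝ E] [FiniteDimensional ℝ E]
  {H : Type*} [TopologicalSpace H] (I : ModelWithCorners ℝ E H)
  {B : Type*} [TopologicalSpace B] [ChartedSpace H B] [IsManifold I ∞ B]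
  [RiemannianBundle (fun x : B => TangentSpace I x)]

theorem continuousOn_chartVec (x₀ : B) :
    ContinuousOn (chartVec I x₀) (TotalSpace.proj ⁻¹' (extChartAt I x₀).source) := by
  have h := (trivializationAt E (TangentSpace I) x₀).continuousOn
  have hs : (trivializationAt E (TangentSpace I) x₀).source =
      (TotalSpace.proj ⁻¹' (extChartAt I x₀).source : Set (TangentBundle I B)) := by
    rw [TangentBundle.trivializationAt_source, extChartAt_source]
  rw [hs] at h
  refine (continuous_snd.comp_continuousOn h).congr fun ξ hξ => ?_
  rw [mem_preimage, extChartAt_source] at hξ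
  have h1 := TangentBundle.continuousLinearMapAt_trivializationAt (I := I) (x₀ := x₀) hξ
  have h2 := DFunLike.congr_fun h1 ξ.2
  refine (Eq.symm ?_).trans rfl
  refine (Eq.trans ?_ h2)
  rw [Trivialization.continuousLinearMapAt_apply, Trivialization.coe_linearMapAt_of_mem _ (by simpa using hξ)]
  rfl

variable {Λ : Set B} {k l : ℕ}
  (φs : ∀ b : Λ, EuclideanSpace ℝ (Fin k) →ₗᵢ[ℝ] TangentSpace I (b : B))
  (φu : ∀ b : Λ, EuclideanSpace ℝ (Fin l) →ₗᵢ[ℝ] TangentSpace I (b : B))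

/-- The tangent vector `φs_b x_s + φu_b x_u`. -/
noncomputable def frameVec (b : Λ) (x : EuclideanSpace ℝ (Fin k) × EuclideanSpace ℝ (Fin l)) :
    TangentSpace I (b : B) :=
  φs b x.1 + φu b x.2

/-- The frame at `b` in the coordinates of the chart at `x₀`. -/
noncomputable def chartFrame (x₀ : B) (b : Λ) :
    EuclideanSpace ℝ (Fin k) × EuclideanSpace ℝ (Fin l) →L[ℝ] E :=
  LinearMap.toContinuousLinearMap
    { toFun := fun x => chartVec I x₀ ⟨b, frameVec I φs φu b x⟩
      map_add' := fun x y => by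
        have h : frameVec I φs φu b (x + y) = frameVec I φs φu b x + frameVec I φs φu b y := by
          simp only [frameVec, Prod.fst_add, Prod.snd_add, map_add]; abel
        rw [h]
        exact (mfderiv I 𝓘(ℝ, E) (extChartAt I x₀) (b : B)).map_add _ _
      map_smul' := fun a x => by
        have h : frameVec I φs φu b (a • x) = a • frameVec I φs φu b x := by
          simp only [frameVec, Prod.smul_fst, Prod.smul_snd, map_smul, smul_add]
        rw [h]
        exact (mfderiv I 𝓘(ℝ, E) (extChartAt I x₀) (b : B)).map_smul _ _ }

variable {I φs φu} {Es Eu : ∀ b : B, Submodule ℝ (TangentSpace I b)}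

theorem frameVec_bijective (hφs : IsIsometricTrivialization I Λ Es φs)
    (hφu : IsIsometricTrivialization I Λ Eu φu) {b : Λ} (hc : IsCompl (Es b) (Eu b)) :
    Function.Bijective (frameVec I φs φu b) := by
  constructor
  · intro x y hxy
    have h1 : φs b (x.1 - y.1) = φu b (y.2 - x.2) := by
      simp only [frameVec] at hxy
      rw [map_sub, map_sub, sub_eq_sub_iff_add_eq_add, hxy, add_comm]
    have hs : φs b (x.1 - y.1) ∈ Es b := by
      rw [← hφs.range_eq b]; exact ⟨_, rfl⟩
    have hu : φs b (x.1 - y.1) ∈ Eu b := by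
      rw [h1, ← hφu.range_eq b]; exact ⟨_, rfl⟩
    have h0 : φs b (x.1 - y.1) = 0 := Submodule.disjoint_def.1 hc.disjoint _ hs hu
    have h2 : x.1 - y.1 = 0 := (map_eq_zero_iff _ (φs b).injective).1 h0
    have h3 : y.2 - x.2 = 0 := (map_eq_zero_iff _ (φu b).injective).1 (h1 ▸ h0)
    exact Prod.ext (sub_eq_zero.1 h2) (sub_eq_zero.1 h3).symm
  · intro w
    have hw : w ∈ Es b ⊔ Eu b := by rw [hc.sup_eq_top]; trivial
    obtain ⟨p, hp, q, hq, rfl⟩ := Submodule.mem_sup.1 hw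
    rw [← hφs.range_eq b] at hp
    rw [← hφu.range_eq b] at hq
    obtain ⟨xs, rfl⟩ := hp
    obtain ⟨xu, rfl⟩ := hq
    exact ⟨(xs, xu), rfl⟩

theorem chartFrame_bijective (hφs : IsIsometricTrivialization I Λ Es φs)
    (hφu : IsIsometricTrivialization I Λ Eu φu) {b : Λ} (hc : IsCompl (Es b) (Eu b)) {x₀ : B}
    (hb : (b : B) ∈ (extChartAt I x₀).source) :
    Function.Bijective (chartFrame I φs φu x₀ b) := by
  obtain ⟨L, hL⟩ := isInvertible_mfderiv_extChartAt (I := I) hb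
  have h1 : Function.Bijective (mfderiv I 𝓘(ℝ, E) (extChartAt I x₀) (b : B)) := by
    rw [← hL]; exact L.bijective
  exact h1.comp (frameVec_bijective hφs hφu hc)

theorem IsIsometricTrivialization.continuousAt_chartVec
    (hφs : IsIsometricTrivialization I Λ Es φs) {x₀ : B} {b : Λ}
    (hb : (b : B) ∈ (extChartAt I x₀).source) (x : EuclideanSpace ℝ (Fin k)) :
    ContinuousAt (fun b : Λ => chartVec I x₀ ⟨b, φs b x⟩) b := by
  have h1 : ContinuousAt (chartVec I x₀) (⟨b, φs b x⟩ : TangentBundle I B) :=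
    (continuousOn_chartVec I x₀).continuousAt
      (((isOpen_extChartAt_source x₀).preimage
        (FiberBundle.continuous_proj E (TangentSpace I))).mem_nhds hb)
  have h2 : Continuous (fun b : Λ => (⟨b, φs b x⟩ : TangentBundle I B)) :=
    hφs.continuous.comp (Continuous.prodMk continuous_id continuous_const)
  exact ContinuousAt.comp (g := chartVec I x₀) (f := fun b : Λ => (⟨b, φs b x⟩ : TangentBundle I B))
    h1 h2.continuousAt

theorem continuousOn_chartFrame (hφs : IsIsometricTrivialization I Λ Es φs)
    (hφu : IsIsometricTrivialization I Λ Eu φu) (x₀ : B) :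
    ContinuousOn (chartFrame I φs φu x₀) {b : Λ | (b : B) ∈ (extChartAt I x₀).source} := by
  rw [continuousOn_clm_apply]
  intro x b hb
  have h : (fun b : Λ => chartFrame I φs φu x₀ b x) = fun b : Λ =>
      chartVec I x₀ ⟨b, φs b x.1⟩ + chartVec I x₀ ⟨b, φu b x.2⟩ := by
    ext b
    exact (mfderiv I 𝓘(ℝ, E) (extChartAt I x₀) (b : B)).map_add _ _
  rw [h]
  exact ((hφs.continuousAt_chartVec hb x.1).add
    (hφu.continuousAt_chartVec hb x.2)).continuousWithinAt

end Charts

section Charts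

variable {E : Type*} [NormedAddCommGroup E] [NormedSpace ℝ E] [FiniteDimensional ℝ E]
  {H : Type*} [TopologicalSpace H] (I : ModelWithCorners ℝ E H)
  {B : Type*} [TopologicalSpace B] [T2Space B] [ChartedSpace H B] [IsManifold I ∞ B]
  [RiemannianBundle (fun x : B => TangentSpace I x)]
  {Λ : Set B} {k l : ℕ}
  (φs : ∀ b : Λ, EuclideanSpace ℝ (Fin k) →ₗᵢ[ℝ] TangentSpace I (b : B))
  (φu : ∀ b : Λ, EuclideanSpace ℝ (Fin l) →ₗᵢ[ℝ] TangentSpace I (b : B))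

/-- In the chart at `x₀`, and near `b`, the adapted chart `φ_b` is `x ↦ b + Φ (x + S x)`, where
`Φ` is the frame at `b` and the Lipschitz constant of `S` on a small ball is of the order of the
radius of the ball. -/
structure IsNormalForm (x₀ : B) (b : Λ) (c : ℝ)
    (Φ : (EuclideanSpace ℝ (Fin k) × EuclideanSpace ℝ (Fin l)) ≃L[ℝ] E)
    (S : EuclideanSpace ℝ (Fin k) × EuclideanSpace ℝ (Fin l) →
      EuclideanSpace ℝ (Fin k) × EuclideanSpace ℝ (Fin l)) : Prop where
  mem_source : (b : B) ∈ (extChartAt I x₀).source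
  apply_eq : ∀ x, Φ x = chartVec I x₀ ⟨b, frameVec I φs φu b x⟩
  norm_le : ∀ x, ‖Φ x‖ ≤ c * ‖x‖
  norm_symm_le : ∀ y, ‖Φ.symm y‖ ≤ c * ‖y‖
  map_zero : S 0 = 0
  lipschitz : ∀ s ≤ 1 / c, ∀ x x', ‖x‖ ≤ s → ‖x'‖ ≤ s → ‖S x - S x'‖ ≤ c * s * ‖x - x'‖
  chart_mem : ∀ x, ‖x‖ ≤ 1 / c → baseChart I φs φu b x ∈ (extChartAt I x₀).source
  chart_eq : ∀ x, ‖x‖ ≤ 1 / c →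
    extChartAt I x₀ (baseChart I φs φu b x) = extChartAt I x₀ b + Φ (x + S x)

variable {I φs φu}

theorem IsNormalForm.mono {x₀ : B} {b : Λ} {c c' : ℝ}
    {Φ : (EuclideanSpace ℝ (Fin k) × EuclideanSpace ℝ (Fin l)) ≃L[ℝ] E}
    {S : EuclideanSpace ℝ (Fin k) × EuclideanSpace ℝ (Fin l) →
      EuclideanSpace ℝ (Fin k) × EuclideanSpace ℝ (Fin l)}
    (h : IsNormalForm I φs φu x₀ b c Φ S) (hc : 0 < c) (hcc : c ≤ c') :
    IsNormalForm I φs φu x₀ b c' Φ S := by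
  have hle : 1 / c' ≤ 1 / c := one_div_le_one_div_of_le hc hcc
  refine ⟨h.mem_source, h.apply_eq, fun x => (h.norm_le x).trans (by gcongr),
    fun x => (h.norm_symm_le x).trans (by gcongr), h.map_zero, fun s hs x x' hx hx' => ?_,
    fun x hx => h.chart_mem x (hx.trans hle), fun x hx => h.chart_eq x (hx.trans hle)⟩
  have hs0 : 0 ≤ s := (norm_nonneg _).trans hx
  exact (h.lipschitz s (hs.trans hle) x x' hx hx').trans (by gcongr)

variable [IsContMDiffRiemannianBundle I ∞ E (fun x : B => TangentSpace I x)]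
  {Es Eu : ∀ b : B, Submodule ℝ (TangentSpace I b)}

theorem exists_isNormalForm (hφs : IsIsometricTrivialization I Λ Es φs)
    (hφu : IsIsometricTrivialization I Λ Eu φu) (b₀ : Λ) (hint : I.IsInteriorPoint (b₀ : B))
    (hcompl : ∀ b ∈ Λ, IsCompl (Es b) (Eu b)) :
    ∃ c, 1 ≤ c ∧ ∀ᶠ b in 𝓝 b₀, (∃ Φ S, IsNormalForm I φs φu (b₀ : B) b c Φ S) ∧
      ∀ x, ‖x‖ ≤ 1 / c → ContinuousWithinAt
        (fun p : Λ × (EuclideanSpace ℝ (Fin k) × EuclideanSpace ℝ (Fin l)) =>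
          baseChart I φs φu p.1 p.2) (univ ×ˢ Metric.closedBall 0 (1 / c)) (b, x) := by
  obtain ⟨r, hr, C, hC, R, hRL, hR0, hR⟩ := exists_expMap_expansion I (b₀ : B) hint
  set e := extChartAt I (b₀ : B) with he
  set Φ := chartFrame I φs φu (b₀ : B) with hΦ
  have hsrc : ∀ᶠ b : Λ in 𝓝 b₀, (b : B) ∈ e.source :=
    continuousAt_subtype_val.preimage_mem_nhds
      ((isOpen_extChartAt_source _).mem_nhds (mem_extChartAt_source _))
  have hball : ∀ᶠ b : Λ in 𝓝 b₀, e b ∈ Metric.closedBall (e b₀) r :=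
    ((continuousAt_extChartAt (I := I) (b₀ : B)).comp
      (continuousAt_subtype_val (x := b₀))).preimage_mem_nhds (Metric.closedBall_mem_nhds _ hr)
  have hΦc : ContinuousAt Φ b₀ := (continuousOn_chartFrame hφs hφu (b₀ : B)).continuousAt hsrc
  have hbij : ∀ b : Λ, (b : B) ∈ e.source → Function.Bijective (Φ b) := fun b hb =>
    chartFrame_bijective hφs hφu (hcompl b b.2) hb
  let Ψ : ∀ b : Λ, (b : B) ∈ e.source →
      (EuclideanSpace ℝ (Fin k) × EuclideanSpace ℝ (Fin l)) ≃L[ℝ] E := fun b hb =>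
    (LinearEquiv.ofBijective (Φ b).toLinearMap (hbij b hb)).toContinuousLinearEquiv
  have hΨ : ∀ b hb x, Ψ b hb x = Φ b x := fun b hb x => rfl
  -- bounds for the frames
  set Ψ₀ := Ψ b₀ (mem_extChartAt_source _) with hΨ₀
  set a : ℝ := ‖(Ψ₀.symm : E →L[ℝ] EuclideanSpace ℝ (Fin k) × EuclideanSpace ℝ (Fin l))‖ + 1
    with ha
  have ha0 : 0 < a := by positivity
  have hlow₀ : ∀ x, ‖x‖ ≤ a * ‖Φ b₀ x‖ := fun x => by
    have h1 := (Ψ₀.symm : E →L[ℝ] EuclideanSpace ℝ (Fin k) × EuclideanSpace ℝ (Fin l)).le_opNorm (Ψ₀ x)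
    have h2 : (Ψ₀.symm : E →L[ℝ] EuclideanSpace ℝ (Fin k) × EuclideanSpace ℝ (Fin l)) (Ψ₀ x) = x :=
      Ψ₀.symm_apply_apply x
    rw [h2, hΨ _ (mem_extChartAt_source _)] at h1
    exact h1.trans (by gcongr; linarith)
  have hnear : ∀ᶠ b in 𝓝 b₀, ‖Φ b - Φ b₀‖ ≤ 1 / (2 * a) := by
    have := hΦc.preimage_mem_nhds (Metric.closedBall_mem_nhds _ (by positivity : 0 < 1 / (2 * a)))
    filter_upwards [this] with b hb
    rwa [mem_preimage, mem_closedBall_iff_norm] at hb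
  set m : ℝ := ‖Φ b₀‖ + 1 / (2 * a) with hm
  have hm0 : 0 < m := by positivity
  have hup : ∀ b, ‖Φ b - Φ b₀‖ ≤ 1 / (2 * a) → ∀ x, ‖Φ b x‖ ≤ m * ‖x‖ := fun b hb x => by
    have : ‖Φ b‖ ≤ m := by
      calc ‖Φ b‖ = ‖Φ b₀ + (Φ b - Φ b₀)‖ := by congr 1; abel
        _ ≤ m := (norm_add_le _ _).trans (add_le_add le_rfl hb)
    exact ((Φ b).le_opNorm x).trans (by gcongr)
  have hlow : ∀ b, ‖Φ b - Φ b₀‖ ≤ 1 / (2 * a) → ∀ x, ‖x‖ ≤ 2 * a * ‖Φ b x‖ := fun b hb x => by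
    have h1 : ‖Φ b₀ x‖ ≤ ‖Φ b x‖ + 1 / (2 * a) * ‖x‖ := by
      calc ‖Φ b₀ x‖ = ‖Φ b x - (Φ b - Φ b₀) x‖ := by congr 1; rw [sub_apply]; abel
        _ ≤ _ := (norm_sub_le _ _).trans (by
          gcongr
          exact ((Φ b - Φ b₀).le_opNorm x).trans (by gcongr))
    have h2 : ‖x‖ ≤ a * (‖Φ b x‖ + 1 / (2 * a) * ‖x‖) := (hlow₀ x).trans (by gcongr)
    have h3 : a * (‖Φ b x‖ + 1 / (2 * a) * ‖x‖) = a * ‖Φ b x‖ + ‖x‖ / 2 := by field_simp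
    linarith
  set c : ℝ := max (max 1 (m / r)) (max (max m (2 * a)) (2 * a * C * m ^ 2)) with hc
  have hc1 : 1 ≤ c := (le_max_left _ _).trans (le_max_left _ _)
  have hcr : m / r ≤ c := (le_max_right _ _).trans (le_max_left _ _)
  have hcm : m ≤ c := ((le_max_left _ _).trans (le_max_left _ _)).trans (le_max_right _ _)
  have hca : 2 * a ≤ c := ((le_max_right _ _).trans (le_max_left _ _)).trans (le_max_right _ _)
  have hcC : 2 * a * C * m ^ 2 ≤ c := (le_max_right _ _).trans (le_max_right _ _)
  have hc0 : 0 < c := by linarith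
  have hmr : ∀ s, s ≤ 1 / c → m * s ≤ r := fun s hs => by
    have : m ≤ c * r := by rwa [div_le_iff₀ hr] at hcr
    calc m * s ≤ m * (1 / c) := by gcongr
      _ = m / c := by ring
      _ ≤ r := by rw [div_le_iff₀ hc0]; linarith
  have hexp : ∀ b : Λ, (b : B) ∈ e.source → e b ∈ Metric.closedBall (e b₀) r →
      ‖Φ b - Φ b₀‖ ≤ 1 / (2 * a) → ∀ x, ‖x‖ ≤ 1 / c →
      baseChart I φs φu b x ∈ e.source ∧
        e (baseChart I φs φu b x) = e b + Φ b x + R (e b) (Φ b x) := fun b h1 h2 h3 x hx =>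
    hR ⟨b, frameVec I φs φu b x⟩ h1 h2 ((hup b h3 x).trans (hmr _ hx))
  refine ⟨c, hc1, ?_⟩
  have hall := (hsrc.and (hball.and hnear))
  obtain ⟨U, hU, hUo, hbU⟩ := mem_nhds_iff.1 hall
  filter_upwards [hUo.mem_nhds hbU] with b hb
  obtain ⟨hb1, hb2, hb3⟩ := hU hb
  have hsymm : ∀ y, ‖(Ψ b hb1).symm y‖ ≤ 2 * a * ‖y‖ := fun y => by
    have h := hlow b hb3 ((Ψ b hb1).symm y)
    have h' : Φ b ((Ψ b hb1).symm y) = y := (Ψ b hb1).apply_symm_apply y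
    rwa [h'] at h
  constructor
  · refine ⟨Ψ b hb1, fun x => (Ψ b hb1).symm (R (e b) (Φ b x)), hb1, fun x => rfl,
      fun x => (hup b hb3 x).trans (by gcongr), fun y => ?_, ?_, fun s hs x x' hx hx' => ?_,
      fun x hx => (hexp b hb1 hb2 hb3 x hx).1, fun x hx => ?_⟩
    · exact (hsymm y).trans (by gcongr)
    · simp only [_root_.map_zero]
      rw [hR0 _ hb2, _root_.map_zero]
    · have hs0 : 0 ≤ s := (norm_nonneg _).trans hx
      rw [← map_sub]
      have h1 := hsymm (R (e b) (Φ b x) - R (e b) (Φ b x'))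
      have h2 := hRL (m * s) (hmr s hs) (e b) hb2 (e b) hb2 (Φ b x)
        (by rw [mem_closedBall_zero_iff]; exact (hup b hb3 x).trans (by gcongr)) (Φ b x')
        (by rw [mem_closedBall_zero_iff]; exact (hup b hb3 x').trans (by gcongr))
      rw [sub_self, norm_zero, zero_add, ← map_sub] at h2
      calc _ ≤ 2 * a * (C * (m * s) * (m * ‖x - x'‖)) := by
            refine h1.trans ?_
            gcongr
            refine h2.trans ?_
            gcongr
            exact hup b hb3 _
        _ = 2 * a * C * m ^ 2 * (s * ‖x - x'‖) := by ring
        _ ≤ c * (s * ‖x - x'‖) := by gcongr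
        _ = _ := by ring
    · rw [(hexp b hb1 hb2 hb3 x hx).2, map_add, (Ψ b hb1).apply_symm_apply, hΨ b hb1, add_assoc]
  · intro x hx
    set D : Set (Λ × (EuclideanSpace ℝ (Fin k) × EuclideanSpace ℝ (Fin l))) :=
      U ×ˢ Metric.closedBall 0 (1 / c) with hD
    have hΦon : ContinuousOn (fun p : Λ × (EuclideanSpace ℝ (Fin k) × EuclideanSpace ℝ (Fin l)) =>
        Φ p.1 p.2) D := by
      refine ContinuousOn.clm_apply ?_ continuousOn_snd
      exact (continuousOn_chartFrame hφs hφu (b₀ : B)).comp continuousOn_fst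
        fun p hp => (hU hp.1).1
    have heon : ContinuousOn (fun p : Λ × (EuclideanSpace ℝ (Fin k) × EuclideanSpace ℝ (Fin l)) =>
        e p.1) D :=
      (continuousOn_extChartAt (b₀ : B)).comp
        (continuous_subtype_val.comp continuous_fst).continuousOn fun p hp => (hU hp.1).1
    have hRon : ContinuousOn (fun q : E × E => R q.1 q.2)
        (Metric.closedBall (e b₀) r ×ˢ Metric.closedBall 0 r) := by
      refine LipschitzOnWith.continuousOn (K := Real.toNNReal (2 * (C * r)))
        (LipschitzOnWith.of_dist_le_mul fun q hq q' hq' => ?_)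
      have := hRL r le_rfl q.1 hq.1 q'.1 hq'.1 q.2 hq.2 q'.2 hq'.2
      rw [Real.coe_toNNReal _ (by positivity), dist_eq_norm, dist_eq_norm]
      refine this.trans ?_
      have h1 : ‖q.1 - q'.1‖ ≤ ‖q - q'‖ := norm_fst_le (q - q')
      have h2 : ‖q.2 - q'.2‖ ≤ ‖q - q'‖ := norm_snd_le (q - q')
      calc C * r * (‖q.1 - q'.1‖ + ‖q.2 - q'.2‖) ≤ C * r * (‖q - q'‖ + ‖q - q'‖) := by gcongr
        _ = _ := by ring
    have hon : ContinuousOn (fun p : Λ × (EuclideanSpace ℝ (Fin k) × EuclideanSpace ℝ (Fin l)) =>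
        e p.1 + Φ p.1 p.2 + R (e p.1) (Φ p.1 p.2)) D := by
      refine (heon.add hΦon).add (hRon.comp (heon.prodMk hΦon) fun p hp => ⟨(hU hp.1).2.1, ?_⟩)
      rw [mem_closedBall_zero_iff]
      have hp2 : ‖p.2‖ ≤ 1 / c := by simpa using hp.2
      exact (hup _ (hU hp.1).2.2 _).trans (hmr _ hp2)
    have hmain : ContinuousOn (fun p : Λ × (EuclideanSpace ℝ (Fin k) × EuclideanSpace ℝ (Fin l)) =>
        baseChart I φs φu p.1 p.2) D := by
      refine ((continuousOn_extChartAt_symm (I := I) (b₀ : B)).comp hon fun p hp => ?_).congr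
        fun p hp => ?_
      · have hp2 : ‖p.2‖ ≤ 1 / c := by simpa using hp.2
        obtain ⟨h1, h2⟩ := hexp p.1 (hU hp.1).1 (hU hp.1).2.1 (hU hp.1).2.2 p.2 hp2
        rw [← h2]
        exact e.map_source h1
      · have hp2 : ‖p.2‖ ≤ 1 / c := by simpa using hp.2
        obtain ⟨h1, h2⟩ := hexp p.1 (hU hp.1).1 (hU hp.1).2.1 (hU hp.1).2.2 p.2 hp2
        simp only [Function.comp]
        rw [← h2, e.left_inv h1]
    have hx' : ((b, x) : Λ × (EuclideanSpace ℝ (Fin k) × EuclideanSpace ℝ (Fin l))) ∈ D :=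
      ⟨hb, by simpa using hx⟩
    refine (hmain _ hx').mono_of_mem_nhdsWithin ?_
    rw [hD, show U ×ˢ Metric.closedBall (0 : EuclideanSpace ℝ (Fin k) × EuclideanSpace ℝ (Fin l))
      (1 / c) = (univ ×ˢ Metric.closedBall 0 (1 / c)) ∩ (U ×ˢ univ) by
        ext p; simp [and_comm]]
    exact Filter.inter_mem self_mem_nhdsWithin (mem_nhdsWithin_of_mem_nhds
      ((hUo.prod isOpen_univ).mem_nhds ⟨hb, trivial⟩))

end Charts

theorem approximatesLinearOn_add_of_lipschitz {V : Type*} [NormedAddCommGroup V] [NormedSpace ℝ V]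
    {W : Set V} {S : V → V} (hS : ∀ x ∈ W, ∀ x' ∈ W, ‖S x - S x'‖ ≤ 1 / 2 * ‖x - x'‖) :
    ApproximatesLinearOn (fun x => x + S x)
      ((ContinuousLinearEquiv.refl ℝ V : V ≃L[ℝ] V) : V →L[ℝ] V) W (1 / 2) := fun x hx x' hx' => by
  simp only [ContinuousLinearEquiv.coe_refl, ContinuousLinearMap.coe_id', id]
  rw [show x + S x - (x' + S x') - (x - x') = S x - S x' by abel]
  exact_mod_cast hS x hx x' hx'

theorem isOpen_image_add_of_lipschitz {V : Type*} [NormedAddCommGroup V] [NormedSpace ℝ V]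
    [CompleteSpace V] {W : Set V} (hW : IsOpen W) {S : V → V}
    (hS : ∀ x ∈ W, ∀ x' ∈ W, ‖S x - S x'‖ ≤ 1 / 2 * ‖x - x'‖) :
    IsOpen ((fun x => x + S x) '' W) := by
  have hT := approximatesLinearOn_add_of_lipschitz hS
  refine hT.open_image (ContinuousLinearEquiv.refl ℝ V).toNonlinearRightInverse hW ?_
  rcases subsingleton_or_nontrivial V with hV | hV
  · exact Or.inl hV
  · right
    have : ((ContinuousLinearEquiv.refl ℝ V).toNonlinearRightInverse).nnnorm = 1 := by
      simp only [ContinuousLinearEquiv.toNonlinearRightInverse]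
      ext
      exact ContinuousLinearMap.norm_id
    rw [this, inv_one]
    exact NNReal.half_lt_self one_ne_zero

section Charts

variable {E : Type*} [NormedAddCommGroup E] [NormedSpace ℝ E] [FiniteDimensional ℝ E]
  {H : Type*} [TopologicalSpace H] {I : ModelWithCorners ℝ E H}
  {B : Type*} [TopologicalSpace B] [T2Space B] [ChartedSpace H B] [IsManifold I ∞ B]
  [RiemannianBundle (fun x : B => TangentSpace I x)]
  {Λ : Set B} {k l : ℕ}
  {φs : ∀ b : Λ, EuclideanSpace ℝ (Fin k) →ₗᵢ[ℝ] TangentSpace I (b : B)}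
  {φu : ∀ b : Λ, EuclideanSpace ℝ (Fin l) →ₗᵢ[ℝ] TangentSpace I (b : B)}

namespace IsNormalForm

variable {x₀ : B} {b : Λ} {c : ℝ}
  {Φ : (EuclideanSpace ℝ (Fin k) × EuclideanSpace ℝ (Fin l)) ≃L[ℝ] E}
  {S : EuclideanSpace ℝ (Fin k) × EuclideanSpace ℝ (Fin l) →
    EuclideanSpace ℝ (Fin k) × EuclideanSpace ℝ (Fin l)}

theorem lipschitz_half (h : IsNormalForm I φs φu x₀ b c Φ S) (hc : 0 < c)
    {x x' : EuclideanSpace ℝ (Fin k) × EuclideanSpace ℝ (Fin l)}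
    (hx : ‖x‖ ≤ 1 / (2 * c)) (hx' : ‖x'‖ ≤ 1 / (2 * c)) :
    ‖S x - S x'‖ ≤ 1 / 2 * ‖x - x'‖ := by
  have h1 : 1 / (2 * c) ≤ 1 / c := one_div_le_one_div_of_le hc (by linarith)
  refine (h.lipschitz _ h1 x x' hx hx').trans (le_of_eq ?_)
  field_simp

theorem radius_le (hc : 0 < c) : 1 / (2 * c) ≤ 1 / c :=
  one_div_le_one_div_of_le hc (by linarith)

theorem injOn (h : IsNormalForm I φs φu x₀ b c Φ S) (hc : 0 < c) :
    InjOn (baseChart I φs φu b) (Metric.closedBall 0 (1 / (2 * c))) := by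
  intro x hx x' hx' hxx
  rw [mem_closedBall_zero_iff] at hx hx'
  have h1 := h.chart_eq x (hx.trans (radius_le hc))
  rw [hxx, h.chart_eq x' (hx'.trans (radius_le hc)), add_right_inj, Φ.injective.eq_iff] at h1
  have h2 := h.lipschitz_half hc hx hx'
  have h3 : S x - S x' = -(x - x') := by
    have : S x - S x' = (x + S x) - (x' + S x') - (x - x') := by abel
    rw [this, h1]; abel
  rw [h3, norm_neg] at h2
  have : ‖x - x'‖ = 0 := by linarith [norm_nonneg (x - x')]
  exact sub_eq_zero.1 (norm_eq_zero.1 this)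

theorem isOpen_image (h : IsNormalForm I φs φu x₀ b c Φ S) (hc : 0 < c)
    {W : Set (EuclideanSpace ℝ (Fin k) × EuclideanSpace ℝ (Fin l))} (hW : IsOpen W)
    (hWs : W ⊆ Metric.closedBall 0 (1 / (2 * c))) : IsOpen (baseChart I φs φu b '' W) := by
  have hopen : IsOpen ((fun x => x + S x) '' W) := isOpen_image_add_of_lipschitz hW
    fun x hx x' hx' => h.lipschitz_half hc (mem_closedBall_zero_iff.1 (hWs hx))
      (mem_closedBall_zero_iff.1 (hWs hx'))
  have hopen' : IsOpen ((fun y => extChartAt I x₀ b + Φ y) '' ((fun x => x + S x) '' W)) := by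
    have : IsOpenMap fun y => extChartAt I x₀ b + Φ y :=
      (Homeomorph.addLeft (extChartAt I x₀ (b : B))).isOpenMap.comp Φ.toHomeomorph.isOpenMap
    exact this _ hopen
  have heq : baseChart I φs φu b '' W = (extChartAt I x₀).source ∩ extChartAt I x₀ ⁻¹'
      ((fun y => extChartAt I x₀ b + Φ y) '' ((fun x => x + S x) '' W)) := by
    have hle : ∀ x ∈ W, ‖x‖ ≤ 1 / c := fun x hx =>
      (mem_closedBall_zero_iff.1 (hWs hx)).trans (radius_le hc)
    ext p
    constructor
    · rintro ⟨x, hx, rfl⟩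
      exact ⟨h.chart_mem x (hle x hx), _, ⟨x, hx, rfl⟩, (h.chart_eq x (hle x hx)).symm⟩
    · rintro ⟨hp, -, ⟨x, hx, rfl⟩, hxp⟩
      refine ⟨x, hx, (extChartAt I x₀).injOn (h.chart_mem x (hle x hx)) hp ?_⟩
      rw [h.chart_eq x (hle x hx)]
      exact hxp
  rw [heq]
  exact (continuousOn_extChartAt x₀).isOpen_inter_preimage (isOpen_extChartAt_source x₀) hopen'

end IsNormalForm

variable [IsContMDiffRiemannianBundle I ∞ E (fun x : B => TangentSpace I x)]
  {Es Eu : ∀ b : B, Submodule ℝ (TangentSpace I b)} [CompactSpace Λ]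

theorem exists_chart_radius (hφs : IsIsometricTrivialization I Λ Es φs)
    (hφu : IsIsometricTrivialization I Λ Eu φu) (hint : ∀ b ∈ Λ, I.IsInteriorPoint b)
    (hcompl : ∀ b ∈ Λ, IsCompl (Es b) (Eu b)) :
    ∃ r > 0, (∀ b, InjOn (baseChart I φs φu b) (Metric.closedBall 0 r)) ∧
      ContinuousOn (fun p : Λ × (EuclideanSpace ℝ (Fin k) × EuclideanSpace ℝ (Fin l)) =>
        baseChart I φs φu p.1 p.2) (univ ×ˢ Metric.closedBall 0 r) ∧
      ∀ δ, δ ≤ r → IsAdmissibleRadius (baseChart I φs φu) δ := by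
  let P : ℝ → Λ → Prop := fun c b => 1 ≤ c ∧
      InjOn (baseChart I φs φu b) (Metric.closedBall 0 (1 / c)) ∧
      (∀ W : Set (EuclideanSpace ℝ (Fin k) × EuclideanSpace ℝ (Fin l)), IsOpen W →
        W ⊆ Metric.closedBall 0 (1 / c) → IsOpen (baseChart I φs φu b '' W)) ∧
      ∀ x, ‖x‖ ≤ 1 / c → ContinuousWithinAt
        (fun p : Λ × (EuclideanSpace ℝ (Fin k) × EuclideanSpace ℝ (Fin l)) =>
          baseChart I φs φu p.1 p.2) (univ ×ˢ Metric.closedBall 0 (1 / c)) (b, x)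
  have mono : ∀ b c c', c ≤ c' → P c b → P c' b := by
    rintro b c c' hcc ⟨hc, hP⟩
    have hle : 1 / c' ≤ 1 / c := one_div_le_one_div_of_le (by linarith) hcc
    have hsub := Metric.closedBall_subset_closedBall
      (x := (0 : EuclideanSpace ℝ (Fin k) × EuclideanSpace ℝ (Fin l))) hle
    obtain ⟨h1, h2, h3⟩ := hP
    exact ⟨hc.trans hcc, h1.mono hsub, fun W hW hWs => h2 W hW (hWs.trans hsub), fun x hx =>
      (h3 x (hx.trans hle)).mono (prod_mono_right hsub)⟩
  have loc : ∀ b₀, ∃ c, ∀ᶠ b in 𝓝 b₀, P c b := by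
    intro b₀
    obtain ⟨c, hc1, hc⟩ := exists_isNormalForm hφs hφu b₀ (hint b₀ b₀.2) hcompl
    have hc0 : 0 < c := by linarith
    have hle := IsNormalForm.radius_le hc0
    refine ⟨2 * c, ?_⟩
    filter_upwards [hc] with b hb
    obtain ⟨⟨Φ, S, hn⟩, hcont⟩ := hb
    exact ⟨by linarith, hn.injOn hc0, fun W hW hWs => hn.isOpen_image hc0 hW hWs, fun x hx =>
      (hcont x (hx.trans hle)).mono (prod_mono_right (Metric.closedBall_subset_closedBall hle))⟩
  obtain ⟨c, hc1, hc⟩ := exists_forall_of_eventually mono loc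
  obtain hc := fun b => (hc b).2
  have hon : ContinuousOn (fun p : Λ × (EuclideanSpace ℝ (Fin k) × EuclideanSpace ℝ (Fin l)) =>
      baseChart I φs φu p.1 p.2) (univ ×ˢ Metric.closedBall 0 (1 / c)) := fun p hp =>
    (hc p.1).2.2 p.2 (by simpa using hp.2)
  refine ⟨1 / c, by positivity, fun b => (hc b).1, hon, fun δ hδ b => ?_⟩
  have hi : IsOpenEmbedding (fun x : Q k δ × Q l δ =>
      ((x.1, x.2) : EuclideanSpace ℝ (Fin k) × EuclideanSpace ℝ (Fin l))) :=
    (Metric.isOpen_ball.isOpenEmbedding_subtypeVal).prodMap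
      (Metric.isOpen_ball.isOpenEmbedding_subtypeVal)
  have hmem : ∀ x : Q k δ × Q l δ, ((x.1, x.2) : EuclideanSpace ℝ (Fin k) ×
      EuclideanSpace ℝ (Fin l)) ∈ Metric.closedBall 0 (1 / c) := fun x => by
    have h1 := x.1.2
    have h2 := x.2.2
    rw [mem_ball_zero_iff] at h1 h2
    rw [mem_closedBall_zero_iff, Prod.norm_mk]
    exact max_le (h1.le.trans hδ) (h2.le.trans hδ)
  refine IsOpenEmbedding.of_continuous_injective_isOpenMap ?_ ?_ ?_
  · exact hon.comp_continuous (continuous_const.prodMk hi.continuous) fun x =>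
      ⟨trivial, hmem x⟩
  · intro x y hxy
    exact hi.injective ((hc b).1 (hmem x) (hmem y) hxy)
  · intro U hU
    have := (hc b).2.1 _ (hi.isOpenMap U hU) (by rintro - ⟨x, -, rfl⟩; exact hmem x)
    rwa [image_image] at this

end Charts

section ChartEstimates

variable {E : Type*} [NormedAddCommGroup E] [NormedSpace ℝ E]
  {H : Type*} [TopologicalSpace H] (I : ModelWithCorners ℝ E H)
  {X : Type*} [TopologicalSpace X] [ChartedSpace H X] [IsManifold I ∞ X]

/-- The differential of a vector-valued function, applied to a tangent vector. -/
noncomputable def vectorDeriv {F : Type*} [NormedAddCommGroup F] [NormedSpace ℝ F] (g : X → F)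
    (ξ : TangentBundle I X) : F :=
  mfderiv I 𝓘(ℝ, F) g ξ.1 ξ.2

theorem mfderivWithin_symm_chartVec {x₀ : X} {ξ : TangentBundle I X}
    (hξ : ξ.1 ∈ (extChartAt I x₀).source) :
    (mfderivWithin 𝓘(ℝ, E) I (extChartAt I x₀).symm (range I) (extChartAt I x₀ ξ.1) :
      E →L[ℝ] E) (chartVec (E := E) I x₀ ξ) = ξ.2 := by
  have : IsManifold I 1 X := IsManifold.of_le (n := ∞) one_le_smooth
  have h := mfderivWithin_extChartAt_symm_comp_mfderiv_extChartAt'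
    (I := I) (x := x₀) (y := ξ.1) hξ
  exact congrArg (fun L : E →L[ℝ] E => L ξ.2) h

theorem exists_chart_estimate_of_immersion [FiniteDimensional ℝ E] [CompactSpace X]
    {F : Type*} [NormedAddCommGroup F] [NormedSpace ℝ F] {ι : X → F}
    (hι : ContMDiff I 𝓘(ℝ, F) ∞ ι) (hinj : Function.Injective ι)
    (himm : ∀ x, Function.Injective (mfderiv I 𝓘(ℝ, F) ι x)) (x₀ : X) {U : Set X}
    (hU : U ∈ 𝓝 x₀) :
    ∃ c, 1 ≤ c ∧ ∀ᶠ y in 𝓝 x₀, y ∈ U ∧ ∀ x τ, τ ≤ 1 / c → ‖ι x - ι y‖ ≤ τ →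
      x ∈ U ∧ x ∈ (extChartAt I x₀).source ∧
      ‖extChartAt I x₀ x - extChartAt I x₀ y‖ ≤ c * τ ∧
      ∀ (ξ η : TangentBundle I X) (s : ℝ), ξ.1 = x → η.1 = y → ‖chartVec I x₀ η‖ ≤ s →
        ‖vectorDeriv I ι ξ - vectorDeriv I ι η‖ ≤ τ * s →
        ‖chartVec I x₀ ξ - chartVec I x₀ η‖ ≤ c * τ * s := by
  have : IsManifold I 1 X := IsManifold.of_le (n := ∞) one_le_smooth
  set ψ := extChartAt I x₀ with hψ
  set a₀ := ψ x₀ with ha₀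
  set f : E → F := ι ∘ ψ.symm with hf
  set f' := fderivWithin ℝ f (range I) with hf'
  have ha₀r : a₀ ∈ range I := extChartAt_target_subset_range x₀ (mem_extChartAt_target x₀)
  have hfc : ContDiffWithinAt ℝ ∞ f (range I) a₀ := (contMDiffAt_iff.1 (hι x₀)).2
  have hder : ∀ a ∈ ψ.target, HasFDerivWithinAt f (f' a) (range I) a := fun a ha => by
    have h1 : MDifferentiableWithinAt 𝓘(ℝ, E) 𝓘(ℝ, F) f (range I) a :=
      ((hι _).mdifferentiableAt (by simp)).comp_mdifferentiableWithinAt a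
        (mdifferentiableWithinAt_extChartAt_symm ha)
    exact h1.differentiableWithinAt.hasFDerivWithinAt
  have hchain : ∀ ξ : TangentBundle I X, ξ.1 ∈ ψ.source →
      f' (ψ ξ.1) (chartVec I x₀ ξ) = vectorDeriv I ι ξ := fun ξ hξ => by
    have hu : UniqueMDiffWithinAt 𝓘(ℝ, E) (range I) (ψ ξ.1) :=
      (I.uniqueDiffOn _ (extChartAt_target_subset_range x₀ (ψ.map_source hξ))).uniqueMDiffWithinAt
    have h2 : mfderivWithin 𝓘(ℝ, E) 𝓘(ℝ, F) f (range I) (ψ ξ.1) =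
        (mfderiv I 𝓘(ℝ, F) ι (ψ.symm (ψ ξ.1))).comp
          (mfderivWithin 𝓘(ℝ, E) I ψ.symm (range I) (ψ ξ.1)) :=
      mfderiv_comp_mfderivWithin _ ((hι _).mdifferentiableAt (by simp))
        (mdifferentiableWithinAt_extChartAt_symm (ψ.map_source hξ)) hu
    rw [hf', ← mfderivWithin_eq_fderivWithin, h2]
    have h3 : ∀ x, x = ξ.1 → ∀ v w : E, v = w → (mfderiv I 𝓘(ℝ, F) ι x : E → F) v =
      (mfderiv I 𝓘(ℝ, F) ι ξ.1 : E → F) w := by rintro x rfl v w rfl; rfl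
    exact h3 _ (ψ.left_inv hξ) _ _ (mfderivWithin_symm_chartVec I hξ)
  set L : E →L[ℝ] F := f' a₀ with hL
  have hLinj : LinearMap.ker (L : E →ₗ[ℝ] F) = ⊥ := by
    refine LinearMap.ker_eq_bot'.2 fun v hv => ?_
    obtain ⟨Λ, hΛ⟩ := isInvertible_mfderiv_extChartAt (I := I) (mem_extChartAt_source x₀)
    let ξ : TangentBundle I X := ⟨x₀, Λ.symm v⟩
    have h1 : chartVec I x₀ ξ = v := by
      have h2 : Λ (Λ.symm v) = v := Λ.apply_symm_apply v
      refine Eq.trans ?_ h2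
      exact congrArg (fun L : E →L[ℝ] E => L (Λ.symm v)) hΛ.symm
    have h2 := hchain ξ (mem_extChartAt_source x₀)
    rw [h1] at h2
    have h3 : Λ.symm v = 0 := (injective_iff_map_eq_zero _).1 (himm x₀) _ (h2.symm.trans hv)
    exact (map_eq_zero_iff _ Λ.symm.injective).1 h3
  obtain ⟨K, hK, hKL⟩ := (L : E →ₗ[ℝ] F).exists_antilipschitzWith hLinj
  have hLK : ∀ v, ‖v‖ ≤ K * ‖L v‖ := fun v => by
    have := hKL.le_mul_dist v 0
    simpa using this
  have hf'c : ContDiffWithinAt ℝ 1 f' (range I) a₀ :=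
    hfc.fderivWithin_right I.uniqueDiffOn two_le_smooth ha₀r
  obtain ⟨K', t, ht, hK't⟩ := hf'c.exists_lipschitzOnWith I.convex_range
  have hclose : {a | ‖f' a - L‖ ≤ 1 / (2 * K)} ∈ 𝓝[range I] a₀ := by
    have := hf'c.continuousWithinAt.preimage_mem_nhdsWithin
      (Metric.closedBall_mem_nhds _ (by positivity : (0 : ℝ) < 1 / (2 * K)))
    filter_upwards [this] with a ha
    rwa [mem_preimage, mem_closedBall_iff_norm] at ha
  obtain ⟨r, hr, hrs⟩ := Metric.mem_nhdsWithin_iff.1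
    (Filter.inter_mem (extChartAt_target_mem_nhdsWithin x₀) (Filter.inter_mem ht hclose))
  set S := Metric.ball a₀ r ∩ range I with hS
  have hSconv : Convex ℝ S := (convex_ball _ _).inter I.convex_range
  have hderS : ∀ a ∈ S, HasFDerivWithinAt f (f' a) S a := fun a ha =>
    (hder a (hrs ha).1).mono inter_subset_right
  have hanti : ∀ a ∈ S, ∀ a' ∈ S, ‖a - a'‖ ≤ 2 * K * ‖f a - f a'‖ := fun a ha a' ha' => by
    have h1 := Convex.norm_image_sub_le_of_norm_hasFDerivWithin_le' hderS
      (fun z hz => (hrs hz).2.2) hSconv ha' ha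
    have h2 := hLK (a - a')
    have h3 : ‖L (a - a')‖ ≤ ‖f a - f a'‖ + ‖f a - f a' - L (a - a')‖ := by
      calc ‖L (a - a')‖ = ‖(f a - f a') - (f a - f a' - L (a - a'))‖ := by congr 1; abel
        _ ≤ _ := norm_sub_le _ _
    have h4 : ‖a - a'‖ ≤ K * (‖f a - f a'‖ + 1 / (2 * K) * ‖a - a'‖) :=
      h2.trans (by gcongr; linarith)
    have h5 : K * (‖f a - f a'‖ + 1 / (2 * K) * ‖a - a'‖) = K * ‖f a - f a'‖ + ‖a - a'‖ / 2 := by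
      field_simp
    linarith
  have hvec : ∀ a ∈ S, ∀ v, ‖v‖ ≤ 2 * K * ‖f' a v‖ := fun a ha v => by
    have h1 : ‖(f' a - L) v‖ ≤ 1 / (2 * K) * ‖v‖ :=
      ((f' a - L).le_opNorm v).trans (by gcongr; exact (hrs ha).2.2)
    have h3 : ‖L v‖ ≤ ‖f' a v‖ + ‖(f' a - L) v‖ := by
      calc ‖L v‖ = ‖f' a v - (f' a - L) v‖ := by congr 1; rw [sub_apply]; abel
        _ ≤ _ := norm_sub_le _ _
    have h4 : ‖v‖ ≤ K * (‖f' a v‖ + 1 / (2 * K) * ‖v‖) := (hLK v).trans (by gcongr; linarith)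
    have h5 : K * (‖f' a v‖ + 1 / (2 * K) * ‖v‖) = K * ‖f' a v‖ + ‖v‖ / 2 := by
      field_simp
    linarith
  set V : Set X := U ∩ (ψ.source ∩ ψ ⁻¹' (Metric.ball a₀ r)) with hV
  have hVn : V ∈ 𝓝 x₀ := Filter.inter_mem hU (Filter.inter_mem (extChartAt_source_mem_nhds x₀)
    ((continuousAt_extChartAt x₀).preimage_mem_nhds (Metric.ball_mem_nhds _ hr)))
  have hVS : ∀ x ∈ V, ψ x ∈ S := fun x hx =>
    ⟨hx.2.2, extChartAt_target_subset_range x₀ (ψ.map_source hx.2.1)⟩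
  have hfψ : ∀ x ∈ V, f (ψ x) = ι x := fun x hx => congrArg ι (ψ.left_inv hx.2.1)
  have hemb : IsEmbedding ι := (hι.continuous.isClosedEmbedding hinj).isEmbedding
  rw [hemb.nhds_eq_comap] at hVn
  obtain ⟨ε, hε, hεV⟩ := (Metric.nhds_basis_ball.comap ι).mem_iff.1 hVn
  set c : ℝ := max (max 1 (2 / ε)) (max (2 * K) (2 * K * (1 + K' * (2 * K)))) with hc
  have hc1 : 1 ≤ c := (le_max_left _ _).trans (le_max_left _ _)
  have hc2 : 2 / ε ≤ c := (le_max_right _ _).trans (le_max_left _ _)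
  have hc3 : 2 * K ≤ c := (le_max_left _ _).trans (le_max_right _ _)
  have hc4 : 2 * K * (1 + K' * (2 * K)) ≤ c := (le_max_right _ _).trans (le_max_right _ _)
  have hc0 : 0 < c := by linarith
  refine ⟨c, hc1, ?_⟩
  have hev : ∀ᶠ y in 𝓝 x₀, ι y ∈ Metric.ball (ι x₀) (ε / 2) :=
    hι.continuous.continuousAt.preimage_mem_nhds (Metric.ball_mem_nhds _ (by positivity))
  filter_upwards [hev] with y hy
  have hyV : y ∈ V := hεV (Metric.ball_subset_ball (by linarith) hy)
  refine ⟨hyV.1, fun x τ hτ hxy => ?_⟩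
  have hτ0 : 0 ≤ τ := (norm_nonneg _).trans hxy
  have hxV : x ∈ V := by
    refine hεV ?_
    rw [mem_preimage, Metric.mem_ball]
    rw [Metric.mem_ball] at hy
    have : τ ≤ ε / 2 := by
      refine hτ.trans ?_
      rw [div_le_iff₀ hc0]
      rw [div_le_iff₀ hε] at hc2
      linarith
    rw [← dist_eq_norm] at hxy
    linarith [dist_triangle (ι x) (ι y) (ι x₀)]
  have hψxy : ‖ψ x - ψ y‖ ≤ 2 * K * τ := by
    refine (hanti _ (hVS x hxV) _ (hVS y hyV)).trans ?_
    rw [hfψ x hxV, hfψ y hyV]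
    gcongr
  refine ⟨hxV.1, hxV.2.1, hψxy.trans (by gcongr), ?_⟩
  rintro ξ η s rfl rfl hs hξη
  have hs0 : 0 ≤ s := (norm_nonneg _).trans hs
  rw [← hchain ξ hxV.2.1, ← hchain η hyV.2.1] at hξη
  have h1 : ‖f' (ψ η.1) - f' (ψ ξ.1)‖ ≤ K' * (2 * K * τ) := by
    rw [norm_sub_rev]
    refine (hK't.norm_sub_le (hrs (hVS _ hxV)).2.1 (hrs (hVS _ hyV)).2.1).trans ?_
    gcongr
  have h2 : ‖f' (ψ ξ.1) (chartVec I x₀ ξ - chartVec I x₀ η)‖ ≤ τ * s + K' * (2 * K * τ) * s := by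
    calc ‖f' (ψ ξ.1) (chartVec I x₀ ξ - chartVec I x₀ η)‖
        = ‖(f' (ψ ξ.1) (chartVec I x₀ ξ) - f' (ψ η.1) (chartVec I x₀ η)) +
          (f' (ψ η.1) - f' (ψ ξ.1)) (chartVec I x₀ η)‖ := by
          congr 1; rw [map_sub, sub_apply]; abel
      _ ≤ _ := (norm_add_le _ _).trans (add_le_add hξη
        (((f' (ψ η.1) - f' (ψ ξ.1)).le_opNorm _).trans (by gcongr)))
  calc ‖chartVec I x₀ ξ - chartVec I x₀ η‖ ≤ 2 * K * (τ * s + K' * (2 * K * τ) * s) :=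
        (hvec _ (hVS _ hxV) _).trans (by gcongr)
    _ = 2 * K * (1 + K' * (2 * K)) * (τ * s) := by ring
    _ ≤ c * (τ * s) := by gcongr
    _ = _ := by ring

/-- The norm of the tangent vector at `x₀` with coordinates `u` in the chart at `x₀`. -/
noncomputable def chartNorm [RiemannianBundle (fun x : X => TangentSpace I x)] (x₀ : X) (u : E) : ℝ :=
  ‖(trivializationAt E (TangentSpace I) x₀).symmL ℝ x₀ u‖

variable [RiemannianBundle (fun x : X => TangentSpace I x)]
  [IsContMDiffRiemannianBundle I ∞ E (fun x : X => TangentSpace I x)]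

theorem chartNorm_add_le (x₀ : X) (u v : E) :
    chartNorm I x₀ (u + v) ≤ chartNorm I x₀ u + chartNorm I x₀ v := by
  simp only [chartNorm, map_add]
  exact norm_add_le _ _

theorem continuousLinearMapAt_apply_eq_chartVec {x₀ y : X} (hy : y ∈ (extChartAt I x₀).source)
    (v : TangentSpace I y) :
    (trivializationAt E (TangentSpace I) x₀).continuousLinearMapAt ℝ y v =
      chartVec I x₀ ⟨y, v⟩ := by
  rw [extChartAt_source] at hy
  exact DFunLike.congr_fun (TangentBundle.continuousLinearMapAt_trivializationAt hy) v

theorem isContinuousRiemannianBundle_tangent :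
    IsContinuousRiemannianBundle E (fun x : X => TangentSpace I x) := by
  obtain ⟨g, hg, hg'⟩ := IsContMDiffRiemannianBundle.exists_contMDiff (IB := I) (n := ∞) (F := E)
    (E := fun x : X => TangentSpace I x)
  exact ⟨g, hg.continuous, hg'⟩

theorem eventually_norm_le_chartNorm (x₀ : X) {r : ℝ} (hr : 1 < r) :
    ∀ᶠ y in 𝓝 x₀, ∀ v : TangentSpace I y, ‖v‖ ≤ r * chartNorm I x₀ (chartVec I x₀ ⟨y, v⟩) ∧
      chartNorm I x₀ (chartVec I x₀ ⟨y, v⟩) ≤ r * ‖v‖ := by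
  have := isContinuousRiemannianBundle_tangent I (X := X)
  filter_upwards [eventually_norm_symmL_trivializationAt_self_comp_lt E
    (fun x : X => TangentSpace I x) x₀ hr, eventually_norm_symmL_trivializationAt_comp_self_lt E
    (fun x : X => TangentSpace I x) x₀ hr, extChartAt_source_mem_nhds (I := I) x₀] with y h1 h2 hy v
  rw [← continuousLinearMapAt_apply_eq_chartVec I hy]
  set e := trivializationAt E (TangentSpace I) x₀
  have hye : y ∈ e.baseSet := by
    rw [extChartAt_source] at hy; simpa [e] using hy
  have hxe : x₀ ∈ e.baseSet := FiberBundle.mem_baseSet_trivializationAt' x₀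
  constructor
  · have h3 : v = (e.symmL ℝ y ∘L e.continuousLinearMapAt ℝ x₀)
        (e.symmL ℝ x₀ (e.continuousLinearMapAt ℝ y v)) := by
      rw [ContinuousLinearMap.comp_apply, e.continuousLinearMapAt_symmL hxe,
        e.symmL_continuousLinearMapAt hye]
    conv_lhs => rw [h3]
    exact (ContinuousLinearMap.le_opNorm _ _).trans (by gcongr; rfl)
  · exact ((e.symmL ℝ x₀ ∘L e.continuousLinearMapAt ℝ y).le_opNorm v).trans (by gcongr)

theorem exists_eventually_norm_le_chartVec (x₀ : X) :
    ∃ c, 1 ≤ c ∧ ∀ᶠ y in 𝓝 x₀, ∀ v : TangentSpace I y, ‖v‖ ≤ c * ‖chartVec I x₀ ⟨y, v⟩‖ ∧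
      ‖chartVec I x₀ ⟨y, v⟩‖ ≤ c * ‖v‖ := by
  have := isContinuousRiemannianBundle_tangent I (X := X)
  obtain ⟨C, hC, h1⟩ := eventually_norm_trivializationAt_lt E (fun x : X => TangentSpace I x) x₀
  obtain ⟨C', hC', h2⟩ := eventually_norm_symmL_trivializationAt_lt E
    (fun x : X => TangentSpace I x) x₀
  refine ⟨max 1 (max C C'), le_max_left _ _, ?_⟩
  filter_upwards [h1, h2, extChartAt_source_mem_nhds (I := I) x₀] with y h1 h2 hy v
  rw [← continuousLinearMapAt_apply_eq_chartVec I hy]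
  set e := trivializationAt E (TangentSpace I) x₀
  have hye : y ∈ e.baseSet := by
    rw [extChartAt_source] at hy; simpa [e] using hy
  constructor
  · have h3 : v = e.symmL ℝ y (e.continuousLinearMapAt ℝ y v) :=
      (e.symmL_continuousLinearMapAt hye v).symm
    conv_lhs => rw [h3]
    refine (ContinuousLinearMap.le_opNorm _ _).trans ?_
    gcongr
    exact h2.le.trans ((le_max_right _ _).trans (le_max_right _ _))
  · refine (ContinuousLinearMap.le_opNorm _ _).trans ?_
    gcongr
    exact h1.le.trans ((le_max_left _ _).trans (le_max_right _ _))

end ChartEstimates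

theorem exists_eventually_forall_of_eventually {X Y : Type*} [TopologicalSpace X]
    [TopologicalSpace Y] [CompactSpace Y] {P : ℝ → X × Y → Prop}
    (mono : ∀ p c c', c ≤ c' → P c p → P c' p) (x₀ : X)
    (loc : ∀ y₀, ∃ c, ∀ᶠ p in 𝓝 (x₀, y₀), P c p) :
    ∃ c, 1 ≤ c ∧ ∀ᶠ x in 𝓝 x₀, ∀ y, P c (x, y) := by
  have loc' : ∀ y₀, ∃ c, ∃ U ∈ 𝓝 x₀, ∃ V ∈ 𝓝 y₀, ∀ x ∈ U, ∀ y ∈ V, P c (x, y) := fun y₀ => by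
    obtain ⟨c, hc⟩ := loc y₀
    rw [nhds_prod_eq] at hc
    obtain ⟨U, hU, V, hV, h⟩ := Filter.mem_prod_iff.1 hc
    exact ⟨c, U, hU, V, hV, fun x hx y hy => h ⟨hx, hy⟩⟩
  choose c U hU V hV h using loc'
  obtain ⟨t, -, ht⟩ := isCompact_univ.elim_nhds_subcover V (fun y₀ _ => hV y₀)
  obtain ⟨m, hm⟩ := (t.image c).exists_le
  refine ⟨max 1 m, le_max_left _ _, ?_⟩
  filter_upwards [(Filter.biInter_finset_mem t).2 fun y₀ _ => hU y₀] with x hx y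
  obtain ⟨y₀, hy₀, hy⟩ := mem_iUnion₂.1 (ht (mem_univ y))
  exact mono _ _ _ ((hm _ (Finset.mem_image_of_mem c hy₀)).trans (le_max_right _ _))
    (h y₀ x (mem_iInter₂.1 hx y₀ hy₀) y hy)

section Product

variable {E : Type*} [NormedAddCommGroup E] [NormedSpace ℝ E]
  {H : Type*} [TopologicalSpace H] {I : ModelWithCorners ℝ E H}
  {B : Type*} [TopologicalSpace B] [ChartedSpace H B] [IsManifold I ∞ B]
  {E' : Type*} [NormedAddCommGroup E'] [NormedSpace ℝ E']
  {H' : Type*} [TopologicalSpace H'] {J : ModelWithCorners ℝ E' H'}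
  {M : Type*} [TopologicalSpace M] [ChartedSpace H' M] [IsManifold J ∞ M]

/-- The component along the base of a tangent vector of `B × M`. -/
def baseVec (ξ : TangentBundle (I.prod J) (B × M)) : TangentBundle I B := ⟨ξ.1.1, ξ.2.1⟩

/-- The component along the fiber of a tangent vector of `B × M`. -/
def fiberVec (ξ : TangentBundle (I.prod J) (B × M)) : TangentBundle J M := ⟨ξ.1.2, ξ.2.2⟩

theorem tangentNorm_eq [RiemannianBundle (fun x : B => TangentSpace I x)]
    [RiemannianBundle (fun x : M => TangentSpace J x)]
    (ξ : TangentBundle (I.prod J) (B × M)) :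
    tangentNorm I J ξ = ‖(baseVec ξ).2‖ + ‖(fiberVec ξ).2‖ := by
  simp only [tangentNorm, mfderiv_fst, mfderiv_snd]
  rfl

theorem vectorDeriv_comp {F : Type*} [NormedAddCommGroup F] [NormedSpace ℝ F] {g : M → F}
    {f : B → M} {ξ : TangentBundle I B} (hg : MDifferentiableAt J 𝓘(ℝ, F) g (f ξ.1))
    (hf : MDifferentiableAt I J f ξ.1) :
    vectorDeriv I (g ∘ f) ξ = vectorDeriv J g (tangentMap I J f ξ) := by
  have h := mfderiv_comp ξ.1 hg hf
  exact congrArg (fun L : E →L[ℝ] F => L ξ.2) h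

theorem vectorDeriv_eq_fderiv {F : Type*} [NormedAddCommGroup F] [NormedSpace ℝ F] {g : E → F}
    (ξ : TangentBundle 𝓘(ℝ, E) E) : vectorDeriv 𝓘(ℝ, E) g ξ = fderiv ℝ g ξ.1 ξ.2 := by
  rw [vectorDeriv, mfderiv_eq_fderiv]
  rfl

theorem chartVec_prod {x₀ : B × M} {ξ : TangentBundle (I.prod J) (B × M)}
    (hξ : ξ.1 ∈ (extChartAt (I.prod J) x₀).source) :
    chartVec (I.prod J) x₀ ξ = (chartVec I x₀.1 (baseVec ξ), chartVec J x₀.2 (fiberVec ξ)) := by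
  have : IsManifold I 1 B := IsManifold.of_le (n := ∞) one_le_smooth
  have : IsManifold J 1 M := IsManifold.of_le (n := ∞) one_le_smooth
  have hξ' := hξ
  rw [extChartAt_prod, PartialEquiv.prod_source] at hξ'
  have h0 : MDifferentiableAt (I.prod J) 𝓘(ℝ, E × E') (extChartAt (I.prod J) x₀) ξ.1 :=
    mdifferentiableAt_extChartAt (by rwa [extChartAt_source] at hξ)
  refine Prod.ext ?_ ?_
  · have h1 : vectorDeriv (I.prod J) ((Prod.fst : E × E' → E) ∘ extChartAt (I.prod J) x₀) ξ =
        (chartVec (I.prod J) x₀ ξ).1 := by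
      rw [vectorDeriv_comp differentiableAt_fst.mdifferentiableAt h0, vectorDeriv_eq_fderiv,
        fderiv_fst]
      rfl
    have h2 : vectorDeriv (I.prod J) (extChartAt I x₀.1 ∘ (Prod.fst : B × M → B)) ξ =
        chartVec I x₀.1 (baseVec ξ) := by
      rw [vectorDeriv_comp (mdifferentiableAt_extChartAt (by
        have := hξ'.1; rwa [extChartAt_source] at this)) mdifferentiableAt_fst,
        tangentMap_prodFst]
      rfl
    rw [← h1, ← h2, extChartAt_prod]
    rfl
  · have h1 : vectorDeriv (I.prod J) ((Prod.snd : E × E' → E') ∘ extChartAt (I.prod J) x₀) ξ =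
        (chartVec (I.prod J) x₀ ξ).2 := by
      rw [vectorDeriv_comp differentiableAt_snd.mdifferentiableAt h0, vectorDeriv_eq_fderiv,
        fderiv_snd]
      rfl
    have h2 : vectorDeriv (I.prod J) (extChartAt J x₀.2 ∘ (Prod.snd : B × M → M)) ξ =
        chartVec J x₀.2 (fiberVec ξ) := by
      rw [vectorDeriv_comp (mdifferentiableAt_extChartAt (by
        have := hξ'.2; rwa [extChartAt_source] at this)) mdifferentiableAt_snd,
        tangentMap_prodSnd]
      rfl
    rw [← h1, ← h2, extChartAt_prod]
    rfl

variable [FiniteDimensional ℝ E] [FiniteDimensional ℝ E'] [CompactSpace B] [CompactSpace M]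
  [RiemannianBundle (fun x : M => TangentSpace J x)]
  [IsContMDiffRiemannianBundle J ∞ E' (fun x : M => TangentSpace J x)]

/-- If two tangent vectors of `B × M` have close images under the embedding `ι`, then their
components are close. -/
theorem IsSmoothInjectiveImmersion.exists_estimate {N : ℕ} {ι : B × M → EuclideanSpace ℝ (Fin N)}
    (hι : IsSmoothInjectiveImmersion I J ι) (c₀ : B) {ε : ℝ} (hε : 0 < ε) :
    ∃ c, 1 ≤ c ∧ ∀ᶠ b in 𝓝 c₀, ∀ m : M, b ∈ (extChartAt I c₀).source ∧
      ∀ (x : B × M) (τ : ℝ), τ ≤ 1 / c → ‖ι x - ι (b, m)‖ ≤ τ →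
      x.1 ∈ (extChartAt I c₀).source ∧ ‖extChartAt I c₀ x.1 - extChartAt I c₀ b‖ ≤ c * τ ∧
      ∀ (ξ η : TangentBundle (I.prod J) (B × M)) (s : ℝ), ξ.1 = x → η.1 = (b, m) →
        ‖chartVec I c₀ (baseVec η)‖ ≤ s → ‖(fiberVec η).2‖ ≤ s →
        ‖pushVector I J ι ξ - pushVector I J ι η‖ ≤ τ * s →
        ‖chartVec I c₀ (baseVec ξ) - chartVec I c₀ (baseVec η)‖ ≤ c * τ * s ∧
        ‖(fiberVec ξ).2‖ ≤ (1 + ε) * ‖(fiberVec η).2‖ + c * τ * s := by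
  let P : ℝ → B × M → Prop := fun c p => 0 < c ∧ p.1 ∈ (extChartAt I c₀).source ∧
      ∀ (x : B × M) (τ : ℝ), τ ≤ 1 / c → ‖ι x - ι p‖ ≤ τ →
      x.1 ∈ (extChartAt I c₀).source ∧ ‖extChartAt I c₀ x.1 - extChartAt I c₀ p.1‖ ≤ c * τ ∧
      ∀ (ξ η : TangentBundle (I.prod J) (B × M)) (s : ℝ), ξ.1 = x → η.1 = p →
        ‖chartVec I c₀ (baseVec η)‖ ≤ s → ‖(fiberVec η).2‖ ≤ s →
        ‖pushVector I J ι ξ - pushVector I J ι η‖ ≤ τ * s →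
        ‖chartVec I c₀ (baseVec ξ) - chartVec I c₀ (baseVec η)‖ ≤ c * τ * s ∧
        ‖(fiberVec ξ).2‖ ≤ (1 + ε) * ‖(fiberVec η).2‖ + c * τ * s
  suffices h : ∃ c, 1 ≤ c ∧ ∀ᶠ b in 𝓝 c₀, ∀ m : M, P c (b, m) by
    obtain ⟨c, hc1, hc⟩ := h
    exact ⟨c, hc1, hc.mono fun b hb m => (hb m).2⟩
  refine exists_eventually_forall_of_eventually ?_ c₀ ?_
  · rintro p c c' hcc ⟨hc, hp, h⟩
    refine ⟨hc.trans_le hcc, hp, fun x τ hτ hx => ?_⟩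
    have hτ0 : 0 ≤ τ := (norm_nonneg _).trans hx
    obtain ⟨h1, h2, h3⟩ := h x τ (hτ.trans (one_div_le_one_div_of_le hc hcc)) hx
    refine ⟨h1, h2.trans (by gcongr), fun ξ η s hξ hη hs1 hs2 hs => ?_⟩
    have hs0 : 0 ≤ s := (norm_nonneg _).trans hs1
    obtain ⟨h4, h5⟩ := h3 ξ η s hξ hη hs1 hs2 hs
    exact ⟨h4.trans (by gcongr), h5.trans (by gcongr)⟩
  · intro m₀
    set r := Real.sqrt (1 + ε) with hr
    have hr1 : 1 < r := Real.lt_sqrt_of_sq_lt (by linarith)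
    have hrr : r * r = 1 + ε := Real.mul_self_sqrt (by linarith)
    obtain ⟨C, hC1, hC⟩ := exists_eventually_norm_le_chartVec J m₀
    obtain ⟨c, hc1, hc⟩ := exists_chart_estimate_of_immersion (I.prod J) hι.contMDiff hι.injective
      hι.injective_mfderiv (c₀, m₀) (prod_mem_nhds (Filter.univ_mem (f := 𝓝 c₀))
        ((eventually_norm_le_chartNorm J m₀ hr1).and hC))
    set A := ‖(trivializationAt E' (TangentSpace J) m₀).symmL ℝ m₀‖ with hA
    have hAu : ∀ u, chartNorm J m₀ u ≤ A * ‖u‖ := fun u => ContinuousLinearMap.le_opNorm _ _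
    set c' := max (c * C) (r * A * (c * C)) with hc'
    have hcC : c * C ≤ c' := le_max_left _ _
    have hrA : r * A * (c * C) ≤ c' := le_max_right _ _
    have hcc' : c ≤ c' := (le_mul_of_one_le_right (by linarith) hC1).trans hcC
    refine ⟨c', ?_⟩
    filter_upwards [hc, extChartAt_source_mem_nhds (I := I.prod J) (c₀, m₀)] with p hp hps
    have hsrc : ∀ x : B × M, x ∈ (extChartAt (I.prod J) (c₀, m₀)).source →
        x.1 ∈ (extChartAt I c₀).source := fun x hx => by
      rw [extChartAt_prod, PartialEquiv.prod_source] at hx; exact hx.1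
    refine ⟨by linarith, hsrc p hps, fun x τ hτ hxp => ?_⟩
    have hτ0 : 0 ≤ τ := (norm_nonneg _).trans hxp
    obtain ⟨hxU, hxs, hxy, hvec⟩ := hp.2 x τ
      (hτ.trans (one_div_le_one_div_of_le (by linarith) hcc')) hxp
    refine ⟨hsrc x hxs, ?_, ?_⟩
    · rw [extChartAt_prod] at hxy
      exact (norm_fst_le _).trans (hxy.trans (by gcongr))
    · rintro ξ η s rfl rfl hs1 hs2 hξη
      have hs0 : 0 ≤ s := (norm_nonneg _).trans hs1
      have hη2 : ‖chartVec J m₀ (fiberVec η)‖ ≤ C * s :=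
        ((hp.1.2.2 (fiberVec η).2).2).trans (mul_le_mul_of_nonneg_left hs2 (by linarith))
      have h1 := hvec ξ η (C * s) rfl rfl (by
        rw [chartVec_prod hps, Prod.norm_mk]
        exact max_le (hs1.trans (le_mul_of_one_le_left hs0 hC1)) hη2)
        (hξη.trans (mul_le_mul_of_nonneg_left (le_mul_of_one_le_left hs0 hC1) hτ0))
      rw [chartVec_prod hps, chartVec_prod hxs] at h1
      have h2 : ‖chartVec I c₀ (baseVec ξ) - chartVec I c₀ (baseVec η)‖ ≤ c * τ * (C * s) :=
        (norm_fst_le _).trans h1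
      have h3 : ‖chartVec J m₀ (fiberVec ξ) - chartVec J m₀ (fiberVec η)‖ ≤ c * τ * (C * s) :=
        (norm_snd_le _).trans h1
      constructor
      · calc _ ≤ c * τ * (C * s) := h2
          _ = (c * C) * (τ * s) := by ring
          _ ≤ c' * (τ * s) := by gcongr
          _ = _ := by ring
      · have h4 : chartNorm J m₀ (chartVec J m₀ (fiberVec ξ)) ≤
            chartNorm J m₀ (chartVec J m₀ (fiberVec η)) + A * (c * τ * (C * s)) := by
          have := chartNorm_add_le J m₀ (chartVec J m₀ (fiberVec η))
            (chartVec J m₀ (fiberVec ξ) - chartVec J m₀ (fiberVec η))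
          rw [add_sub_cancel] at this
          exact this.trans (by gcongr; exact (hAu _).trans (by gcongr))
        calc ‖(fiberVec ξ).2‖ ≤ r * chartNorm J m₀ (chartVec J m₀ (fiberVec ξ)) :=
              (hxU.2.1 (fiberVec ξ).2).1
          _ ≤ r * (r * ‖(fiberVec η).2‖ + A * (c * τ * (C * s))) := by
              gcongr
              exact h4.trans (by gcongr; exact (hp.1.2.1 (fiberVec η).2).2)
          _ = (r * r) * ‖(fiberVec η).2‖ + r * A * (c * C) * (τ * s) := by ring
          _ ≤ (1 + ε) * ‖(fiberVec η).2‖ + c' * (τ * s) := by rw [hrr]; gcongr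
          _ = _ := by ring

end Product

section Lift

variable {E : Type*} [NormedAddCommGroup E] [NormedSpace ℝ E]
  {H : Type*} [TopologicalSpace H] (I : ModelWithCorners ℝ E H)
  {B : Type*} [TopologicalSpace B] [ChartedSpace H B] [IsManifold I ∞ B]

/-- The tangent vector with coordinates `(z, v)` in the chart at `x₀`. -/
noncomputable def liftVec (x₀ : B) (z v : E) : TangentBundle I B :=
  tangentMap 𝓘(ℝ, E) I (extChartAt I x₀).symm ⟨z, v⟩

variable {I} {x₀ : B} {z : E}

theorem mdifferentiableAt_extChartAt_symm_of_mem_interior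
    (hz : z ∈ interior (extChartAt I x₀).target) :
    MDifferentiableAt 𝓘(ℝ, E) I (extChartAt I x₀).symm z :=
  ((contMDiffOn_extChartAt_symm (n := ∞) x₀).contMDiffAt
    (mem_interior_iff_mem_nhds.1 hz)).mdifferentiableAt (by simp)

theorem fderiv_comp_extChartAt_symm {F : Type*} [NormedAddCommGroup F] [NormedSpace ℝ F]
    {u : B → F} (hz : z ∈ interior (extChartAt I x₀).target)
    (hu : MDifferentiableAt I 𝓘(ℝ, F) u ((extChartAt I x₀).symm z)) (v : E) :
    fderiv ℝ (u ∘ (extChartAt I x₀).symm) z v = vectorDeriv I u (liftVec I x₀ z v) := by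
  have h := vectorDeriv_comp (ξ := (⟨z, v⟩ : TangentBundle 𝓘(ℝ, E) E)) hu
    (mdifferentiableAt_extChartAt_symm_of_mem_interior hz)
  rw [vectorDeriv_eq_fderiv] at h
  exact h

theorem chartVec_liftVec (hz : z ∈ interior (extChartAt I x₀).target) (v : E) :
    chartVec I x₀ (liftVec I x₀ z v) = v := by
  have hzt := interior_subset hz
  have hm : MDifferentiableAt I 𝓘(ℝ, E) (extChartAt I x₀) ((extChartAt I x₀).symm z) :=
    have : IsManifold I 1 B := IsManifold.of_le (n := ∞) one_le_smooth
    mdifferentiableAt_extChartAt (by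
      have := (extChartAt I x₀).map_target hzt
      rwa [extChartAt_source] at this)
  have h := fderiv_comp_extChartAt_symm hz hm v
  have heq : extChartAt I x₀ ∘ (extChartAt I x₀).symm =ᶠ[𝓝 z] id := by
    filter_upwards [mem_interior_iff_mem_nhds.1 hz] with y hy
    exact (extChartAt I x₀).right_inv hy
  rw [heq.fderiv_eq, fderiv_id] at h
  exact h.symm

theorem liftVec_chartVec [T2Space B] [FiniteDimensional ℝ E] [RiemannianBundle (fun x : B => TangentSpace I x)]
    [IsContMDiffRiemannianBundle I ∞ E (fun x : B => TangentSpace I x)] {ζ : TangentBundle I B} (hζ : ζ.1 ∈ (extChartAt I x₀).source)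
    (hi : extChartAt I x₀ ζ.1 ∈ interior (extChartAt I x₀).target) :
    liftVec I x₀ (extChartAt I x₀ ζ.1) (chartVec I x₀ ζ) = ζ :=
  eq_of_chartVec_eq I hζ ((extChartAt I x₀).left_inv hζ) (chartVec_liftVec hi _)

theorem contDiffAt_writtenInCharts {h : B → B} {n : ℕ∞ω} (hn : n ≤ (∞ : ℕ∞ω))
    (hh : ContMDiff I I n h) {c₀ : B}
    (hz : z ∈ interior (extChartAt I x₀).target)
    (hs : h ((extChartAt I x₀).symm z) ∈ (extChartAt I c₀).source) :
    ContDiffAt ℝ n (extChartAt I c₀ ∘ h ∘ (extChartAt I x₀).symm) z := by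
  rw [← contMDiffAt_iff_contDiffAt]
  have h1 : ContMDiffAt 𝓘(ℝ, E) I n (extChartAt I x₀).symm z :=
    ((contMDiffOn_extChartAt_symm (n := ∞) x₀).contMDiffAt
      (mem_interior_iff_mem_nhds.1 hz)).of_le hn
  have h2 : ContMDiffAt I 𝓘(ℝ, E) n (extChartAt I c₀) (h ((extChartAt I x₀).symm z)) :=
    (contMDiffAt_extChartAt' (n := ∞) (by rwa [extChartAt_source] at hs)).of_le hn
  exact ContMDiffAt.comp (I' := I) z h2 (ContMDiffAt.comp (I' := I) z (hh _) h1)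

end Lift

section Perturbation

variable {E : Type*} [NormedAddCommGroup E] [NormedSpace ℝ E]
  {H : Type*} [TopologicalSpace H] {I : ModelWithCorners ℝ E H}
  {B : Type*} [TopologicalSpace B] [ChartedSpace H B] [IsManifold I ∞ B]
  {E' : Type*} [NormedAddCommGroup E'] [NormedSpace ℝ E']
  {H' : Type*} [TopologicalSpace H'] {J : ModelWithCorners ℝ E' H'}
  {M : Type*} [TopologicalSpace M] [ChartedSpace H' M] [IsManifold J ∞ M]

theorem baseVec_tangentMap {G : B × M → B × M} {ξ : TangentBundle (I.prod J) (B × M)}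
    (hG : MDifferentiableAt (I.prod J) (I.prod J) G ξ.1) :
    baseVec (tangentMap (I.prod J) (I.prod J) G ξ) =
      tangentMap (I.prod J) I (Prod.fst ∘ G) ξ := by
  rw [tangentMap_comp_at ξ mdifferentiableAt_fst hG, tangentMap_prodFst]
  rfl

theorem fiberVec_tangentMap {G : B × M → B × M} {ξ : TangentBundle (I.prod J) (B × M)}
    (hG : MDifferentiableAt (I.prod J) (I.prod J) G ξ.1) :
    fiberVec (tangentMap (I.prod J) (I.prod J) G ξ) =
      tangentMap (I.prod J) J (Prod.snd ∘ G) ξ := by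
  rw [tangentMap_comp_at ξ mdifferentiableAt_snd hG, tangentMap_prodSnd]
  rfl

theorem baseVec_tangentMap_skew {h : B → B} {f : B → M → M}
    {ξ : TangentBundle (I.prod J) (B × M)} (hh : MDifferentiableAt I I h ξ.1.1)
    (hF : MDifferentiableAt (I.prod J) (I.prod J) (skew h f) ξ.1) :
    baseVec (tangentMap (I.prod J) (I.prod J) (skew h f) ξ) = tangentMap I I h (baseVec ξ) := by
  rw [baseVec_tangentMap hF]
  have : (Prod.fst ∘ skew h f : B × M → B) = h ∘ Prod.fst := rfl
  rw [this, tangentMap_comp_at ξ hh mdifferentiableAt_fst, tangentMap_prodFst]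
  rfl

variable [RiemannianBundle (fun x : B => TangentSpace I x)]
  [RiemannianBundle (fun x : M => TangentSpace J x)]

theorem norm_fiberVec_tangentMap_skew_le {h : B → B} {f : B → M → M} {K L : ℝ}
    {ξ : TangentBundle (I.prod J) (B × M)}
    (hF : MDifferentiableAt (I.prod J) (I.prod J) (skew h f) ξ.1)
    (hK : ‖mfderiv I J (fun b' => f b' ξ.1.2) ξ.1.1‖ ≤ K) (hL : ‖mfderiv J J (f ξ.1.1) ξ.1.2‖ ≤ L) :
    ‖(fiberVec (tangentMap (I.prod J) (I.prod J) (skew h f) ξ)).2‖ ≤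
      K * ‖(baseVec ξ).2‖ + L * ‖(fiberVec ξ).2‖ := by
  rw [fiberVec_tangentMap hF]
  have hs : MDifferentiableAt (I.prod J) J (Prod.snd ∘ skew h f) ξ.1 :=
    mdifferentiableAt_snd.comp _ hF
  have h1 := mfderiv_prod_eq_add_apply (v := ξ.2) hs
  have h2 : ‖mfderiv I J (fun b' => f b' ξ.1.2) ξ.1.1 (baseVec ξ).2 +
      mfderiv J J (f ξ.1.1) ξ.1.2 (fiberVec ξ).2‖ ≤
      K * ‖(baseVec ξ).2‖ + L * ‖(fiberVec ξ).2‖ := by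
    refine (norm_add_le _ _).trans (add_le_add ?_ ?_)
    · exact (ContinuousLinearMap.le_opNorm _ _).trans
        (mul_le_mul_of_nonneg_right hK (norm_nonneg _))
    · exact (ContinuousLinearMap.le_opNorm _ _).trans
        (mul_le_mul_of_nonneg_right hL (norm_nonneg _))
  refine le_trans (le_of_eq ?_) h2
  exact congrArg (fun v : TangentSpace J (f ξ.1.1 ξ.1.2) => ‖v‖) h1

variable [T2Space B] [FiniteDimensional ℝ E]
  [IsContMDiffRiemannianBundle I ∞ E (fun x : B => TangentSpace I x)]

theorem exists_norm_chartVec_tangentMap_le {h : B → B} (hh : ContMDiff I I 2 h) {b₀ : B}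
    (hb₀ : I.IsInteriorPoint b₀) :
    ∃ c, 1 ≤ c ∧ ∀ᶠ b in 𝓝 b₀, ∀ ζ : TangentBundle I B, ζ.1 = b →
      ‖chartVec I (h b₀) (tangentMap I I h ζ)‖ ≤ c * ‖ζ.2‖ := by
  have : IsManifold I 1 B := IsManifold.of_le (n := ∞) one_le_smooth
  set e := extChartAt I b₀ with he
  have hz₀ := extChartAt_mem_interior_target I (mem_extChartAt_source b₀) hb₀
  have hsym : e.symm (e b₀) = b₀ := e.left_inv (mem_extChartAt_source b₀)
  have h1 : ContDiffAt ℝ 2 (extChartAt I (h b₀) ∘ h ∘ e.symm) (e b₀) :=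
    contDiffAt_writtenInCharts two_le_smooth hh hz₀ (by
      rw [hsym]; exact mem_extChartAt_source _)
  have h2 : ContinuousAt (fderiv ℝ (extChartAt I (h b₀) ∘ h ∘ e.symm)) (e b₀) :=
    (h1.fderiv_right (m := 1) (by norm_num)).continuousAt
  set K := ‖fderiv ℝ (extChartAt I (h b₀) ∘ h ∘ e.symm) (e b₀)‖ + 1 with hK
  have h3 : ∀ᶠ z in 𝓝 (e b₀), ‖fderiv ℝ (extChartAt I (h b₀) ∘ h ∘ e.symm) z‖ < K :=
    h2.norm.eventually_lt continuousAt_const (by simp [hK])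
  have h4 := (continuousAt_extChartAt (I := I) b₀).eventually h3
  have h5 := (continuousAt_extChartAt (I := I) b₀).eventually
    (isOpen_interior.mem_nhds hz₀)
  obtain ⟨C, hC1, hC⟩ := exists_eventually_norm_le_chartVec I b₀
  refine ⟨max 1 (K * C), le_max_left _ _, ?_⟩
  filter_upwards [h4, h5, hC, extChartAt_source_mem_nhds (I := I) b₀,
    hh.continuous.continuousAt.preimage_mem_nhds (extChartAt_source_mem_nhds (I := I) (h b₀))]
    with b hbK hbi hbC hbs hhb ζ hζ
  subst hζ
  have hm : MDifferentiableAt I 𝓘(ℝ, E) (extChartAt I (h b₀)) (h ζ.1) :=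
    mdifferentiableAt_extChartAt (by rwa [mem_preimage, extChartAt_source] at hhb)
  have hhm : ∀ p, MDifferentiableAt I I h p := fun p => (hh p).mdifferentiableAt (by norm_num)
  have h6 : chartVec I (h b₀) (tangentMap I I h ζ) =
      fderiv ℝ (extChartAt I (h b₀) ∘ h ∘ e.symm) (e ζ.1) (chartVec I b₀ ζ) := by
    have hse : e.symm (e ζ.1) = ζ.1 := e.left_inv hbs
    have h7 := fderiv_comp_extChartAt_symm (u := extChartAt I (h b₀) ∘ h) hbi
      (by rw [hse]; exact hm.comp _ (hhm _)) (chartVec I b₀ ζ)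
    rw [liftVec_chartVec hbs hbi, vectorDeriv_comp hm (hhm _)] at h7
    exact h7.symm
  rw [h6]
  calc _ ≤ K * (C * ‖ζ.2‖) := (ContinuousLinearMap.le_opNorm _ _).trans
        (mul_le_mul hbK.le (hbC ζ.2).2 (norm_nonneg _) (by positivity))
    _ = K * C * ‖ζ.2‖ := by ring
    _ ≤ _ := by gcongr; exact le_max_right _ _

end Perturbation

section Perturbation

variable {E : Type*} [NormedAddCommGroup E] [NormedSpace ℝ E] [FiniteDimensional ℝ E]
  {H : Type*} [TopologicalSpace H] {I : ModelWithCorners ℝ E H}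
  {B : Type*} [TopologicalSpace B] [T2Space B] [CompactSpace B] [ChartedSpace H B] [IsManifold I ∞ B]
  [RiemannianBundle (fun x : B => TangentSpace I x)]
  [IsContMDiffRiemannianBundle I ∞ E (fun x : B => TangentSpace I x)]
  {E' : Type*} [NormedAddCommGroup E'] [NormedSpace ℝ E'] [FiniteDimensional ℝ E']
  {H' : Type*} [TopologicalSpace H'] {J : ModelWithCorners ℝ E' H'}
  {M : Type*} [TopologicalSpace M] [CompactSpace M] [ChartedSpace H' M] [IsManifold J ∞ M]
  [RiemannianBundle (fun x : M => TangentSpace J x)]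
  [IsContMDiffRiemannianBundle J ∞ E' (fun x : M => TangentSpace J x)]
  {h : B → B} {f : B → M → M} {N : ℕ} {ι : B × M → EuclideanSpace ℝ (Fin N)}

theorem exists_perturbation_estimate (hh : ContMDiff I I 2 h)
    (hF : ContMDiff (I.prod J) (I.prod J) 1 (skew h f)) (hι : IsSmoothInjectiveImmersion I J ι)
    {K L : ℝ} (hKL : K ≤ L) (hK : ∀ b m, ‖mfderiv I J (fun b' => f b' m) b‖ ≤ K)
    (hL : ∀ b m, ‖mfderiv J J (f b) m‖ ≤ L) {b₀ : B} (hb₀ : I.IsInteriorPoint b₀) {ε : ℝ}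
    (hε : 0 < ε) :
    ∃ c, 1 ≤ c ∧ ∀ᶠ b in 𝓝 b₀, ∀ (G : B × M → B × M) (ρ : ℝ),
      ContMDiff (I.prod J) (I.prod J) 1 G → C1DistLT I J ι G (skew h f) ρ → ρ ≤ 1 / c →
      h b ∈ (extChartAt I (h b₀)).source ∧ ∀ m,
        (G (b, m)).1 ∈ (extChartAt I (h b₀)).source ∧
        ‖extChartAt I (h b₀) (G (b, m)).1 - extChartAt I (h b₀) (h b)‖ ≤ c * ρ ∧
        ∀ ξ : TangentBundle (I.prod J) (B × M), ξ.1 = (b, m) →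
          ‖chartVec I (h b₀) (baseVec (tangentMap (I.prod J) (I.prod J) G ξ)) -
            chartVec I (h b₀) (tangentMap I I h (baseVec ξ))‖ ≤
              c * ρ * (‖(baseVec ξ).2‖ + ‖(fiberVec ξ).2‖) ∧
          ‖(fiberVec (tangentMap (I.prod J) (I.prod J) G ξ)).2‖ ≤
            (K + ε) * ‖(baseVec ξ).2‖ + (L + ε) * ‖(fiberVec ξ).2‖ := by
  set L' := max L 0 with hL'
  have hL'0 : 0 ≤ L' := le_max_right _ _
  obtain ⟨c₁, hc₁, hest⟩ := hι.exists_estimate (h b₀) (ε := ε / (2 * (L' + 1))) (by positivity)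
  obtain ⟨c₂, hc₂, hder⟩ := exists_norm_chartVec_tangentMap_le hh hb₀
  set s₀ := max c₂ L' with hs₀
  have hs₀1 : 1 ≤ s₀ := hc₂.trans (le_max_left _ _)
  set c := max (c₁ * s₀) (2 * (c₁ * s₀) / ε) with hc
  have hc1 : c₁ * s₀ ≤ c := le_max_left _ _
  have hc2 : 2 * (c₁ * s₀) / ε ≤ c := le_max_right _ _
  have h1 : 1 ≤ c₁ * s₀ := one_le_mul_of_one_le_of_one_le hc₁ hs₀1
  have hc₁c : c₁ ≤ c := (le_mul_of_one_le_right (by linarith) hs₀1).trans hc1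
  refine ⟨c, h1.trans hc1, ?_⟩
  have hh0 : ∀ p, MDifferentiableAt I I h p := fun p => (hh p).mdifferentiableAt (by norm_num)
  filter_upwards [hh.continuous.continuousAt.eventually hest, hder,
    hh.continuous.continuousAt.preimage_mem_nhds (extChartAt_source_mem_nhds (I := I) (h b₀))]
    with b hb hbd hbs G ρ hG hGF hρ
  refine ⟨hbs, fun m => ?_⟩
  obtain ⟨r, hr, hGF⟩ := hGF
  have hFb : skew h f (b, m) = (h b, f b m) := rfl
  have hclose : ∀ ξ : TangentBundle (I.prod J) (B × M), ξ.1 = (b, m) →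
      ‖ι (G (b, m)) - ι (h b, f b m)‖ ≤ ρ := fun ξ hξ => by
    have := (hGF ξ).1
    rw [hξ, hFb] at this
    exact this.trans hr.le
  have hρc : ρ ≤ 1 / c₁ := hρ.trans (one_div_le_one_div_of_le (by linarith) hc₁c)
  have hρ0 : 0 ≤ ρ := (norm_nonneg _).trans (hclose ⟨(b, m), 0⟩ rfl)
  obtain ⟨-, hest⟩ := hb (f b m)
  obtain ⟨h2, h3, h4⟩ := hest (G (b, m)) ρ hρc (hclose ⟨(b, m), 0⟩ rfl)
  refine ⟨h2, h3.trans (by gcongr), fun ξ hξ => ?_⟩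
  set a := ‖(baseVec ξ).2‖ with ha
  set a' := ‖(fiberVec ξ).2‖ with ha'
  have ha0 : 0 ≤ a := norm_nonneg _
  have ha'0 : 0 ≤ a' := norm_nonneg _
  have hGd : MDifferentiableAt (I.prod J) (I.prod J) G ξ.1 := (hG _).mdifferentiableAt (by norm_num)
  have hFd : MDifferentiableAt (I.prod J) (I.prod J) (skew h f) ξ.1 :=
    (hF _).mdifferentiableAt (by norm_num)
  have hbase := baseVec_tangentMap_skew (hh0 ξ.1.1) hFd
  have hfib : ‖(fiberVec (tangentMap (I.prod J) (I.prod J) (skew h f) ξ)).2‖ ≤ K * a + L * a' :=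
    norm_fiberVec_tangentMap_skew_le hFd (hK _ _) (hL _ _)
  have hLL' : L ≤ L' := le_max_left _ _
  have hKL' : K ≤ L' := hKL.trans hLL'
  have hfib' : ‖(fiberVec (tangentMap (I.prod J) (I.prod J) (skew h f) ξ)).2‖ ≤ L' * (a + a') :=
    hfib.trans (by rw [mul_add]; gcongr)
  have h5 := h4 (tangentMap (I.prod J) (I.prod J) G ξ)
    (tangentMap (I.prod J) (I.prod J) (skew h f) ξ) (s₀ * (a + a')) (congrArg G hξ)
    (congrArg (skew h f) hξ) ?_ ?_ ?_
  · obtain ⟨h6, h7⟩ := h5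
    rw [hbase] at h6
    constructor
    · calc _ ≤ c₁ * ρ * (s₀ * (a + a')) := h6
        _ = c₁ * s₀ * (ρ * (a + a')) := by ring
        _ ≤ c * (ρ * (a + a')) := by gcongr
        _ = _ := by ring
    · have hρ' : c₁ * s₀ * ρ ≤ ε / 2 := by
        have hcpos : 0 < c := by linarith
        have h8 : ρ * c ≤ 1 := by rwa [le_div_iff₀ hcpos] at hρ
        have h9 : 2 * (c₁ * s₀) ≤ c * ε := by rwa [div_le_iff₀ hε] at hc2
        nlinarith
      have h10 : ε / (2 * (L' + 1)) * L' ≤ ε / 2 := by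
        rw [div_mul_eq_mul_div, div_le_div_iff₀ (by positivity) (by norm_num)]
        nlinarith
      have h11 : ε / (2 * (L' + 1)) *
          ‖(fiberVec (tangentMap (I.prod J) (I.prod J) (skew h f) ξ)).2‖ ≤ ε / 2 * (a + a') :=
        calc _ ≤ ε / (2 * (L' + 1)) * (L' * (a + a')) := by gcongr
          _ = ε / (2 * (L' + 1)) * L' * (a + a') := by ring
          _ ≤ _ := by gcongr
      have h12 : c₁ * ρ * (s₀ * (a + a')) ≤ ε / 2 * (a + a') :=
        calc _ = c₁ * s₀ * ρ * (a + a') := by ring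
          _ ≤ _ := by gcongr
      calc _ ≤ _ := h7
        _ ≤ (K * a + L * a') + ε / 2 * (a + a') + ε / 2 * (a + a') := by
            rw [add_mul, one_mul]
            exact add_le_add (add_le_add hfib h11) h12
        _ = _ := by ring
  · rw [hbase]
    calc _ ≤ c₂ * a := hbd (baseVec ξ) (congrArg Prod.fst hξ)
      _ ≤ s₀ * (a + a') := by gcongr; exacts [le_max_left _ _, by linarith]
  · exact hfib'.trans (by gcongr; exact le_max_right _ _)
  · refine ((hGF ξ).2.trans ?_)
    rw [tangentNorm_eq]
    calc r * (a + a') ≤ ρ * (a + a') := by gcongr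
      _ ≤ ρ * (s₀ * (a + a')) := by
        gcongr; exact le_mul_of_one_le_left (by positivity) hs₀1

end Perturbation

section Curves

variable {E' : Type*} [NormedAddCommGroup E'] [NormedSpace ℝ E']
  {H' : Type*} [TopologicalSpace H'] {J : ModelWithCorners ℝ E' H'}
  {M : Type*} [EMetricSpace M] [ChartedSpace H' M] [IsManifold J ∞ M]
  [RiemannianBundle (fun x : M => TangentSpace J x)] [IsRiemannianManifold J M]

theorem exists_curve_of_edist_le {m m' : M} {a b : ℝ} (ha : 0 ≤ a)
    (hm : edist m m' ≤ ENNReal.ofReal a) (hab : a < b) :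
    ∃ γ : ℝ → M, γ 0 = m ∧ γ 1 = m' ∧ ContMDiff 𝓘(ℝ, ℝ) J 1 γ ∧
      pathELength J γ 0 1 ≤ ENNReal.ofReal b := by
  rw [IsRiemannianManifold.out (I := J) m m'] at hm
  have hlt : riemannianEDist J m m' < ENNReal.ofReal b :=
    hm.trans_lt ((ENNReal.ofReal_lt_ofReal_iff (ha.trans_lt hab)).2 hab)
  obtain ⟨γ, h0, h1, hγ, hlen, -, -⟩ :=
    exists_lt_locally_constant_of_riemannianEDist_lt hlt zero_lt_one
  exact ⟨γ, h0, h1, hγ, hlen.le⟩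

theorem edist_map_le {g : M → M} (hg : ContMDiff J J 1 g) {C : ℝ} (hC : 0 ≤ C)
    (hgC : ∀ ζ : TangentBundle J M, ‖(tangentMap J J g ζ).2‖ ≤ C * ‖ζ.2‖) {m m' : M} {a : ℝ}
    (ha : 0 ≤ a) (hm : edist m m' ≤ ENNReal.ofReal a) :
    edist (g m) (g m') ≤ ENNReal.ofReal (C * a) := by
  refine ENNReal.le_of_forall_pos_le_add fun ε hε _ => ?_
  have hε' : (0 : ℝ) < ε := hε
  obtain ⟨γ, h0, h1, hγ, hlen⟩ := exists_curve_of_edist_le (J := J) ha hm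
    (lt_add_of_pos_right a (show (0 : ℝ) < ε / (C + 1) by positivity))
  have hle : pathELength J (g ∘ γ) 0 1 ≤ ENNReal.ofReal C * pathELength J γ 0 1 := by
    rw [pathELength_eq_lintegral_mfderiv_Icc, pathELength_eq_lintegral_mfderiv_Icc,
      ← MeasureTheory.lintegral_const_mul' _ _ ENNReal.ofReal_ne_top]
    refine MeasureTheory.lintegral_mono fun t => ?_
    have h2 := tangentMap_comp_at (⟨t, (1 : ℝ)⟩ : TangentBundle 𝓘(ℝ, ℝ) ℝ)
      ((hg (γ t)).mdifferentiableAt (by norm_num)) ((hγ t).mdifferentiableAt (by norm_num))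
    have h3 := hgC (tangentMap 𝓘(ℝ, ℝ) J γ ⟨t, (1 : ℝ)⟩)
    rw [← h2] at h3
    rw [← ofReal_norm, ← ofReal_norm, ← ENNReal.ofReal_mul hC]
    exact ENNReal.ofReal_le_ofReal h3
  calc edist (g m) (g m') ≤ pathELength J (g ∘ γ) 0 1 := by
        rw [IsRiemannianManifold.out (I := J) (g m) (g m')]
        exact riemannianEDist_le_pathELength (hg.comp hγ).contMDiffOn (congrArg g h0)
          (congrArg g h1) zero_le_one
    _ ≤ ENNReal.ofReal C * ENNReal.ofReal (a + ε / (C + 1)) := hle.trans (by gcongr)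
    _ = ENNReal.ofReal (C * a + C * (ε / (C + 1))) := by
        rw [← ENNReal.ofReal_mul hC, mul_add]
    _ ≤ ENNReal.ofReal (C * a + ε) := by
        refine ENNReal.ofReal_le_ofReal (by
          gcongr
          rw [mul_div_assoc', div_le_iff₀ (by positivity)]
          nlinarith)
    _ = ENNReal.ofReal (C * a) + ε := by
        rw [ENNReal.ofReal_add (by positivity) hε'.le, ENNReal.ofReal_coe_nnreal]

theorem norm_sub_le_of_vectorDeriv_le {F : Type*} [NormedAddCommGroup F] [NormedSpace ℝ F]
    {g : M → F} (hg : ContMDiff J 𝓘(ℝ, F) 1 g) {C : ℝ} (hC : 0 ≤ C)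
    (hgC : ∀ ζ : TangentBundle J M, ‖vectorDeriv J g ζ‖ ≤ C * ‖ζ.2‖) {m m' : M} {a : ℝ}
    (ha : 0 ≤ a) (hm : edist m m' ≤ ENNReal.ofReal a) : ‖g m - g m'‖ ≤ C * a := by
  refine le_of_forall_pos_le_add fun ε hε => ?_
  obtain ⟨γ, h0, h1, hγ, hlen⟩ := exists_curve_of_edist_le (J := J) ha hm
    (lt_add_of_pos_right a (show (0 : ℝ) < ε / (C + 1) by positivity))
  have hsm : ContDiff ℝ 1 (g ∘ γ) := (hg.comp hγ).contDiff
  have hle : ∫⁻ t in Icc (0 : ℝ) 1, ‖deriv (g ∘ γ) t‖ₑ ≤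
      ENNReal.ofReal C * pathELength J γ 0 1 := by
    rw [pathELength_eq_lintegral_mfderiv_Icc,
      ← MeasureTheory.lintegral_const_mul' _ _ ENNReal.ofReal_ne_top]
    refine MeasureTheory.lintegral_mono fun t => ?_
    have h2 := vectorDeriv_comp (ξ := (⟨t, (1 : ℝ)⟩ : TangentBundle 𝓘(ℝ, ℝ) ℝ))
      ((hg (γ t)).mdifferentiableAt (by norm_num)) ((hγ t).mdifferentiableAt (by norm_num))
    have h3 := hgC (tangentMap 𝓘(ℝ, ℝ) J γ ⟨t, (1 : ℝ)⟩)
    rw [← h2, vectorDeriv_eq_fderiv] at h3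
    rw [← ofReal_norm, ← ofReal_norm, ← ENNReal.ofReal_mul hC]
    exact ENNReal.ofReal_le_ofReal h3
  have h4 : ‖g m - g m'‖ₑ ≤ ENNReal.ofReal (C * (a + ε / (C + 1))) := by
    calc ‖g m - g m'‖ₑ = ‖(g ∘ γ) 1 - (g ∘ γ) 0‖ₑ := by
          rw [Function.comp, Function.comp, h0, h1, ← enorm_neg, neg_sub]
      _ ≤ _ := enorm_sub_le_lintegral_deriv_of_contDiffOn_Icc hsm.contDiffOn zero_le_one
      _ ≤ ENNReal.ofReal C * ENNReal.ofReal (a + ε / (C + 1)) := hle.trans (by gcongr)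
      _ = _ := by rw [← ENNReal.ofReal_mul hC]
  rw [← ofReal_norm, ENNReal.ofReal_le_ofReal_iff (by positivity)] at h4
  refine h4.trans ?_
  rw [mul_add]
  gcongr
  rw [mul_div_assoc', div_le_iff₀ (by positivity)]
  nlinarith

theorem edist_le_of_curve {γ : ℝ → M} (hγ : ContMDiffOn 𝓘(ℝ, ℝ) J 1 γ (Icc 0 1)) {C : ℝ}
    (hC : ∀ t ∈ Icc (0 : ℝ) 1, ‖(tangentMap 𝓘(ℝ, ℝ) J γ ⟨t, (1 : ℝ)⟩).2‖ ≤ C) :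
    edist (γ 0) (γ 1) ≤ ENNReal.ofReal C := by
  rw [IsRiemannianManifold.out (I := J) (γ 0) (γ 1)]
  refine (riemannianEDist_le_pathELength hγ rfl rfl zero_le_one).trans ?_
  rw [pathELength_eq_lintegral_mfderiv_Icc]
  calc _ ≤ ∫⁻ t in Icc (0 : ℝ) 1, ENNReal.ofReal C := by
        refine MeasureTheory.setLIntegral_mono measurable_const fun t ht => ?_
        rw [← ofReal_norm]
        exact ENNReal.ofReal_le_ofReal (hC t ht)
    _ = _ := by simp

end Curves

section Local

variable {E : Type*} [NormedAddCommGroup E] [NormedSpace ℝ E] [FiniteDimensional ℝ E]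
  {H : Type*} [TopologicalSpace H] {I : ModelWithCorners ℝ E H}
  {B : Type*} [TopologicalSpace B] [T2Space B] [CompactSpace B] [ChartedSpace H B]
  [IsManifold I ∞ B] [RiemannianBundle (fun x : B => TangentSpace I x)]
  [IsContMDiffRiemannianBundle I ∞ E (fun x : B => TangentSpace I x)]
  {E' : Type*} [NormedAddCommGroup E'] [NormedSpace ℝ E'] [FiniteDimensional ℝ E']
  {H' : Type*} [TopologicalSpace H'] {J : ModelWithCorners ℝ E' H'}
  {M : Type*} [EMetricSpace M] [CompactSpace M] [ChartedSpace H' M] [IsManifold J ∞ M]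
  [RiemannianBundle (fun x : M => TangentSpace J x)]
  [IsContMDiffRiemannianBundle J ∞ E' (fun x : M => TangentSpace J x)]
  [IsRiemannianManifold J M]
  {h : B → B} {f : B → M → M} {N : ℕ} {ι : B × M → EuclideanSpace ℝ (Fin N)}

theorem contMDiff_slice_left {n : ℕ∞ω} (m : M) :
    ContMDiff I (I.prod J) n (fun b : B => (b, m)) :=
  contMDiff_id.prodMk contMDiff_const

theorem contMDiff_slice_right {n : ℕ∞ω} (b : B) :
    ContMDiff J (I.prod J) n (fun m : M => (b, m)) :=
  contMDiff_const.prodMk contMDiff_id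

/-- Estimates, in the charts at `b₀` and `h b₀`, for the perturbations of the skew product. -/
theorem exists_local_estimate (hh : ContMDiff I I 2 h)
    (hF : ContMDiff (I.prod J) (I.prod J) 1 (skew h f)) (hι : IsSmoothInjectiveImmersion I J ι)
    {K L : ℝ} (hK0 : 0 ≤ K) (hKL : K ≤ L)
    (hK : ∀ b m, ‖mfderiv I J (fun b' => f b' m) b‖ ≤ K)
    (hL : ∀ b m, ‖mfderiv J J (f b) m‖ ≤ L) {b₀ : B} (hb₀ : I.IsInteriorPoint b₀) {ε : ℝ}
    (hε : 0 < ε) :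
    ∃ c, 1 ≤ c ∧
      Metric.ball (extChartAt I b₀ b₀) (1 / c) ⊆ interior (extChartAt I b₀).target ∧
      (∀ z ∈ Metric.ball (extChartAt I b₀ b₀) (1 / c),
        h ((extChartAt I b₀).symm z) ∈ (extChartAt I (h b₀)).source) ∧
      ∀ (G : B × M → B × M) (ρ : ℝ),
      ContMDiff (I.prod J) (I.prod J) 1 G → C1DistLT I J ι G (skew h f) ρ → ρ ≤ 1 / c →
      (∀ z ∈ Metric.ball (extChartAt I b₀ b₀) (1 / c), ∀ m : M,
        (G ((extChartAt I b₀).symm z, m)).1 ∈ (extChartAt I (h b₀)).source ∧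
        ‖extChartAt I (h b₀) (G ((extChartAt I b₀).symm z, m)).1 -
          extChartAt I (h b₀) (h ((extChartAt I b₀).symm z))‖ ≤ c * ρ) ∧
      (∀ z ∈ Metric.ball (extChartAt I b₀ b₀) (1 / c),
        ∀ z' ∈ Metric.ball (extChartAt I b₀ b₀) (1 / c), ∀ m : M,
        ‖(extChartAt I (h b₀) (G ((extChartAt I b₀).symm z, m)).1 -
          extChartAt I (h b₀) (h ((extChartAt I b₀).symm z))) -
         (extChartAt I (h b₀) (G ((extChartAt I b₀).symm z', m)).1 -
          extChartAt I (h b₀) (h ((extChartAt I b₀).symm z')))‖ ≤ c * ρ * ‖z - z'‖) ∧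
      (∀ z ∈ Metric.ball (extChartAt I b₀ b₀) (1 / c), ∀ (m m' : M) (a : ℝ), 0 ≤ a →
        edist m m' ≤ ENNReal.ofReal a →
        ‖extChartAt I (h b₀) (G ((extChartAt I b₀).symm z, m)).1 -
          extChartAt I (h b₀) (G ((extChartAt I b₀).symm z, m')).1‖ ≤ c * ρ * a ∧
        edist (G ((extChartAt I b₀).symm z, m)).2 (G ((extChartAt I b₀).symm z, m')).2 ≤
          ENNReal.ofReal ((L + ε) * a)) ∧
      (∀ z ∈ Metric.ball (extChartAt I b₀ b₀) (1 / c),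
        ∀ z' ∈ Metric.ball (extChartAt I b₀ b₀) (1 / c), ∀ m : M,
        ∀ b ∈ (extChartAt I b₀).source,
        extChartAt I b₀ b ∈ Metric.ball (extChartAt I b₀ b₀) (1 / c) →
        ∀ v : TangentSpace I b, chartVec I b₀ ⟨b, v⟩ = z' - z →
        edist (G ((extChartAt I b₀).symm z, m)).2 (G ((extChartAt I b₀).symm z', m)).2 ≤
          ENNReal.ofReal ((K + ε) * ‖v‖)) := by
  have : IsManifold I 1 B := IsManifold.of_le (n := ∞) one_le_smooth
  set e := extChartAt I b₀ with he
  set κ := extChartAt I (h b₀) with hκ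
  set q := Real.sqrt (1 + ε / (2 * (K + ε))) with hq
  have hq1 : 1 < q := Real.lt_sqrt_of_sq_lt (by
    have : 0 < ε / (2 * (K + ε)) := by positivity
    linarith)
  have hqq : q * q = 1 + ε / (2 * (K + ε)) := Real.mul_self_sqrt (by positivity)
  obtain ⟨c₁, hc₁, hest⟩ := exists_perturbation_estimate hh hF hι hKL hK hL hb₀
    (half_pos hε)
  obtain ⟨c₂, hc₂, hnorm⟩ := exists_eventually_norm_le_chartVec I b₀
  have hsrc := extChartAt_mem_interior_target I (mem_extChartAt_source b₀) hb₀
  have hsym : e.symm (e b₀) = b₀ := e.left_inv (mem_extChartAt_source b₀)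
  have hsymc : ContinuousAt e.symm (e b₀) := continuousAt_extChartAt_symm b₀
  have hev := hsymc.eventually (show ∀ᶠ b in 𝓝 (e.symm (e b₀)), _ by
    rw [hsym]
    exact (hest.and (hnorm.and ((eventually_norm_le_chartNorm I b₀ hq1).and
      (hh.continuous.continuousAt.preimage_mem_nhds (extChartAt_source_mem_nhds (I := I) (h b₀)))))))
  obtain ⟨r, hr, hrs⟩ := Metric.nhds_basis_ball.mem_iff.1
    (Filter.inter_mem hev (isOpen_interior.mem_nhds hsrc))
  set c := max (max (c₁ * c₂) (1 / r)) 1 with hc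
  have hcc : c₁ * c₂ ≤ c := (le_max_left _ _).trans (le_max_left _ _)
  have hcr : 1 / r ≤ c := (le_max_right _ _).trans (le_max_left _ _)
  have hc1 : 1 ≤ c := le_max_right _ _
  have hc0 : 0 < c := by linarith
  have hc₁c : c₁ ≤ c := (le_mul_of_one_le_right (by linarith) hc₂).trans hcc
  have hcr' : 1 / c ≤ r := by
    rw [div_le_iff₀ hc0]; rw [div_le_iff₀ hr] at hcr; linarith
  have hsub : ∀ z ∈ Metric.ball (e b₀) (1 / c), _ := fun z hz =>
    hrs (Metric.ball_subset_ball hcr' hz)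
  have hL0 : 0 ≤ L := hK0.trans hKL
  refine ⟨c, hc1, fun z hz => (hsub z hz).2, fun z hz => (hsub z hz).1.2.2.2,
    fun G ρ hG hGF hρ => ?_⟩
  have hρ₁ : ρ ≤ 1 / c₁ := hρ.trans (one_div_le_one_div_of_le (by linarith) hc₁c)
  have hmain : ∀ z ∈ Metric.ball (e b₀) (1 / c), _ := fun z hz =>
    (hsub z hz).1.1 G ρ hG hGF hρ₁
  have hGd : ∀ p, MDifferentiableAt (I.prod J) (I.prod J) G p := fun p =>
    (hG p).mdifferentiableAt (by norm_num)
  have hhd : ∀ p, MDifferentiableAt I I h p := fun p => (hh p).mdifferentiableAt (by norm_num)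
  have hκd : ∀ p ∈ κ.source, MDifferentiableAt I 𝓘(ℝ, E) κ p := fun p hp =>
    mdifferentiableAt_extChartAt (by rwa [hκ, extChartAt_source] at hp)
  have hρ0 : M → 0 ≤ ρ := fun m => by
    obtain ⟨ρ', hρ', hd⟩ := hGF
    exact (norm_nonneg _).trans ((hd ⟨(b₀, m), 0⟩).1.trans hρ'.le)
  -- slices of `G`
  have hleft : ∀ (m : M) (ζ : TangentBundle I B),
      tangentMap I (I.prod J) (fun x : B => G (x, m)) ζ = tangentMap (I.prod J) (I.prod J) G
        ⟨(ζ.1, m), (ζ.2, 0)⟩ := fun m ζ => by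
    have h1 := tangentMap_comp_at (I := I) (I' := I.prod J) (I'' := I.prod J) (g := G)
      (f := fun x : B => (x, m)) ζ (hGd _)
      ((contMDiff_slice_left (n := 1) m ζ.1).mdifferentiableAt (by norm_num))
    rw [tangentMap_prod_left] at h1
    exact h1
  have hright : ∀ (b : B) (ζ : TangentBundle J M),
      tangentMap J (I.prod J) (fun x : M => G (b, x)) ζ = tangentMap (I.prod J) (I.prod J) G
        ⟨(b, ζ.1), (0, ζ.2)⟩ := fun b ζ => by
    have h1 := tangentMap_comp_at (I := J) (I' := I.prod J) (I'' := I.prod J) (g := G)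
      (f := fun x : M => (b, x)) ζ (hGd _)
      ((contMDiff_slice_right (n := 1) b ζ.1).mdifferentiableAt (by norm_num))
    rw [tangentMap_prod_right] at h1
    exact h1
  have hGl : ∀ m, ContMDiff I (I.prod J) 1 (fun x : B => G (x, m)) := fun m =>
    hG.comp (contMDiff_slice_left m)
  have hGr : ∀ b, ContMDiff J (I.prod J) 1 (fun x : M => G (b, x)) := fun b =>
    hG.comp (contMDiff_slice_right b)
  have hbase : ∀ ζ : TangentBundle (I.prod J) (B × M),
      tangentMap (I.prod J) I Prod.fst ζ = baseVec ζ := fun ζ => tangentMap_prodFst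
  have hfiber : ∀ ζ : TangentBundle (I.prod J) (B × M),
      tangentMap (I.prod J) J Prod.snd ζ = fiberVec ζ := fun ζ => tangentMap_prodSnd
  have hlift : ∀ z ∈ Metric.ball (e b₀) (1 / c), ∀ v, ‖(liftVec I b₀ z v).2‖ ≤ c₂ * ‖v‖ :=
    fun z hz v => by
      have h1 := ((hsub z hz).1.2.1 (liftVec I b₀ z v).2).1
      have h2 := chartVec_liftVec (hsub z hz).2 v
      exact h1.trans (le_of_eq (congrArg (fun x : E => c₂ * ‖x‖) h2))
  refine ⟨fun z hz m => ?_, fun z hz z' hz' m => ?_, fun z hz m m' a ha hm => ⟨?_, ?_⟩,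
    fun z hz z' hz' m b hb hbz v hv => ?_⟩
  · obtain ⟨h1, h2, -⟩ := (hmain z hz).2 m
    exact ⟨h1, h2.trans (by have := hρ0 m; gcongr)⟩
  · have hA : ∀ z ∈ Metric.ball (e b₀) (1 / c),
        MDifferentiableAt I 𝓘(ℝ, E) (κ ∘ Prod.fst ∘ fun x : B => G (x, m)) (e.symm z) :=
      fun z hz => MDifferentiableAt.comp (I' := I) (e.symm z) (hκd _ ((hmain z hz).2 m).1)
        (MDifferentiableAt.comp (I' := I.prod J) (e.symm z) mdifferentiableAt_fst
          ((hGl m _).mdifferentiableAt (by norm_num)))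
    have hB : ∀ z ∈ Metric.ball (e b₀) (1 / c),
        MDifferentiableAt I 𝓘(ℝ, E) (κ ∘ h) (e.symm z) :=
      fun z hz => (hκd _ (hmain z hz).1).comp _ (hhd _)
    have hd : ∀ u : B → E, ∀ z ∈ Metric.ball (e b₀) (1 / c),
        MDifferentiableAt I 𝓘(ℝ, E) u (e.symm z) → DifferentiableAt ℝ (u ∘ e.symm) z :=
      fun u z hz hu => (hu.comp z
        (mdifferentiableAt_extChartAt_symm_of_mem_interior (hsub z hz).2)).differentiableAt
    have hbound : ∀ z ∈ Metric.ball (e b₀) (1 / c),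
        ‖fderiv ℝ (fun z => ((κ ∘ Prod.fst ∘ fun x : B => G (x, m)) ∘ e.symm) z -
          ((κ ∘ h) ∘ e.symm) z) z‖ ≤ c * ρ := fun z hz => by
      have hρm := hρ0 m
      refine ContinuousLinearMap.opNorm_le_bound _ (by positivity) fun v => ?_
      rw [fderiv_fun_sub (hd _ z hz (hA z hz)) (hd _ z hz (hB z hz)), sub_apply,
        fderiv_comp_extChartAt_symm (hsub z hz).2 (hA z hz),
        fderiv_comp_extChartAt_symm (hsub z hz).2 (hB z hz)]
      set ζ := liftVec I b₀ z v with hζ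
      have h1 : vectorDeriv I (κ ∘ Prod.fst ∘ fun x : B => G (x, m)) ζ =
          chartVec I (h b₀) (baseVec (tangentMap (I.prod J) (I.prod J) G
            ⟨(ζ.1, m), (ζ.2, 0)⟩)) := by
        have h2 : MDifferentiableAt I (I.prod J) (fun x : B => G (x, m)) ζ.1 :=
          (hGl m _).mdifferentiableAt (by norm_num)
        rw [vectorDeriv_comp (J := I) (hκd _ ((hmain z hz).2 m).1)
          (mdifferentiableAt_fst.comp _ h2),
          tangentMap_comp_at (I' := I.prod J) ζ mdifferentiableAt_fst h2, hbase, hleft]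
        rfl
      have h3 : vectorDeriv I (κ ∘ h) ζ = chartVec I (h b₀) (tangentMap I I h ζ) :=
        vectorDeriv_comp (hκd _ (hmain z hz).1) (hhd _)
      have h4 := (((hmain z hz).2 m).2.2 ⟨(ζ.1, m), (ζ.2, 0)⟩ rfl).1
      have h5 : ‖(fiberVec (⟨(ζ.1, m), (ζ.2, 0)⟩ : TangentBundle (I.prod J) (B × M))).2‖ = 0 :=
        norm_zero (E := TangentSpace J m)
      rw [h1, h3]
      refine h4.trans ?_
      rw [h5, add_zero]
      calc _ ≤ c₁ * ρ * (c₂ * ‖v‖) := mul_le_mul_of_nonneg_left (hlift z hz v) (by positivity)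
        _ = c₁ * c₂ * (ρ * ‖v‖) := by ring
        _ ≤ c * (ρ * ‖v‖) := by gcongr
        _ = _ := by ring
    exact (convex_ball (e b₀) (1 / c)).norm_image_sub_le_of_norm_fderiv_le
      (fun z hz => (hd _ z hz (hA z hz)).sub (hd _ z hz (hB z hz))) hbound hz' hz
  · have hρm := hρ0 m
    set b := e.symm z with hb
    refine norm_sub_le_of_vectorDeriv_le (J := J)
      (g := κ ∘ Prod.fst ∘ fun x : M => G (b, x)) (fun x => ?_) (C := c * ρ)
      (by positivity) (fun ζ => ?_) ha hm
    · have h1 : ContMDiffAt I 𝓘(ℝ, E) 1 κ (G (b, x)).1 :=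
        contMDiffAt_extChartAt' (by
          have := ((hmain z hz).2 x).1
          rwa [extChartAt_source] at this)
      exact h1.comp x (contMDiffAt_fst.comp x (hGr b x))
    · have h2 : MDifferentiableAt J (I.prod J) (fun x : M => G (b, x)) ζ.1 :=
        (hGr b _).mdifferentiableAt (by norm_num)
      have h1 : vectorDeriv J (κ ∘ Prod.fst ∘ fun x : M => G (b, x)) ζ =
          chartVec I (h b₀) (baseVec (tangentMap (I.prod J) (I.prod J) G
            ⟨(b, ζ.1), (0, ζ.2)⟩)) := by
        rw [vectorDeriv_comp (J := I) (hκd _ ((hmain z hz).2 _).1)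
          (mdifferentiableAt_fst.comp _ h2),
          tangentMap_comp_at (I' := I.prod J) ζ mdifferentiableAt_fst h2, hbase, hright]
        rfl
      have h4 := (((hmain z hz).2 _).2.2 ⟨(b, ζ.1), (0, ζ.2)⟩ rfl).1
      have h5 : ‖(baseVec (⟨(b, ζ.1), (0, ζ.2)⟩ : TangentBundle (I.prod J) (B × M))).2‖ = 0 :=
        norm_zero (E := TangentSpace I b)
      have h6 : chartVec I (h b₀) (tangentMap I I h
          (baseVec (⟨(b, ζ.1), (0, ζ.2)⟩ : TangentBundle (I.prod J) (B × M)))) = 0 := by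
        have h7 : (mfderiv I I h b : E →L[ℝ] E) 0 = 0 := map_zero _
        have h8 : (mfderiv I 𝓘(ℝ, E) κ (h b) : E →L[ℝ] E) 0 = 0 := map_zero _
        exact (congrArg (mfderiv I 𝓘(ℝ, E) κ (h b) : E →L[ℝ] E) h7).trans h8
      rw [h5, h6, sub_zero, zero_add] at h4
      rw [h1]
      exact h4.trans (mul_le_mul_of_nonneg_right (by gcongr) (norm_nonneg _))
  · set b := e.symm z with hb
    refine edist_map_le (J := J) (g := Prod.snd ∘ fun x : M => G (b, x))
      (contMDiff_snd.comp (hGr b)) (by positivity) (fun ζ => ?_) ha hm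
    have h2 : MDifferentiableAt J (I.prod J) (fun x : M => G (b, x)) ζ.1 :=
      (hGr b _).mdifferentiableAt (by norm_num)
    have h4 := (((hmain z hz).2 _).2.2 ⟨(b, ζ.1), (0, ζ.2)⟩ rfl).2
    have h5 : ‖(baseVec (⟨(b, ζ.1), (0, ζ.2)⟩ : TangentBundle (I.prod J) (B × M))).2‖ = 0 :=
      norm_zero (E := TangentSpace I b)
    rw [tangentMap_comp_at (I' := I.prod J) ζ mdifferentiableAt_snd h2, hfiber, hright]
    rw [h5, mul_zero, zero_add] at h4
    exact h4.trans (mul_le_mul_of_nonneg_right (by linarith) (norm_nonneg _))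
  · have hzt : ∀ t ∈ Icc (0 : ℝ) 1, z + t • (z' - z) ∈ Metric.ball (e b₀) (1 / c) := fun t ht =>
      (convex_ball (e b₀) (1 / c)).add_smul_sub_mem hz hz' ht
    have hline : ContMDiff 𝓘(ℝ, ℝ) 𝓘(ℝ, E) 1 (fun t : ℝ => z + t • (z' - z)) :=
      (contDiff_const.add (contDiff_id.smul contDiff_const)).contMDiff
    have hαt : ∀ t ∈ Icc (0 : ℝ) 1,
        ContMDiffAt 𝓘(ℝ, ℝ) I 1 (e.symm ∘ fun t : ℝ => z + t • (z' - z)) t := fun t ht =>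
      ContMDiffAt.comp (I' := 𝓘(ℝ, E)) t (((contMDiffOn_extChartAt_symm (n := 1) b₀).contMDiffAt
        (mem_interior_iff_mem_nhds.1 (hsub _ (hzt t ht)).2))) (hline t)
    have hγ := edist_le_of_curve (J := J) (C := (K + ε) * ‖v‖)
      (γ := (Prod.snd ∘ fun x : B => G (x, m)) ∘ e.symm ∘ fun t : ℝ => z + t • (z' - z))
      (fun t ht => (((contMDiff_snd.comp (hGl m)) _).comp t (hαt t ht)).contMDiffWithinAt)
      (fun t ht => ?_)
    · simpa using hγ
    set w := z + t • (z' - z) with hw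
    have hvel : tangentMap 𝓘(ℝ, ℝ) I (e.symm ∘ fun t : ℝ => z + t • (z' - z)) ⟨t, (1 : ℝ)⟩ =
        liftVec I b₀ w (z' - z) := by
      rw [tangentMap_comp_at (I' := 𝓘(ℝ, E)) _
        (mdifferentiableAt_extChartAt_symm_of_mem_interior (hsub _ (hzt t ht)).2)
        ((hline t).mdifferentiableAt (by norm_num)), liftVec]
      have hd : HasDerivAt (fun t : ℝ => z + t • (z' - z)) (z' - z) t := by
        simpa using ((hasDerivAt_id t).smul_const (z' - z)).const_add z
      have hd' : vectorDeriv 𝓘(ℝ, ℝ) (fun t : ℝ => z + t • (z' - z)) ⟨t, (1 : ℝ)⟩ = z' - z := by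
        rw [vectorDeriv_eq_fderiv, hd.hasFDerivAt.fderiv]
        exact one_smul ℝ _
      exact congrArg (fun v : E => tangentMap 𝓘(ℝ, E) I e.symm (⟨w, v⟩ : TangentBundle 𝓘(ℝ, E) E))
        hd'
    have h2 : MDifferentiableAt I (I.prod J) (fun x : B => G (x, m)) (e.symm w) :=
      (hGl m _).mdifferentiableAt (by norm_num)
    set ζ := liftVec I b₀ w (z' - z) with hζ
    rw [tangentMap_comp_at (I' := I) _ (mdifferentiableAt_snd.comp _ h2)
      ((hαt t ht).mdifferentiableAt (by norm_num)), hvel,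
      tangentMap_comp_at (I' := I.prod J) ζ mdifferentiableAt_snd h2, hfiber, hleft]
    have h4 := (((hmain _ (hzt t ht)).2 m).2.2 ⟨(ζ.1, m), (ζ.2, 0)⟩ rfl).2
    have h5 : ‖(fiberVec (⟨(ζ.1, m), (ζ.2, 0)⟩ : TangentBundle (I.prod J) (B × M))).2‖ = 0 :=
      norm_zero (E := TangentSpace J m)
    rw [h5, mul_zero, add_zero] at h4
    have h6 : ‖ζ.2‖ ≤ q * (q * ‖v‖) := by
      refine ((hsub _ (hzt t ht)).1.2.2.1 ζ.2).1.trans ?_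
      have h7 : chartVec I b₀ ⟨e.symm w, ζ.2⟩ = z' - z :=
        chartVec_liftVec (hsub _ (hzt t ht)).2 (z' - z)
      have h8 := (hsub _ hbz).1.2.2.1
      have h9 : ∀ b', b' = b → (∀ v : TangentSpace I b',
        ‖v‖ ≤ q * chartNorm I b₀ (chartVec I b₀ ⟨b', v⟩) ∧
          chartNorm I b₀ (chartVec I b₀ ⟨b', v⟩) ≤ q * ‖v‖) →
          chartNorm I b₀ (chartVec I b₀ ⟨b, v⟩) ≤ q * ‖v‖ := by
        rintro b' rfl h; exact (h v).2
      have h10 := h9 _ (e.left_inv hb) h8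
      rw [h7]
      rw [hv] at h10
      gcongr
    calc _ ≤ (K + ε / 2) * ‖ζ.2‖ := h4
      _ ≤ (K + ε / 2) * (q * (q * ‖v‖)) := by gcongr
      _ = (K + ε / 2) * (q * q) * ‖v‖ := by ring
      _ ≤ (K + ε) * ‖v‖ := by
        gcongr
        rw [hqq, mul_add, mul_one]
        have : (K + ε / 2) * (ε / (2 * (K + ε))) ≤ ε / 2 := by
          rw [mul_div_assoc', div_le_div_iff₀ (by positivity) (by norm_num)]
          nlinarith
        linarith

end Local

section Implicit

variable {V E : Type*} [NormedAddCommGroup V] [NormedSpace ℝ V] [CompleteSpace V]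
  [NormedAddCommGroup E] [NormedSpace ℝ E] {M : Type*} [EMetricSpace M]

theorem exists_add_eq_of_lipschitz {S : V → V} {c : ℝ} (hc : 0 < c) (hS0 : S 0 = 0)
    (hS : ∀ s ≤ 1 / c, ∀ x x', ‖x‖ ≤ s → ‖x'‖ ≤ s → ‖S x - S x'‖ ≤ c * s * ‖x - x'‖) {w : V}
    (hw : ‖w‖ ≤ 1 / (4 * c)) : ∃ y, ‖y‖ ≤ 2 * ‖w‖ ∧ y + S y = w := by
  rcases subsingleton_or_nontrivial V with hV | hV
  · exact ⟨0, by simp, Subsingleton.elim _ _⟩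
  have hw2 : 2 * ‖w‖ ≤ 1 / (2 * c) := by
    calc 2 * ‖w‖ ≤ 2 * (1 / (4 * c)) := by gcongr
      _ = _ := by field_simp; norm_num
  have h1 : ApproximatesLinearOn (fun x => x + S x)
      ((ContinuousLinearEquiv.refl ℝ V : V ≃L[ℝ] V) : V →L[ℝ] V)
      (Metric.closedBall 0 (2 * ‖w‖)) (1 / 2) :=
    approximatesLinearOn_add_of_lipschitz fun x hx x' hx' => by
      rw [mem_closedBall_zero_iff] at hx hx'
      refine (hS (1 / (2 * c)) (one_div_le_one_div_of_le hc (by linarith)) x x' (hx.trans hw2)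
        (hx'.trans hw2)).trans (le_of_eq ?_)
      field_simp
  have h2 := h1.surjOn_closedBall_of_nonlinearRightInverse
    (ContinuousLinearEquiv.refl ℝ V).toNonlinearRightInverse
    (ε := 2 * ‖w‖) (by positivity) Subset.rfl
  have h3 : ((ContinuousLinearEquiv.refl ℝ V).toNonlinearRightInverse).nnnorm = 1 := by
    simp only [ContinuousLinearEquiv.toNonlinearRightInverse]
    ext
    exact ContinuousLinearMap.norm_id
  obtain ⟨y, hy, hyw⟩ := @h2 w (by
    rw [h3, hS0, add_zero, mem_closedBall_zero_iff]
    simp only [inv_one, NNReal.coe_one, one_div, NNReal.coe_inv, NNReal.coe_ofNat]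
    linarith)
  exact ⟨y, mem_closedBall_zero_iff.1 hy, hyw⟩

/-- A map written in two charts in normal form, as a perturbation of its linear part. -/
theorem exists_model_of_normal_form {c : ℝ} (hc : 1 ≤ c) {Φ Φ' : V ≃L[ℝ] E} {S S' : V → V}
    (hΦ : ∀ x, ‖Φ x‖ ≤ c * ‖x‖) (hΦ' : ∀ y, ‖Φ'.symm y‖ ≤ c * ‖y‖)
    (hS0 : S 0 = 0) (hS'0 : S' 0 = 0)
    (hS : ∀ s ≤ 1 / c, ∀ x x', ‖x‖ ≤ s → ‖x'‖ ≤ s → ‖S x - S x'‖ ≤ c * s * ‖x - x'‖)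
    (hS' : ∀ s ≤ 1 / c, ∀ x x', ‖x‖ ≤ s → ‖x'‖ ≤ s → ‖S' x - S' x'‖ ≤ c * s * ‖x - x'‖)
    {z₀ : E} {η : E → E} {D : E →L[ℝ] E} (hD : ‖D‖ ≤ c)
    (hη : ∀ t ≤ 1 / c, ∀ z ∈ Metric.closedBall z₀ t, ∀ z' ∈ Metric.closedBall z₀ t,
      ‖η z - η z' - D (z - z')‖ ≤ c * t * ‖z - z'‖)
    {g : E → M → E} {ρ δ : ℝ} (hρ0 : 0 ≤ ρ) (hρ : ρ ≤ δ) (hδ : δ ≤ 1 / (400 * c ^ 9))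
    (hg : ∀ z ∈ Metric.closedBall z₀ (1 / c), ∀ m, ‖g z m - η z‖ ≤ c * ρ)
    (hgz : ∀ z ∈ Metric.closedBall z₀ (1 / c), ∀ z' ∈ Metric.closedBall z₀ (1 / c), ∀ m,
      ‖(g z m - η z) - (g z' m - η z')‖ ≤ c * ρ * ‖z - z'‖)
    (hgm : ∀ z ∈ Metric.closedBall z₀ (1 / c), ∀ (m m' : M) (a : ℝ), 0 ≤ a →
      edist m m' ≤ ENNReal.ofReal a → ‖g z m - g z m'‖ ≤ c * ρ * a) :
    (∀ x, ‖x‖ ≤ δ → z₀ + Φ (x + S x) ∈ Metric.closedBall z₀ (1 / c)) ∧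
    ∃ Y : V → M → V,
      (∀ x m, ‖x‖ ≤ δ → ‖Y x m‖ ≤ 400 * c ^ 9 * δ ∧ ‖Y x m‖ ≤ 1 / c ∧
        η z₀ + Φ' (Y x m + S' (Y x m)) = g (z₀ + Φ (x + S x)) m ∧
        ‖Y x m - Φ'.symm (D (Φ x))‖ ≤ 400 * c ^ 9 * (δ ^ 2 + ρ)) ∧
      (∀ x x' m, ‖x‖ ≤ δ → ‖x'‖ ≤ δ →
        ‖Y x m - Y x' m - Φ'.symm (D (Φ (x - x')))‖ ≤ 400 * c ^ 9 * δ * ‖x - x'‖) ∧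
      (∀ x (m m' : M) (a : ℝ), ‖x‖ ≤ δ → 0 ≤ a → edist m m' ≤ ENNReal.ofReal a →
        ‖Y x m - Y x m'‖ ≤ 400 * c ^ 9 * ρ * a) := by
  have hc0 : 0 < c := by linarith
  have hδ0 : 0 ≤ δ := hρ0.trans hρ
  have hpow : ∀ i j : ℕ, i ≤ j → c ^ i ≤ c ^ j := fun i j hij => pow_le_pow_right₀ hc hij
  have hδc : 400 * c ^ 9 * δ ≤ 1 := by
    rw [le_div_iff₀ (by positivity)] at hδ; linarith
  have hsmall : ∀ j : ℕ, j ≤ 9 → 400 * (c ^ j * δ) ≤ 1 := fun j hj => by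
    refine le_trans ?_ hδc
    rw [mul_assoc]
    have := hpow j 9 hj
    gcongr
  have hcδ : c * δ ≤ 1 / 2 := by
    have := hsmall 1 (by norm_num); rw [pow_one] at this; linarith
  have hδ1 : δ ≤ 1 := by
    have := hsmall 0 (by norm_num); rw [pow_zero, one_mul] at this; linarith
  have hδc' : δ ≤ 1 / c := by rw [le_div_iff₀ hc0]; linarith
  set z : V → E := fun x => z₀ + Φ (x + S x) with hz
  have hSδ : ∀ x x', ‖x‖ ≤ δ → ‖x'‖ ≤ δ → ‖S x - S x'‖ ≤ c * δ * ‖x - x'‖ := hS δ hδc'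
  have hzz : ∀ x x', ‖x‖ ≤ δ → ‖x'‖ ≤ δ → ‖z x - z x'‖ ≤ 2 * c * ‖x - x'‖ := fun x x' hx hx' => by
    have h1 : z x - z x' = Φ ((x - x') + (S x - S x')) := by
      simp only [hz, map_add, map_sub]; abel
    have h2 := hSδ x x' hx hx'
    have h3 : ‖(x - x') + (S x - S x')‖ ≤ 2 * ‖x - x'‖ := by
      refine (norm_add_le _ _).trans ?_
      nlinarith [norm_nonneg (x - x')]
    rw [h1]
    calc _ ≤ c * (2 * ‖x - x'‖) := (hΦ _).trans (by gcongr)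
      _ = _ := by ring
  have hz0 : z 0 = z₀ := by simp [hz, hS0]
  have hzmem : ∀ x, ‖x‖ ≤ δ → z x ∈ Metric.closedBall z₀ (2 * c * δ) := fun x hx => by
    have := hzz x 0 hx (by rw [norm_zero]; exact hδ0)
    rw [hz0, sub_zero] at this
    rw [mem_closedBall_iff_norm]
    exact this.trans (by gcongr)
  have h2cδ : 2 * c * δ ≤ 1 / c := by
    rw [le_div_iff₀ hc0]
    have := hsmall 2 (by norm_num)
    nlinarith
  have hzmem' : ∀ x, ‖x‖ ≤ δ → z x ∈ Metric.closedBall z₀ (1 / c) := fun x hx =>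
    Metric.closedBall_subset_closedBall h2cδ (hzmem x hx)
  refine ⟨hzmem', ?_⟩
  set P : V → M → V := fun x m => Φ'.symm (g (z x) m - η z₀) with hP
  set A : V → V := fun x => Φ'.symm (D (Φ x)) with hA
  have hAle : ∀ x, ‖A x‖ ≤ c ^ 3 * ‖x‖ := fun x => by
    calc ‖A x‖ ≤ c * (c * (c * ‖x‖)) := by
          refine (hΦ' _).trans ?_
          gcongr
          exact (D.le_opNorm _).trans (by gcongr; exact hΦ x)
      _ = _ := by ring
  have hPx : ∀ x x' m, ‖x‖ ≤ δ → ‖x'‖ ≤ δ →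
      ‖P x m - P x' m - A (x - x')‖ ≤ 7 * c ^ 4 * δ * ‖x - x'‖ := fun x x' m hx hx' => by
    have h1 : P x m - P x' m - A (x - x') = Φ'.symm (((g (z x) m - η (z x)) -
        (g (z x') m - η (z x'))) + (η (z x) - η (z x') - D (z x - z x')) +
        D (Φ (S x - S x'))) := by
      have h2 : z x - z x' = Φ (x - x') + Φ (S x - S x') := by
        simp only [hz, map_add, map_sub]; abel
      simp only [hP, hA]
      rw [h2, ← map_sub, ← map_sub]
      congr 1
      rw [map_add D]
      abel
    have h3 := hzz x x' hx hx'
    have h4 := hgz _ (hzmem' x hx) _ (hzmem' x' hx') m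
    have h5 := hη _ h2cδ _ (hzmem x hx) _ (hzmem x' hx')
    have h6 : ‖D (Φ (S x - S x'))‖ ≤ c * (c * (c * δ * ‖x - x'‖)) :=
      (D.le_opNorm _).trans (by
        gcongr
        exact (hΦ _).trans (by gcongr; exact hSδ x x' hx hx'))
    rw [h1]
    refine (hΦ' _).trans ?_
    calc _ ≤ c * (c * δ * (2 * c * ‖x - x'‖) + c * (2 * c * δ) * (2 * c * ‖x - x'‖) +
            c * (c * (c * δ * ‖x - x'‖))) := by
          gcongr
          refine (norm_add₃_le).trans ?_
          refine add_le_add (add_le_add (h4.trans ?_) (h5.trans ?_)) h6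
          · gcongr
          · gcongr
      _ = (2 * c ^ 3 + 5 * c ^ 4) * δ * ‖x - x'‖ := by ring
      _ ≤ (2 * c ^ 4 + 5 * c ^ 4) * δ * ‖x - x'‖ := by
          have := hpow 3 4 (by norm_num)
          gcongr
      _ = _ := by ring
  have hP0 : ∀ m, ‖P 0 m‖ ≤ c ^ 2 * ρ := fun m => by
    have h1 := hg z₀ (Metric.mem_closedBall_self (by positivity)) m
    simp only [hP, hz0]
    calc _ ≤ c * (c * ρ) := (hΦ' _).trans (by gcongr)
      _ = _ := by ring
  have hPA : ∀ x m, ‖x‖ ≤ δ → ‖P x m - A x‖ ≤ 7 * c ^ 4 * δ * δ + c ^ 2 * ρ := fun x m hx => by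
    have h1 := hPx x 0 m hx (by rw [norm_zero]; exact hδ0)
    rw [sub_zero] at h1
    calc ‖P x m - A x‖ = ‖(P x m - P 0 m - A x) + P 0 m‖ := by congr 1; abel
      _ ≤ 7 * c ^ 4 * δ * ‖x‖ + c ^ 2 * ρ := (norm_add_le _ _).trans (add_le_add h1 (hP0 m))
      _ ≤ _ := by gcongr
  have hPle : ∀ x m, ‖x‖ ≤ δ → ‖P x m‖ ≤ 9 * c ^ 4 * δ := fun x m hx => by
    have h0 : 1 ≤ c ^ 4 := one_le_pow₀ hc
    have h34 := hpow 3 4 (by norm_num)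
    have h24 := hpow 2 4 (by norm_num)
    calc ‖P x m‖ = ‖(P x m - A x) + A x‖ := by congr 1; abel
      _ ≤ (7 * c ^ 4 * δ * δ + c ^ 2 * ρ) + c ^ 3 * ‖x‖ :=
        (norm_add_le _ _).trans (add_le_add (hPA x m hx) (hAle x))
      _ ≤ (7 * c ^ 4 * δ * 1 + c ^ 4 * δ) + c ^ 4 * δ := by gcongr
      _ = _ := by ring
  have hPlip : ∀ x x' m, ‖x‖ ≤ δ → ‖x'‖ ≤ δ → ‖P x m - P x' m‖ ≤ 8 * c ^ 4 * ‖x - x'‖ :=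
    fun x x' m hx hx' => by
      have h34 := hpow 3 4 (by norm_num)
      calc ‖P x m - P x' m‖ = ‖(P x m - P x' m - A (x - x')) + A (x - x')‖ := by congr 1; abel
        _ ≤ 7 * c ^ 4 * δ * ‖x - x'‖ + c ^ 3 * ‖x - x'‖ :=
          (norm_add_le _ _).trans (add_le_add (hPx x x' m hx hx') (hAle _))
        _ ≤ 7 * c ^ 4 * 1 * ‖x - x'‖ + c ^ 4 * ‖x - x'‖ := by gcongr
        _ = _ := by ring
  have h9 : 9 * c ^ 4 * δ ≤ 1 / (4 * c) := by
    rw [le_div_iff₀ (by positivity)]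
    have := hsmall 5 (by norm_num)
    calc 9 * c ^ 4 * δ * (4 * c) = 36 * (c ^ 5 * δ) := by ring
      _ ≤ 1 := by nlinarith [show 0 ≤ c ^ 5 * δ by positivity]
  have hex : ∀ x m, ∃ y, ‖x‖ ≤ δ → ‖y‖ ≤ 2 * ‖P x m‖ ∧ y + S' y = P x m := fun x m => by
    by_cases hx : ‖x‖ ≤ δ
    · obtain ⟨y, hy⟩ := exists_add_eq_of_lipschitz hc0 hS'0 hS' ((hPle x m hx).trans h9)
      exact ⟨y, fun _ => hy⟩
    · exact ⟨0, fun h => absurd h hx⟩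
  choose Y hY using hex
  have hY18 : ∀ x m, ‖x‖ ≤ δ → ‖Y x m‖ ≤ 18 * c ^ 4 * δ := fun x m hx =>
    (hY x m hx).1.trans (by linarith [hPle x m hx])
  have h18 : 18 * c ^ 4 * δ ≤ 1 / c := by
    rw [le_div_iff₀ hc0]
    have := hsmall 5 (by norm_num)
    calc 18 * c ^ 4 * δ * c = 18 * (c ^ 5 * δ) := by ring
      _ ≤ 1 := by nlinarith [show 0 ≤ c ^ 5 * δ by positivity]
  have hS'Y : ∀ x x' m m', ‖x‖ ≤ δ → ‖x'‖ ≤ δ →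
      ‖S' (Y x m) - S' (Y x' m')‖ ≤ 18 * c ^ 5 * δ * ‖Y x m - Y x' m'‖ :=
    fun x x' m m' hx hx' =>
      (hS' _ h18 _ _ (hY18 x m hx) (hY18 x' m' hx')).trans (le_of_eq (by ring))
  have hhalf : 18 * c ^ 5 * δ ≤ 1 / 2 := by
    have := hsmall 5 (by norm_num)
    nlinarith [show 0 ≤ c ^ 5 * δ by positivity]
  have hYdiff : ∀ x x' m m', ‖x‖ ≤ δ → ‖x'‖ ≤ δ →
      ‖Y x m - Y x' m'‖ ≤ 2 * ‖P x m - P x' m'‖ := fun x x' m m' hx hx' => by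
    have h1 : Y x m - Y x' m' = (P x m - P x' m') - (S' (Y x m) - S' (Y x' m')) := by
      rw [← (hY x m hx).2, ← (hY x' m' hx').2]; abel
    have h2 : ‖Y x m - Y x' m'‖ ≤ ‖P x m - P x' m'‖ + ‖S' (Y x m) - S' (Y x' m')‖ := by
      conv_lhs => rw [h1]
      exact norm_sub_le _ _
    have h3 := hS'Y x x' m m' hx hx'
    nlinarith [norm_nonneg (Y x m - Y x' m')]
  have h4c : c ^ 4 ≤ c ^ 9 := hpow 4 9 (by norm_num)
  have h2c : c ^ 2 ≤ c ^ 9 := hpow 2 9 (by norm_num)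
  refine ⟨Y, fun x m hx => ⟨?_, (hY18 x m hx).trans h18, ?_, ?_⟩, fun x x' m hx hx' => ?_,
    fun x m m' a hx ha hm => ?_⟩
  · calc ‖Y x m‖ ≤ 18 * c ^ 4 * δ := hY18 x m hx
      _ ≤ 400 * c ^ 9 * δ := by gcongr; norm_num
  · rw [(hY x m hx).2]
    simp only [hP]
    rw [Φ'.apply_symm_apply, add_sub_cancel]
  · have h1 : Y x m - A x = (P x m - A x) - S' (Y x m) := by
      rw [← (hY x m hx).2]; abel
    have h2 := hS' _ h18 _ 0 (hY18 x m hx) (by rw [norm_zero]; positivity)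
    rw [hS'0, sub_zero, sub_zero] at h2
    change ‖Y x m - A x‖ ≤ _
    rw [h1]
    calc _ ≤ (7 * c ^ 4 * δ * δ + c ^ 2 * ρ) + c * (18 * c ^ 4 * δ) * (18 * c ^ 4 * δ) :=
          (norm_sub_le _ _).trans (add_le_add (hPA x m hx) (h2.trans (by
            gcongr; exact hY18 x m hx)))
      _ = 7 * c ^ 4 * δ ^ 2 + c ^ 2 * ρ + 324 * c ^ 9 * δ ^ 2 := by ring
      _ ≤ 7 * c ^ 9 * δ ^ 2 + c ^ 9 * ρ + 324 * c ^ 9 * δ ^ 2 := by gcongr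
      _ ≤ 400 * c ^ 9 * (δ ^ 2 + ρ) := by
        nlinarith [show 0 ≤ c ^ 9 * δ ^ 2 by positivity, show 0 ≤ c ^ 9 * ρ by positivity]
  · have h1 : Y x m - Y x' m - A (x - x') = (P x m - P x' m - A (x - x')) -
        (S' (Y x m) - S' (Y x' m)) := by
      rw [← (hY x m hx).2, ← (hY x' m hx').2]; abel
    change ‖Y x m - Y x' m - A (x - x')‖ ≤ _
    rw [h1]
    calc _ ≤ 7 * c ^ 4 * δ * ‖x - x'‖ + 18 * c ^ 5 * δ * (2 * (8 * c ^ 4 * ‖x - x'‖)) :=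
          (norm_sub_le _ _).trans (add_le_add (hPx x x' m hx hx')
            ((hS'Y x x' m m hx hx').trans (by
              gcongr
              exact (hYdiff x x' m m hx hx').trans (by gcongr; exact hPlip x x' m hx hx'))))
      _ = 7 * c ^ 4 * (δ * ‖x - x'‖) + 288 * c ^ 9 * (δ * ‖x - x'‖) := by ring
      _ ≤ 7 * c ^ 9 * (δ * ‖x - x'‖) + 288 * c ^ 9 * (δ * ‖x - x'‖) := by gcongr
      _ ≤ 400 * c ^ 9 * δ * ‖x - x'‖ := by
        nlinarith [show 0 ≤ c ^ 9 * (δ * ‖x - x'‖) by positivity]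
  · have h1 : ‖P x m - P x m'‖ ≤ c * (c * ρ * a) := by
      simp only [hP]
      rw [← map_sub, sub_sub_sub_cancel_right]
      exact (hΦ' _).trans (by gcongr; exact hgm _ (hzmem' x hx) m m' a ha hm)
    calc _ ≤ 2 * (c * (c * ρ * a)) := (hYdiff x x m m' hx hx).trans (by gcongr)
      _ = 2 * c ^ 2 * (ρ * a) := by ring
      _ ≤ 400 * c ^ 9 * (ρ * a) := by gcongr; norm_num
      _ = _ := by ring

end Implicit

/-- `(x, m) ↦ (Y x m, Z x m)` is, on the ball of radius `δ`, a perturbation of a skew product over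
the hyperbolic linear map `(x_s, x_u) ↦ (A_s x_s, A_u x_u)`. -/
structure IsHyperbolicModel {k l : ℕ} {M : Type*} [EMetricSpace M]
    (As : EuclideanSpace ℝ (Fin k) →ₗ[ℝ] EuclideanSpace ℝ (Fin k))
    (Au : EuclideanSpace ℝ (Fin l) ≃ₗ[ℝ] EuclideanSpace ℝ (Fin l)) (c ρ δ K L : ℝ)
    (Y : EuclideanSpace ℝ (Fin k) × EuclideanSpace ℝ (Fin l) → M →
      EuclideanSpace ℝ (Fin k) × EuclideanSpace ℝ (Fin l))
    (Z : EuclideanSpace ℝ (Fin k) × EuclideanSpace ℝ (Fin l) → M → M) : Prop where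
  norm_le : ∀ x m, ‖x‖ ≤ δ → ‖Y x m‖ ≤ c * δ
  norm_sub_le : ∀ x m, ‖x‖ ≤ δ → ‖Y x m - (As x.1, Au x.2)‖ ≤ c * (δ ^ 2 + ρ)
  lipschitz_base : ∀ x x' m, ‖x‖ ≤ δ → ‖x'‖ ≤ δ →
    ‖Y x m - Y x' m - (As (x - x').1, Au (x - x').2)‖ ≤ c * δ * ‖x - x'‖
  lipschitz_fiber : ∀ x m m' a, ‖x‖ ≤ δ → 0 ≤ a → edist m m' ≤ ENNReal.ofReal a →
    ‖Y x m - Y x m'‖ ≤ c * ρ * a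
  edist_base : ∀ x x' m, ‖x‖ ≤ δ → ‖x'‖ ≤ δ →
    edist (Z x m) (Z x' m) ≤ ENNReal.ofReal (K * (‖(x - x').1‖ + ‖(x - x').2‖))
  edist_fiber : ∀ x m m' a, ‖x‖ ≤ δ → 0 ≤ a → edist m m' ≤ ENNReal.ofReal a →
    edist (Z x m) (Z x m') ≤ ENNReal.ofReal (L * a)

theorem IsHyperbolicModel.mono {k l : ℕ} {M : Type*} [EMetricSpace M]
    {As : EuclideanSpace ℝ (Fin k) →ₗ[ℝ] EuclideanSpace ℝ (Fin k)}
    {Au : EuclideanSpace ℝ (Fin l) ≃ₗ[ℝ] EuclideanSpace ℝ (Fin l)} {c c' ρ δ K L : ℝ}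
    {Y : EuclideanSpace ℝ (Fin k) × EuclideanSpace ℝ (Fin l) → M →
      EuclideanSpace ℝ (Fin k) × EuclideanSpace ℝ (Fin l)}
    {Z : EuclideanSpace ℝ (Fin k) × EuclideanSpace ℝ (Fin l) → M → M}
    (h : IsHyperbolicModel As Au c ρ δ K L Y Z) (hc : c ≤ c') (hρ : 0 ≤ ρ) (hδ : 0 ≤ δ) :
    IsHyperbolicModel As Au c' ρ δ K L Y Z where
  norm_le x m hx := (h.norm_le x m hx).trans (by gcongr)
  norm_sub_le x m hx := (h.norm_sub_le x m hx).trans (by gcongr)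
  lipschitz_base x x' m hx hx' := (h.lipschitz_base x x' m hx hx').trans (by gcongr)
  lipschitz_fiber x m m' a hx ha hm := (h.lipschitz_fiber x m m' a hx ha hm).trans (by gcongr)
  edist_base := h.edist_base
  edist_fiber := h.edist_fiber

section Linear

variable {E : Type*} [NormedAddCommGroup E] [NormedSpace ℝ E]
  {H : Type*} [TopologicalSpace H] {I : ModelWithCorners ℝ E H}
  {B : Type*} [TopologicalSpace B] [ChartedSpace H B]
  [IsManifold I ∞ B] [RiemannianBundle (fun x : B => TangentSpace I x)]
  {Λ : Set B} {k l : ℕ}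
  {φs : ∀ b : Λ, EuclideanSpace ℝ (Fin k) →ₗᵢ[ℝ] TangentSpace I (b : B)}
  {φu : ∀ b : Λ, EuclideanSpace ℝ (Fin l) →ₗᵢ[ℝ] TangentSpace I (b : B)}
  {Es Eu : ∀ b : B, Submodule ℝ (TangentSpace I b)}

theorem exists_linearMap_of_mapsTo {n : ℕ} {T T' : Type*} [NormedAddCommGroup T]
    [InnerProductSpace ℝ T] [NormedAddCommGroup T'] [InnerProductSpace ℝ T']
    (φ : EuclideanSpace ℝ (Fin n) →ₗᵢ[ℝ] T) (φ' : EuclideanSpace ℝ (Fin n) →ₗᵢ[ℝ] T')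
    (D : T →ₗ[ℝ] T') (hD : ∀ x, D (φ x) ∈ φ'.toLinearMap.range) :
    ∃ A : EuclideanSpace ℝ (Fin n) →ₗ[ℝ] EuclideanSpace ℝ (Fin n), ∀ x, φ' (A x) = D (φ x) := by
  refine ⟨(LinearEquiv.ofInjective φ'.toLinearMap φ'.injective).symm.toLinearMap ∘ₗ
    LinearMap.codRestrict φ'.toLinearMap.range (D ∘ₗ φ.toLinearMap) hD, fun x => ?_⟩
  have h := (LinearEquiv.ofInjective φ'.toLinearMap φ'.injective).apply_symm_apply
    ⟨D (φ x), hD x⟩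
  exact congrArg Subtype.val h

theorem IsHyperbolicSet.exists_linear_model {h : B → B} {lamm lam mum mu : ℝ}
    (hyp : IsHyperbolicSet I h Λ Es Eu lamm lam mum mu)
    (hφs : IsIsometricTrivialization I Λ Es φs) (hφu : IsIsometricTrivialization I Λ Eu φu)
    (b : Λ) :
    ∃ (As : EuclideanSpace ℝ (Fin k) →ₗ[ℝ] EuclideanSpace ℝ (Fin k))
      (Au : EuclideanSpace ℝ (Fin l) ≃ₗ[ℝ] EuclideanSpace ℝ (Fin l)),
      (∀ x, ‖As x‖ ≤ lam * ‖x‖) ∧ (∀ y, ‖Au.symm y‖ ≤ mu * ‖y‖) ∧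
      ∀ x, tangentMap I I h ⟨b, frameVec I φs φu b x⟩ =
        ⟨h b, frameVec I φs φu (hyp.mapsTo.restrict h Λ Λ b) (As x.1, Au x.2)⟩ := by
  set b' := hyp.mapsTo.restrict h Λ Λ b with hb'
  have hs : ∀ x, φs b x ∈ Es b := fun x => by rw [← hφs.range_eq b]; exact ⟨x, rfl⟩
  have hu : ∀ x, φu b x ∈ Eu b := fun x => by rw [← hφu.range_eq b]; exact ⟨x, rfl⟩
  obtain ⟨As, hAs⟩ := exists_linearMap_of_mapsTo (φs b) (φs b') (mfderiv I I h b).toLinearMap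
    fun x => (hφs.range_eq b').symm.le (hyp.map_stable b b.2 _ (hs x))
  obtain ⟨Au, hAu⟩ := exists_linearMap_of_mapsTo (φu b) (φu b') (mfderiv I I h b).toLinearMap
    fun x => (hφu.range_eq b').symm.le (hyp.map_unstable b b.2 _ (hu x))
  have hAs' : ∀ x, ‖As x‖ ≤ lam * ‖x‖ := fun x => by
    have h1 := (hyp.stable_bounds b b.2 _ (hs x)).2
    rw [(φs b).norm_map] at h1
    rw [← (φs b').norm_map (As x), hAs]
    exact h1
  have hAu' : ∀ x, ‖x‖ ≤ mu * ‖Au x‖ := fun x => by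
    have h1 := (hyp.unstable_bounds b b.2 _ (hu x)).2
    rw [(φu b).norm_map] at h1
    rw [← (φu b').norm_map (Au x), hAu]
    exact h1
  have hinj : Function.Injective Au := by
    rw [injective_iff_map_eq_zero]
    intro x hx
    have h1 := hAu' x
    rw [hx, norm_zero, mul_zero] at h1
    exact norm_le_zero_iff.1 h1
  refine ⟨As, LinearEquiv.ofInjectiveEndo Au hinj, hAs', fun y => ?_, fun x => ?_⟩
  · have h1 := hAu' ((LinearEquiv.ofInjectiveEndo Au hinj).symm y)
    have h2 : Au ((LinearEquiv.ofInjectiveEndo Au hinj).symm y) = y :=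
      (LinearEquiv.ofInjectiveEndo Au hinj).apply_symm_apply y
    rwa [h2] at h1
  · have h1 : mfderiv I I h b (frameVec I φs φu b x) =
        frameVec I φs φu b' (As x.1, Au x.2) := by
      simp only [frameVec]
      rw [map_add, hAs, hAu]
      rfl
    exact congrArg (fun v : TangentSpace I (h b) => (⟨h b, v⟩ : TangentBundle I B)) h1

end Linear

theorem exists_forall_norm_sub_sub_le {E : Type*} [NormedAddCommGroup E] [NormedSpace ℝ E]
    {η : E → E} {z₀ : E} (h : ContDiffAt ℝ 2 η z₀) {r₀ : ℝ} (hr₀ : 0 < r₀)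
    (hd : ∀ z ∈ Metric.ball z₀ r₀, DifferentiableAt ℝ η z) :
    ∃ r > 0, ∃ c, 1 ≤ c ∧ ∀ a ∈ Metric.ball z₀ r, ‖fderiv ℝ η a‖ ≤ c ∧
      ∀ t ≤ r, ∀ z ∈ Metric.closedBall a t, ∀ z' ∈ Metric.closedBall a t,
        ‖η z - η z' - fderiv ℝ η a (z - z')‖ ≤ c * t * ‖z - z'‖ := by
  obtain ⟨K, s, hs, hK⟩ := (h.fderiv_right (m := 1) (by norm_num)).exists_lipschitzOnWith
  obtain ⟨r, hr, hrs⟩ := Metric.nhds_basis_ball.mem_iff.1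
    (Filter.inter_mem hs (Metric.ball_mem_nhds z₀ hr₀))
  set D := ‖fderiv ℝ η z₀‖ with hD
  refine ⟨r / 2, by positivity, max 1 (max K (D + K * r)), le_max_left _ _, fun a ha => ?_⟩
  have hz₀ : z₀ ∈ Metric.ball z₀ r := Metric.mem_ball_self hr
  have har : a ∈ Metric.ball z₀ r := Metric.ball_subset_ball (by linarith) ha
  have h1 : ‖fderiv ℝ η a - fderiv ℝ η z₀‖ ≤ K * r := by
    refine (hK.norm_sub_le (hrs har).1 (hrs hz₀).1).trans ?_
    gcongr
    exact (mem_ball_iff_norm.1 har).le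
  constructor
  · calc ‖fderiv ℝ η a‖ = ‖fderiv ℝ η z₀ + (fderiv ℝ η a - fderiv ℝ η z₀)‖ := by congr 1; abel
      _ ≤ D + K * r := (norm_add_le _ _).trans (add_le_add le_rfl h1)
      _ ≤ _ := (le_max_right _ _).trans (le_max_right _ _)
  · intro t ht z hz z' hz'
    have ht0 : 0 ≤ t := dist_nonneg.trans (Metric.mem_closedBall.1 hz)
    have hsub : Metric.closedBall a t ⊆ Metric.ball z₀ r := fun y hy => by
      rw [Metric.mem_ball] at ha ⊢
      rw [Metric.mem_closedBall] at hy
      linarith [dist_triangle y a z₀]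
    have h2 := Convex.norm_image_sub_le_of_norm_hasFDerivWithin_le' (f' := fderiv ℝ η)
      (φ := fderiv ℝ η a) (C := K * t)
      (fun y hy => (hd y (hrs (hsub hy)).2).hasFDerivAt.hasFDerivWithinAt)
      (fun y hy => (hK.norm_sub_le (hrs (hsub hy)).1 (hrs har).1).trans (by
        gcongr; exact mem_closedBall_iff_norm.1 hy)) (convex_closedBall a t) hz' hz
    refine h2.trans ?_
    gcongr
    exact (le_max_left _ _).trans (le_max_right _ _)

section Model

variable {E : Type*} [NormedAddCommGroup E] [NormedSpace ℝ E] [FiniteDimensional ℝ E]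
  {H : Type*} [TopologicalSpace H] {I : ModelWithCorners ℝ E H}
  {B : Type*} [TopologicalSpace B] [T2Space B] [CompactSpace B] [ChartedSpace H B]
  [IsManifold I ∞ B] [RiemannianBundle (fun x : B => TangentSpace I x)]
  [IsContMDiffRiemannianBundle I ∞ E (fun x : B => TangentSpace I x)]
  {E' : Type*} [NormedAddCommGroup E'] [NormedSpace ℝ E'] [FiniteDimensional ℝ E']
  {H' : Type*} [TopologicalSpace H'] {J : ModelWithCorners ℝ E' H'}
  {M : Type*} [EMetricSpace M] [CompactSpace M] [ChartedSpace H' M] [IsManifold J ∞ M]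
  [RiemannianBundle (fun x : M => TangentSpace J x)]
  [IsContMDiffRiemannianBundle J ∞ E' (fun x : M => TangentSpace J x)]
  [IsRiemannianManifold J M]
  {h : B → B} {f : B → M → M} {N : ℕ} {ι : B × M → EuclideanSpace ℝ (Fin N)}
  {Λ : Set B} {Es Eu : ∀ b : B, Submodule ℝ (TangentSpace I b)} {lamm lam mum mu : ℝ}
  {k l : ℕ}
  {φs : ∀ b : Λ, EuclideanSpace ℝ (Fin k) →ₗᵢ[ℝ] TangentSpace I (b : B)}
  {φu : ∀ b : Λ, EuclideanSpace ℝ (Fin l) →ₗᵢ[ℝ] TangentSpace I (b : B)}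

theorem norm_frameVec_le (b : Λ) (x : EuclideanSpace ℝ (Fin k) × EuclideanSpace ℝ (Fin l)) :
    ‖frameVec I φs φu b x‖ ≤ ‖x.1‖ + ‖x.2‖ := by
  refine (norm_add_le _ _).trans (le_of_eq ?_)
  rw [(φs b).norm_map, (φu b).norm_map]

set_option maxHeartbeats 400000 in
theorem eventually_exists_model (hh : ContMDiff I I 2 h)
    (hF : ContMDiff (I.prod J) (I.prod J) 1 (skew h f)) (hι : IsSmoothInjectiveImmersion I J ι)
    (hyp : IsHyperbolicSet I h Λ Es Eu lamm lam mum mu)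
    (hφs : IsIsometricTrivialization I Λ Es φs) (hφu : IsIsometricTrivialization I Λ Eu φu)
    {K L : ℝ} (hK0 : 0 ≤ K) (hKL : K ≤ L)
    (hK : ∀ b m, ‖mfderiv I J (fun b' => f b' m) b‖ ≤ K)
    (hL : ∀ b m, ‖mfderiv J J (f b) m‖ ≤ L) {ε : ℝ} (hε : 0 < ε) (b₀ : Λ) :
    ∃ c, 1 ≤ c ∧ ∀ᶠ b : Λ in 𝓝 b₀,
      ∃ (As : EuclideanSpace ℝ (Fin k) →ₗ[ℝ] EuclideanSpace ℝ (Fin k))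
        (Au : EuclideanSpace ℝ (Fin l) ≃ₗ[ℝ] EuclideanSpace ℝ (Fin l)),
        (∀ x, ‖As x‖ ≤ lam * ‖x‖) ∧ (∀ y, ‖Au.symm y‖ ≤ mu * ‖y‖) ∧
        ∀ (G : B × M → B × M) (ρ δ : ℝ), ContMDiff (I.prod J) (I.prod J) 1 G →
          C1DistLT I J ι G (skew h f) ρ → 0 ≤ ρ → ρ ≤ δ → δ ≤ 1 / c →
          ∃ Y, IsHyperbolicModel As Au c ρ δ (K + ε) (L + ε) Y
              (fun x m => (G (baseChart I φs φu b x, m)).2) ∧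
            ∀ x m, ‖x‖ ≤ δ → baseChart I φs φu (hyp.mapsTo.restrict h Λ Λ b) (Y x m) =
              (G (baseChart I φs φu b x, m)).1 := by
  set hΛ := hyp.mapsTo.restrict h Λ Λ with hhΛ
  have hint₀ : I.IsInteriorPoint (b₀ : B) := hyp.interior b₀ b₀.2
  set e := extChartAt I (b₀ : B) with he
  set κ := extChartAt I (h b₀) with hκ
  set η : E → E := κ ∘ h ∘ e.symm with hη
  obtain ⟨c₁, hc₁, hn₁⟩ := exists_isNormalForm hφs hφu b₀ hint₀ hyp.isCompl
  obtain ⟨c₂, hc₂, hn₂⟩ := exists_isNormalForm hφs hφu (hΛ b₀) (hyp.interior _ (hΛ b₀).2)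
    hyp.isCompl
  obtain ⟨c₃, hc₃, hint, hsrc, hG₃⟩ := exists_local_estimate hh hF hι hK0 hKL hK hL hint₀
    (half_pos hε)
  have hz₀ := extChartAt_mem_interior_target I (mem_extChartAt_source (b₀ : B)) hint₀
  have hsym : e.symm (e b₀) = b₀ := e.left_inv (mem_extChartAt_source _)
  have hη₂ : ∀ z ∈ Metric.ball (e b₀) (1 / c₃), ContDiffAt ℝ 2 η z := fun z hz =>
    contDiffAt_writtenInCharts two_le_smooth hh (hint hz) (hsrc z hz)
  obtain ⟨r, hr, c₄, hc₄, hη₄⟩ := exists_forall_norm_sub_sub_le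
    (hη₂ _ (Metric.mem_ball_self (by positivity))) (by positivity : 0 < 1 / c₃)
    (fun z hz => (hη₂ z hz).differentiableAt (by norm_num))
  set c := max (max (max c₁ c₂) (max (2 * c₃) c₄)) (1 / r) with hc
  have hcc₁ : c₁ ≤ c := ((le_max_left _ _).trans (le_max_left _ _)).trans (le_max_left _ _)
  have hcc₂ : c₂ ≤ c := ((le_max_right _ _).trans (le_max_left _ _)).trans (le_max_left _ _)
  have hcc₃ : 2 * c₃ ≤ c := ((le_max_left _ _).trans (le_max_right _ _)).trans (le_max_left _ _)
  have hcc₄ : c₄ ≤ c := ((le_max_right _ _).trans (le_max_right _ _)).trans (le_max_left _ _)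
  have hcr : 1 / r ≤ c := le_max_right _ _
  have hc1 : 1 ≤ c := hc₁.trans hcc₁
  have hc0 : 0 < c := by linarith
  have hcr' : 1 / c ≤ r := by
    rw [div_le_iff₀ hc0]; rw [div_le_iff₀ hr] at hcr; linarith
  have h1c : 1 / c ≤ 1 / (2 * c₃) := one_div_le_one_div_of_le (by linarith) hcc₃
  set c' := max (400 * c ^ 9) (2 * c * (2 * (K + ε)) / ε) with hc'
  have hc'1 : 400 * c ^ 9 ≤ c' := le_max_left _ _
  have hc'2 : 2 * c * (2 * (K + ε)) / ε ≤ c' := le_max_right _ _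
  have hc9 : c ≤ c ^ 9 := le_self_pow₀ hc1 (by norm_num)
  have hc'c : c ≤ c' := by nlinarith
  refine ⟨c', hc1.trans hc'c, ?_⟩
  have hΛc : Continuous hΛ := by
    rw [continuous_induced_rng]
    exact hh.continuous.comp continuous_subtype_val
  have hev : ∀ᶠ b : Λ in 𝓝 b₀, e b ∈ Metric.ball (e b₀) (min r (1 / (2 * c₃))) :=
    ((continuousAt_extChartAt (I := I) (b₀ : B)).comp
      (continuousAt_subtype_val (x := b₀))).preimage_mem_nhds
        (Metric.ball_mem_nhds _ (lt_min hr (by positivity)))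
  filter_upwards [hn₁, hΛc.continuousAt.eventually hn₂, hev] with b hb₁ hb₂ hbe
  obtain ⟨Φ, S, hnf⟩ := hb₁.1
  obtain ⟨Φ', S', hnf'⟩ := hb₂.1
  have hnf := hnf.mono (by linarith) hcc₁
  have hnf' := hnf'.mono (by linarith) hcc₂
  obtain ⟨As, Au, hAs, hAu, hlin⟩ := hyp.exists_linear_model hφs hφu b
  refine ⟨As, Au, hAs, hAu, fun G ρ δ hG hGF hρ0 hρδ hδ => ?_⟩
  have hber : e b ∈ Metric.ball (e b₀) r := Metric.ball_subset_ball (min_le_left _ _) hbe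
  have hbe3 : e b ∈ Metric.ball (e b₀) (1 / (2 * c₃)) :=
    Metric.ball_subset_ball (min_le_right _ _) hbe
  have h2c₃ : 1 / (2 * c₃) ≤ 1 / c₃ := one_div_le_one_div_of_le (by linarith) (by linarith)
  have hbe3' : e b ∈ Metric.ball (e b₀) (1 / c₃) := Metric.ball_subset_ball h2c₃ hbe3
  have hsub : Metric.closedBall (e b) (1 / c) ⊆ Metric.ball (e b₀) (1 / c₃) := fun z hz => by
    rw [Metric.mem_ball] at hbe3 ⊢
    rw [Metric.mem_closedBall] at hz
    have : 1 / (2 * c₃) + 1 / (2 * c₃) = 1 / c₃ := by field_simp; norm_num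
    linarith [dist_triangle z (e b) (e b₀)]
  have hδ0 : 0 ≤ δ := hρ0.trans hρδ
  have hδc : δ ≤ 1 / c := hδ.trans (one_div_le_one_div_of_le hc0 hc'c)
  have hc₃c : c₃ ≤ c := by linarith
  obtain ⟨hg1, hg2, hg3, hg4⟩ := hG₃ G ρ hG hGF
    (hρδ.trans (hδc.trans (one_div_le_one_div_of_le (by linarith) hc₃c)))
  have hη_apply : ∀ z, η z = κ (h (e.symm z)) := fun z => rfl
  obtain ⟨hmem, Y, hY1, hY2, hY3⟩ := exists_model_of_normal_form (M := M) hc1 (Φ := Φ) (Φ' := Φ')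
    (S := S) (S' := S') hnf.norm_le hnf'.norm_symm_le hnf.map_zero hnf'.map_zero hnf.lipschitz
    hnf'.lipschitz (z₀ := e b) (η := η) (D := fderiv ℝ η (e b))
    ((hη₄ _ hber).1.trans hcc₄)
    (fun t ht z hz z' hz' => ((hη₄ _ hber).2 t (ht.trans hcr') z hz z' hz').trans (by
      have : 0 ≤ t := dist_nonneg.trans (Metric.mem_closedBall.1 hz)
      gcongr))
    (g := fun z m => κ (G (e.symm z, m)).1) hρ0 hρδ
    (hδ.trans (one_div_le_one_div_of_le (by positivity) hc'1))
    (fun z hz m => (hg1 z (hsub hz) m).2.trans (by gcongr))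
    (fun z hz z' hz' m => (hg2 z (hsub hz) z' (hsub hz') m).trans (by gcongr))
    (fun z hz m m' a ha hm => (hg3 z (hsub hz) m m' a ha hm).1.trans (by gcongr))
  -- the linear part
  have hA : ∀ x, Φ'.symm (fderiv ℝ η (e b) (Φ x)) = (As x.1, Au x.2) := fun x => by
    rw [ContinuousLinearEquiv.symm_apply_eq, hnf'.apply_eq, hnf.apply_eq]
    have h1 : MDifferentiableAt I I h ((b : B)) := (hh b).mdifferentiableAt (by norm_num)
    have h2 : MDifferentiableAt I 𝓘(ℝ, E) κ (h b) :=
      have : IsManifold I 1 B := IsManifold.of_le (n := ∞) one_le_smooth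
      mdifferentiableAt_extChartAt (by
        have := hnf'.mem_source
        rwa [extChartAt_source] at this)
    have h3 := fderiv_comp_extChartAt_symm (u := κ ∘ h) (hint hbe3')
      (by rw [e.left_inv hnf.mem_source]; exact h2.comp _ h1)
      (chartVec I (b₀ : B) ⟨b, frameVec I φs φu b x⟩)
    rw [liftVec_chartVec (ζ := (⟨b, frameVec I φs φu b x⟩ : TangentBundle I B)) hnf.mem_source
      (hint hbe3'), vectorDeriv_comp h2 h1, hlin] at h3
    exact h3
  have hz : ∀ x, ‖x‖ ≤ δ → e.symm (e b + Φ (x + S x)) = baseChart I φs φu b x := fun x hx => by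
    rw [← hnf.chart_eq x (hx.trans hδc)]
    exact e.left_inv (hnf.chart_mem x (hx.trans hδc))
  refine ⟨Y, ⟨fun x m hx => ?_, fun x m hx => ?_, fun x x' m hx hx' => ?_,
    fun x m m' a hx ha hm => ?_, fun x x' m hx hx' => ?_, fun x m m' a hx ha hm => ?_⟩,
    fun x m hx => ?_⟩
  · exact (hY1 x m hx).1.trans (by gcongr)
  · rw [← hA]
    exact (hY1 x m hx).2.2.2.trans (by gcongr)
  · rw [← hA]
    exact (hY2 x x' m hx hx').trans (by gcongr)
  · exact (hY3 x m m' a hx ha hm).trans (by gcongr)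
  · have h1 := hg4 _ (hsub (hmem x' hx')) _ (hsub (hmem x hx)) m b hnf.mem_source hbe3'
      (frameVec I φs φu b ((x + S x) - (x' + S x'))) (by
        rw [← hnf.apply_eq, map_sub]; abel)
    rw [hz x hx, hz x' hx'] at h1
    rw [edist_comm]
    refine h1.trans (ENNReal.ofReal_le_ofReal ?_)
    have h2 := hnf.lipschitz δ hδc x x' hx hx'
    have h3 : ‖x - x'‖ ≤ ‖(x - x').1‖ + ‖(x - x').2‖ := by
      rw [Prod.norm_def]; exact max_le_add_of_nonneg (norm_nonneg _) (norm_nonneg _)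
    have h4 : ‖frameVec I φs φu b ((x + S x) - (x' + S x'))‖ ≤
        (1 + 2 * c * δ) * (‖(x - x').1‖ + ‖(x - x').2‖) := by
      rw [show (x + S x) - (x' + S x') = (x - x') + (S x - S x') by abel]
      have h5 := norm_fst_le (S x - S x')
      have h6 := norm_snd_le (S x - S x')
      have h7 := norm_frameVec_le (I := I) (φs := φs) (φu := φu) b ((x - x') + (S x - S x'))
      rw [Prod.fst_add, Prod.snd_add] at h7
      calc _ ≤ ‖(x - x').1 + (S x - S x').1‖ + ‖(x - x').2 + (S x - S x').2‖ := h7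
        _ ≤ (‖(x - x').1‖ + c * δ * ‖x - x'‖) + (‖(x - x').2‖ + c * δ * ‖x - x'‖) :=
            add_le_add ((norm_add_le _ _).trans (add_le_add le_rfl (h5.trans h2)))
              ((norm_add_le _ _).trans (add_le_add le_rfl (h6.trans h2)))
        _ = ‖(x - x').1‖ + ‖(x - x').2‖ + 2 * c * δ * ‖x - x'‖ := by ring
        _ ≤ ‖(x - x').1‖ + ‖(x - x').2‖ + 2 * c * δ * (‖(x - x').1‖ + ‖(x - x').2‖) := by gcongr
        _ = _ := by ring
    calc _ ≤ (K + ε / 2) * ((1 + 2 * c * δ) * (‖(x - x').1‖ + ‖(x - x').2‖)) := by gcongr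
      _ = ((K + ε / 2) * (1 + 2 * c * δ)) * (‖(x - x').1‖ + ‖(x - x').2‖) := by ring
      _ ≤ (K + ε) * (‖(x - x').1‖ + ‖(x - x').2‖) := by
        gcongr
        have h7 : δ * c' ≤ 1 := by rwa [le_div_iff₀ (hc0.trans_le hc'c)] at hδ
        have h8 : 2 * c * (2 * (K + ε)) ≤ c' * ε := by rwa [div_le_iff₀ hε] at hc'2
        have h9 : 2 * c * (2 * (K + ε)) * δ ≤ ε := by
          calc _ ≤ c' * ε * δ := by gcongr
            _ = (δ * c') * ε := by ring
            _ ≤ 1 * ε := by gcongr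
            _ = ε := one_mul _
        have h10 : 0 ≤ 2 * c * δ := by positivity
        nlinarith
  · have h1 := (hg3 _ (hsub (hmem x hx)) m m' a ha hm).2
    rw [hz x hx] at h1
    exact h1.trans (ENNReal.ofReal_le_ofReal (by gcongr; linarith))
  · obtain ⟨-, h1, h2, -⟩ := hY1 x m hx
    have h3 := hg1 _ (hsub (hmem x hx)) m
    rw [hz x hx] at h2 h3
    refine κ.injOn (hnf'.chart_mem _ h1) h3.1 ?_
    rw [← h2, hη_apply, e.left_inv hnf.mem_source]
    exact hnf'.chart_eq _ h1

/-- Perturbations of the skew product are, in the adapted charts, perturbations of hyperbolic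
linear maps, with estimates that are uniform over the hyperbolic set. -/
theorem exists_model [CompactSpace Λ] (hh : ContMDiff I I 2 h)
    (hF : ContMDiff (I.prod J) (I.prod J) 1 (skew h f)) (hι : IsSmoothInjectiveImmersion I J ι)
    (hyp : IsHyperbolicSet I h Λ Es Eu lamm lam mum mu)
    (hφs : IsIsometricTrivialization I Λ Es φs) (hφu : IsIsometricTrivialization I Λ Eu φu)
    {K L : ℝ} (hK0 : 0 ≤ K) (hKL : K ≤ L)
    (hK : ∀ b m, ‖mfderiv I J (fun b' => f b' m) b‖ ≤ K)
    (hL : ∀ b m, ‖mfderiv J J (f b) m‖ ≤ L) {ε : ℝ} (hε : 0 < ε) :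
    ∃ c, 1 ≤ c ∧ ∀ b : Λ,
      ∃ (As : EuclideanSpace ℝ (Fin k) →ₗ[ℝ] EuclideanSpace ℝ (Fin k))
        (Au : EuclideanSpace ℝ (Fin l) ≃ₗ[ℝ] EuclideanSpace ℝ (Fin l)),
        (∀ x, ‖As x‖ ≤ lam * ‖x‖) ∧ (∀ y, ‖Au.symm y‖ ≤ mu * ‖y‖) ∧
        ∀ (G : B × M → B × M) (ρ δ : ℝ), ContMDiff (I.prod J) (I.prod J) 1 G →
          C1DistLT I J ι G (skew h f) ρ → 0 ≤ ρ → ρ ≤ δ → δ ≤ 1 / c →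
          ∃ Y, IsHyperbolicModel As Au c ρ δ (K + ε) (L + ε) Y
              (fun x m => (G (baseChart I φs φu b x, m)).2) ∧
            ∀ x m, ‖x‖ ≤ δ → baseChart I φs φu (hyp.mapsTo.restrict h Λ Λ b) (Y x m) =
              (G (baseChart I φs φu b x, m)).1 := by
  obtain ⟨c, hc1, hc⟩ := exists_forall_of_eventually (P := fun c (b : Λ) => 1 ≤ c ∧
      ∃ (As : EuclideanSpace ℝ (Fin k) →ₗ[ℝ] EuclideanSpace ℝ (Fin k))
        (Au : EuclideanSpace ℝ (Fin l) ≃ₗ[ℝ] EuclideanSpace ℝ (Fin l)),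
        (∀ x, ‖As x‖ ≤ lam * ‖x‖) ∧ (∀ y, ‖Au.symm y‖ ≤ mu * ‖y‖) ∧
        ∀ (G : B × M → B × M) (ρ δ : ℝ), ContMDiff (I.prod J) (I.prod J) 1 G →
          C1DistLT I J ι G (skew h f) ρ → 0 ≤ ρ → ρ ≤ δ → δ ≤ 1 / c →
          ∃ Y, IsHyperbolicModel As Au c ρ δ (K + ε) (L + ε) Y
              (fun x m => (G (baseChart I φs φu b x, m)).2) ∧
            ∀ x m, ‖x‖ ≤ δ → baseChart I φs φu (hyp.mapsTo.restrict h Λ Λ b) (Y x m) =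
              (G (baseChart I φs φu b x, m)).1)
    (fun b c c' hcc ⟨h1, As, Au, hAs, hAu, hm⟩ => ⟨h1.trans hcc, As, Au, hAs, hAu,
      fun G ρ δ hG hGF hρ0 hρδ hδ => by
        obtain ⟨Y, hY, hY'⟩ := hm G ρ δ hG hGF hρ0 hρδ
          (hδ.trans (one_div_le_one_div_of_le (by linarith) hcc))
        exact ⟨Y, hY.mono hcc hρ0 (hρ0.trans hρδ), hY'⟩⟩)
    (fun b₀ => by
      obtain ⟨c, hc1, hc⟩ := eventually_exists_model (φs := φs) (φu := φu) hh hF hι hyp hφs hφu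
        hK0 hKL hK hL hε b₀
      exact ⟨c, hc.mono fun b hb => ⟨hc1, hb⟩⟩)
  exact ⟨c, hc1, fun b => (hc b).2⟩

end Model

section GraphTransform

variable {k l : ℕ} {M : Type*} [EMetricSpace M] {D δ : ℝ}

open Classical in
/-- The extension by zero of the map defining a leaf. -/
noncomputable def leafExt (β : LeafSpace k l M D δ) (y : EuclideanSpace ℝ (Fin k)) (m : M) :
    EuclideanSpace ℝ (Fin l) :=
  if hy : y ∈ Metric.ball 0 δ then β.1 (⟨y, hy⟩, m) else 0

theorem leafExt_of_mem (β : LeafSpace k l M D δ) {y : EuclideanSpace ℝ (Fin k)}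
    (hy : y ∈ Metric.ball 0 δ) (m : M) : leafExt β y m = β.1 (⟨y, hy⟩, m) := by
  rw [leafExt, dif_pos hy]

theorem norm_leafExt_le (hδ : 0 ≤ δ) (β : LeafSpace k l M D δ) (y : EuclideanSpace ℝ (Fin k))
    (m : M) : ‖leafExt β y m‖ ≤ δ / 2 := by
  by_cases hy : y ∈ Metric.ball 0 δ
  · rw [leafExt_of_mem β hy]; exact β.2.1 _
  · rw [leafExt, dif_neg hy, norm_zero]; positivity

theorem norm_leafExt_sub_le (hD : 0 ≤ D * δ / 2) (β : LeafSpace k l M D δ)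
    {y y' : EuclideanSpace ℝ (Fin k)} (hy : ‖y‖ < δ) (hy' : ‖y'‖ < δ) {m m' : M} {a : ℝ}
    (ha : 0 ≤ a) (hm : edist m m' ≤ ENNReal.ofReal a) :
    ‖leafExt β y m - leafExt β y' m'‖ ≤ D * δ / 2 * (‖y - y'‖ + a) := by
  rw [← mem_ball_zero_iff] at hy hy'
  rw [leafExt_of_mem β hy, leafExt_of_mem β hy']
  have h := β.2.2 (⟨y, hy⟩, m) (⟨y', hy'⟩, m')
  have h1 : edist (⟨y, hy⟩ : Q k δ) ⟨y', hy'⟩ = ENNReal.ofReal ‖y - y'‖ := by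
    rw [Subtype.edist_eq, edist_dist, dist_eq_norm]
  rw [edist_dist, dist_eq_norm] at h
  have h2 := h.trans (mul_le_mul_right (add_le_add h1.le hm) _)
  rw [← ENNReal.ofReal_add (norm_nonneg _) ha, ← ENNReal.ofReal_mul hD,
    ENNReal.ofReal_le_ofReal_iff (by positivity)] at h2
  exact h2

theorem dist_leafExt_le (β₀ β₁ : LeafSpace k l M D δ) (y : EuclideanSpace ℝ (Fin k)) (m : M) :
    ‖leafExt β₀ y m - leafExt β₁ y m‖ ≤ dist β₀ β₁ := by
  by_cases hy : y ∈ Metric.ball 0 δ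
  · rw [leafExt_of_mem β₀ hy, leafExt_of_mem β₁ hy, ← dist_eq_norm]
    exact BoundedContinuousFunction.dist_coe_le_dist _
  · rw [leafExt, leafExt, dif_neg hy, dif_neg hy, sub_zero, norm_zero]
    exact dist_nonneg

/-- Numerical conditions under which the graph transform of a hyperbolic model is well defined. -/
structure IsGraphTransformScale (lam mu c ρ K L Lt E q δ : ℝ) : Prop where
  lam_nonneg : 0 ≤ lam
  mu_nonneg : 0 ≤ mu
  c_nonneg : 0 ≤ c
  ρ_nonneg : 0 ≤ ρ
  ρ_le : ρ ≤ δ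
  δ_pos : 0 < δ
  K_nonneg : 0 ≤ K
  L_nonneg : 0 ≤ L
  lam_add_le : lam + K ≤ Lt
  L_le : L ≤ Lt
  E_pos : 0 < E
  stable_lt : lam * δ + c * (δ ^ 2 + ρ) < δ
  unstable_le : mu * (δ / 2 + c * (δ ^ 2 + ρ)) ≤ δ / 2
  q_eq : q = mu * (E * (Lt + c * δ) + c)
  q_le : q ≤ E * (1 - δ * q)
  δq_le : δ * q ≤ 1 / 2

variable {As : EuclideanSpace ℝ (Fin k) →ₗ[ℝ] EuclideanSpace ℝ (Fin k)}
  {Au : EuclideanSpace ℝ (Fin l) ≃ₗ[ℝ] EuclideanSpace ℝ (Fin l)} {c ρ K L lam mu Lt q E : ℝ}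
  {Y : EuclideanSpace ℝ (Fin k) × EuclideanSpace ℝ (Fin l) → M →
    EuclideanSpace ℝ (Fin k) × EuclideanSpace ℝ (Fin l)}
  {Z : EuclideanSpace ℝ (Fin k) × EuclideanSpace ℝ (Fin l) → M → M}

/-- The height of the image of `(x, m)` over the leaf `β`. -/
noncomputable def residual (Y : EuclideanSpace ℝ (Fin k) × EuclideanSpace ℝ (Fin l) → M →
      EuclideanSpace ℝ (Fin k) × EuclideanSpace ℝ (Fin l))
    (Z : EuclideanSpace ℝ (Fin k) × EuclideanSpace ℝ (Fin l) → M → M)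
    (β : LeafSpace k l M D δ) (x : EuclideanSpace ℝ (Fin k) × EuclideanSpace ℝ (Fin l)) (m : M) :
    EuclideanSpace ℝ (Fin l) :=
  (Y x m).2 - leafExt β (Y x m).1 (Z x m)

namespace IsHyperbolicModel

theorem norm_fst_lt (hM : IsHyperbolicModel As Au c ρ δ K L Y Z)
    (hs : IsGraphTransformScale lam mu c ρ K L Lt E q δ) (hAs : ∀ x, ‖As x‖ ≤ lam * ‖x‖)
    {x : EuclideanSpace ℝ (Fin k) × EuclideanSpace ℝ (Fin l)} (hx : ‖x‖ ≤ δ) (m : M) :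
    ‖(Y x m).1‖ < δ := by
  have h1 : ‖(Y x m).1 - As x.1‖ ≤ c * (δ ^ 2 + ρ) :=
    (norm_fst_le (Y x m - (As x.1, Au x.2))).trans (hM.norm_sub_le x m hx)
  have := hs.lam_nonneg
  calc ‖(Y x m).1‖ = ‖As x.1 + ((Y x m).1 - As x.1)‖ := by congr 1; abel
    _ ≤ lam * δ + c * (δ ^ 2 + ρ) := (norm_add_le _ _).trans
      (add_le_add ((hAs _).trans (by gcongr; exact (norm_fst_le x).trans hx)) h1)
    _ < δ := hs.stable_lt

theorem norm_step_sub_le (hM : IsHyperbolicModel As Au c ρ δ K L Y Z)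
    (hs : IsGraphTransformScale lam mu c ρ K L Lt E q δ) (hAs : ∀ x, ‖As x‖ ≤ lam * ‖x‖)
    (hAu : ∀ y, ‖Au.symm y‖ ≤ mu * ‖y‖) (hD : D = 2 * E) (β : LeafSpace k l M D δ)
    {x x' : EuclideanSpace ℝ (Fin k) × EuclideanSpace ℝ (Fin l)} (hx : ‖x‖ ≤ δ) (hx' : ‖x'‖ ≤ δ)
    {m m' : M} {a : ℝ} (ha : 0 ≤ a) (hm : edist m m' ≤ ENNReal.ofReal a) :
    ‖(x.2 - Au.symm (residual Y Z β x m)) - (x'.2 - Au.symm (residual Y Z β x' m'))‖ ≤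
      δ * q * (‖x.1 - x'.1‖ + ‖x.2 - x'.2‖ + a) := by
  have h1 := hs.lam_nonneg
  have h2 := hs.mu_nonneg
  have h3 := hs.c_nonneg
  have h4 := hs.δ_pos
  have h5 := hs.K_nonneg
  have h6 := hs.L_nonneg
  have h7 := hs.E_pos
  have h8 := hs.ρ_nonneg
  set s := ‖x.1 - x'.1‖ with hsd
  set d := ‖x.2 - x'.2‖ with hd
  have hs0 : 0 ≤ s := norm_nonneg _
  have hd0 : 0 ≤ d := norm_nonneg _
  set R := Y x m - Y x' m' - (As (x - x').1, Au (x - x').2) with hR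
  have hxx : ‖x - x'‖ ≤ s + d := by
    rw [Prod.norm_def]; exact max_le_add_of_nonneg (norm_nonneg _) (norm_nonneg _)
  have hRle : ‖R‖ ≤ c * δ * (s + d + a) := by
    calc ‖R‖ = ‖(Y x m - Y x' m - (As (x - x').1, Au (x - x').2)) + (Y x' m - Y x' m')‖ := by
          congr 1; rw [hR]; abel
      _ ≤ c * δ * (s + d) + c * ρ * a := (norm_add_le _ _).trans (add_le_add
          ((hM.lipschitz_base x x' m hx hx').trans (by gcongr))
          (hM.lipschitz_fiber x' m m' a hx' ha hm))
      _ ≤ c * δ * (s + d) + c * δ * a := by gcongr; exact hs.ρ_le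
      _ = _ := by ring
  have hYs : ‖(Y x m).1 - (Y x' m').1‖ ≤ lam * s + c * δ * (s + d + a) := by
    have h9 : (Y x m).1 - (Y x' m').1 = As (x.1 - x'.1) + R.1 := by
      simp only [hR, Prod.fst_sub]; abel
    rw [h9]
    exact (norm_add_le _ _).trans (add_le_add (hAs _) ((norm_fst_le R).trans hRle))
  have hZ : edist (Z x m) (Z x' m') ≤ ENNReal.ofReal (K * (s + d) + L * a) := by
    refine (edist_triangle _ (Z x' m) _).trans ?_
    rw [ENNReal.ofReal_add (by positivity) (by positivity)]
    exact add_le_add (hM.edist_base x x' m hx hx') (hM.edist_fiber x' m m' a hx' ha hm)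
  have hβ := norm_leafExt_sub_le (by rw [hD]; positivity) β (hM.norm_fst_lt hs hAs hx m)
    (hM.norm_fst_lt hs hAs hx' m') (by positivity) hZ
  have heq : (x.2 - Au.symm (residual Y Z β x m)) - (x'.2 - Au.symm (residual Y Z β x' m')) =
      Au.symm ((leafExt β (Y x m).1 (Z x m) - leafExt β (Y x' m').1 (Z x' m')) - R.2) := by
    rw [← Au.injective.eq_iff]
    simp only [map_sub, LinearEquiv.apply_symm_apply, residual, hR, Prod.snd_sub]
    abel
  rw [heq]
  calc _ ≤ mu * (D * δ / 2 * ((lam * s + c * δ * (s + d + a)) + (K * (s + d) + L * a)) +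
        c * δ * (s + d + a)) := by
        refine (hAu _).trans ?_
        gcongr
        refine (_root_.norm_sub_le _ _).trans (add_le_add (hβ.trans ?_) ((norm_snd_le R).trans hRle))
        have : 0 ≤ D * δ / 2 := by rw [hD]; positivity
        gcongr
    _ = mu * δ * (E * ((lam * s + K * (s + d) + L * a) + c * δ * (s + d + a)) +
        c * (s + d + a)) := by rw [hD]; ring
    _ ≤ mu * δ * (E * (Lt * (s + d + a) + c * δ * (s + d + a)) + c * (s + d + a)) := by
        gcongr
        have h10 := hs.lam_add_le
        have h11 := hs.L_le
        nlinarith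
    _ = _ := by rw [hs.q_eq]; ring

theorem norm_sub_le_residual (hM : IsHyperbolicModel As Au c ρ δ K L Y Z)
    (hs : IsGraphTransformScale lam mu c ρ K L Lt E q δ) (hAs : ∀ x, ‖As x‖ ≤ lam * ‖x‖)
    (hAu : ∀ y, ‖Au.symm y‖ ≤ mu * ‖y‖) (hD : D = 2 * E) (β : LeafSpace k l M D δ)
    {x x' : EuclideanSpace ℝ (Fin k) × EuclideanSpace ℝ (Fin l)} (hx : ‖x‖ ≤ δ) (hx' : ‖x'‖ ≤ δ)
    {m m' : M} {a : ℝ} (ha : 0 ≤ a) (hm : edist m m' ≤ ENNReal.ofReal a) :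
    (1 - δ * q) * ‖x.2 - x'.2‖ ≤ mu * ‖residual Y Z β x m - residual Y Z β x' m'‖ +
      δ * q * (‖x.1 - x'.1‖ + a) := by
  have h1 := hM.norm_step_sub_le hs hAs hAu hD β hx hx' ha hm
  have h2 : ‖x.2 - x'.2‖ ≤ ‖(x.2 - Au.symm (residual Y Z β x m)) -
      (x'.2 - Au.symm (residual Y Z β x' m'))‖ +
      mu * ‖residual Y Z β x m - residual Y Z β x' m'‖ := by
    refine le_trans (le_of_eq ?_) ((norm_add_le _ (Au.symm (residual Y Z β x m -
      residual Y Z β x' m'))).trans (add_le_add le_rfl (hAu _)))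
    congr 1
    rw [map_sub]; abel
  nlinarith

theorem exists_residual_eq_zero (hM : IsHyperbolicModel As Au c ρ δ K L Y Z)
    (hs : IsGraphTransformScale lam mu c ρ K L Lt E q δ) (hAs : ∀ x, ‖As x‖ ≤ lam * ‖x‖)
    (hAu : ∀ y, ‖Au.symm y‖ ≤ mu * ‖y‖) (hD : D = 2 * E) (β : LeafSpace k l M D δ)
    {y : EuclideanSpace ℝ (Fin k)} (hy : ‖y‖ ≤ δ) (m : M) :
    ∃ u, ‖u‖ ≤ δ / 2 ∧ residual Y Z β (y, u) m = 0 := by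
  have hδ := hs.δ_pos
  have hmu := hs.mu_nonneg
  set T : EuclideanSpace ℝ (Fin l) → EuclideanSpace ℝ (Fin l) := fun u =>
    u - Au.symm (residual Y Z β (y, u) m) with hT
  have hmem : ∀ u : EuclideanSpace ℝ (Fin l), u ∈ Metric.closedBall 0 δ →
      ‖((y, u) : EuclideanSpace ℝ (Fin k) × EuclideanSpace ℝ (Fin l))‖ ≤ δ := fun u hu => by
    rw [mem_closedBall_zero_iff] at hu
    rw [Prod.norm_mk]; exact max_le hy hu
  have hhalf : ∀ u ∈ Metric.closedBall 0 δ, ‖T u‖ ≤ δ / 2 := fun u hu => by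
    have h1 : ‖(Y (y, u) m).2 - Au u‖ ≤ c * (δ ^ 2 + ρ) :=
      (norm_snd_le (Y (y, u) m - (As y, Au u))).trans (hM.norm_sub_le _ m (hmem u hu))
    have h2 : T u = Au.symm (leafExt β (Y (y, u) m).1 (Z (y, u) m) - ((Y (y, u) m).2 - Au u)) := by
      rw [← Au.injective.eq_iff]
      simp only [hT, map_sub, LinearEquiv.apply_symm_apply, residual]
      abel
    rw [h2]
    refine ((hAu _).trans ?_).trans hs.unstable_le
    gcongr
    exact (_root_.norm_sub_le _ _).trans (add_le_add (norm_leafExt_le hδ.le β _ _) h1)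
  have hmaps : MapsTo T (Metric.closedBall 0 δ) (Metric.closedBall 0 δ) := fun u hu => by
    rw [mem_closedBall_zero_iff]
    linarith [hhalf u hu]
  have hcontr : ContractingWith (1 / 2) (hmaps.restrict T _ _) := by
    refine ⟨by norm_num, LipschitzWith.of_dist_le_mul fun u u' => ?_⟩
    have h1 := hM.norm_step_sub_le hs hAs hAu hD β (hmem u u.2) (hmem u' u'.2) (m := m) (m' := m)
      le_rfl (by simp)
    rw [sub_self, norm_zero, zero_add, add_zero] at h1
    rw [Subtype.dist_eq, Subtype.dist_eq, dist_eq_norm, dist_eq_norm]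
    refine h1.trans ?_
    push_cast
    gcongr
    exact hs.δq_le
  obtain ⟨u, hu, hfix, -⟩ := hcontr.exists_fixedPoint' Metric.isClosed_closedBall.isComplete hmaps
    (Metric.mem_closedBall_self hδ.le) (edist_ne_top _ _)
  have hfix' : T u = u := hfix
  refine ⟨u, hfix' ▸ hhalf u hu, ?_⟩
  have h1 : Au.symm (residual Y Z β (y, u) m) = 0 := by
    have : u - Au.symm (residual Y Z β (y, u) m) = u := hfix'
    rwa [sub_eq_self] at this
  exact (map_eq_zero_iff _ Au.symm.injective).1 h1

theorem exists_graphTransform (hM : IsHyperbolicModel As Au c ρ δ K L Y Z)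
    (hs : IsGraphTransformScale lam mu c ρ K L Lt E q δ) (hAs : ∀ x, ‖As x‖ ≤ lam * ‖x‖)
    (hAu : ∀ y, ‖Au.symm y‖ ≤ mu * ‖y‖) (hD : D = 2 * E) (β : LeafSpace k l M D δ) :
    ∃ β' : LeafSpace k l M D δ,
      (∀ p, residual Y Z β (p.1, β'.1 p) p.2 = 0) ∧
      ∀ p u, ‖u‖ ≤ δ →
        (1 - δ * q) * ‖u - β'.1 p‖ ≤ mu * ‖residual Y Z β (p.1, u) p.2‖ := by
  have hδ := hs.δ_pos
  have hE := hs.E_pos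
  have hq := hs.δq_le
  have hmem : ∀ p : Q k δ × M, ‖(p.1 : EuclideanSpace ℝ (Fin k))‖ ≤ δ := fun p =>
    (mem_ball_zero_iff.1 p.1.2).le
  have hex : ∀ p : Q k δ × M, ∃ u, ‖u‖ ≤ δ / 2 ∧ residual Y Z β (p.1, u) p.2 = 0 := fun p =>
    hM.exists_residual_eq_zero hs hAs hAu hD β (hmem p) p.2
  choose g hg hg0 using hex
  have hnorm : ∀ (p : Q k δ × M) (u : EuclideanSpace ℝ (Fin l)), ‖u‖ ≤ δ →
      ‖((p.1, u) : EuclideanSpace ℝ (Fin k) × EuclideanSpace ℝ (Fin l))‖ ≤ δ := fun p u hu => by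
    rw [Prod.norm_mk]; exact max_le (hmem p) hu
  have hgδ : ∀ p, ‖g p‖ ≤ δ := fun p => (hg p).trans (by linarith)
  have hDδ : 0 < D * δ / 2 := by rw [hD]; positivity
  have hlip : ∀ p p', edist (g p) (g p') ≤
      ENNReal.ofReal (D * δ / 2) * (edist p.1 p'.1 + edist p.2 p'.2) := fun p p' => by
    by_cases hm : edist p.2 p'.2 = ⊤
    · rw [hm, add_top, ENNReal.mul_top (by simpa using hDδ)]
      exact le_top
    · set a := (edist p.2 p'.2).toReal with ha
      have hma : edist p.2 p'.2 = ENNReal.ofReal a := (ENNReal.ofReal_toReal hm).symm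
      have h1 := hM.norm_sub_le_residual hs hAs hAu hD β (hnorm p _ (hgδ p)) (hnorm p' _ (hgδ p'))
        ENNReal.toReal_nonneg hma.le
      rw [hg0, hg0, sub_zero, norm_zero, mul_zero, zero_add] at h1
      have h2 : edist p.1 p'.1 =
          ENNReal.ofReal ‖(p.1 : EuclideanSpace ℝ (Fin k)) - p'.1‖ := by
        rw [Subtype.edist_eq, edist_dist, dist_eq_norm]
      rw [hma, h2, ← ENNReal.ofReal_add (norm_nonneg _) ENNReal.toReal_nonneg,
        ← ENNReal.ofReal_mul hDδ.le, edist_dist, dist_eq_norm]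
      refine ENNReal.ofReal_le_ofReal ?_
      set s := ‖(p.1 : EuclideanSpace ℝ (Fin k)) - p'.1‖ + a with hsa
      have hs0 : 0 ≤ s := add_nonneg (norm_nonneg _) ENNReal.toReal_nonneg
      have h3 : δ * q * s ≤ (1 - δ * q) * (D * δ / 2 * s) := by
        calc δ * q * s ≤ δ * (E * (1 - δ * q)) * s := by gcongr; exact hs.q_le
          _ = _ := by rw [hD]; ring
      exact le_of_mul_le_mul_left (h1.trans h3) (by linarith)
  have hcont : Continuous g := by
    refine LipschitzWith.continuous (K := 2 * Real.toNNReal (D * δ / 2)) fun p p' => ?_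
    refine (hlip p p').trans ?_
    have h1 : edist p.1 p'.1 ≤ edist p p' := by rw [Prod.edist_eq]; exact le_max_left _ _
    have h2 : edist p.2 p'.2 ≤ edist p p' := by rw [Prod.edist_eq]; exact le_max_right _ _
    calc _ ≤ ENNReal.ofReal (D * δ / 2) * (edist p p' + edist p p') := by gcongr
      _ = _ := by
        rw [← two_mul, ← mul_assoc, mul_comm (ENNReal.ofReal _)]
        rfl
  refine ⟨⟨BoundedContinuousFunction.ofNormedAddCommGroup g hcont (δ / 2) hg, hg, hlip⟩, hg0,
    fun p u hu => ?_⟩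
  have h1 := hM.norm_sub_le_residual hs hAs hAu hD β (hnorm p u hu) (hnorm p _ (hgδ p))
    (m := p.2) (m' := p.2) le_rfl (by simp)
  rw [hg0, sub_zero, sub_self, norm_zero, zero_add, mul_zero, add_zero] at h1
  exact h1

end IsHyperbolicModel

end GraphTransform

section Family

variable {B : Type*} [TopologicalSpace B] {M : Type*} [EMetricSpace M] {Λ : Set B} {k l : ℕ}

/-- The maps `Y b` are the expressions of the first component of `G` in the charts at the points
of `Λ`, and with the second component of `G` they are hyperbolic models. -/
structure IsHyperbolicFamily (φ : Λ → EuclideanSpace ℝ (Fin k) × EuclideanSpace ℝ (Fin l) → B)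
    (hΛ : Λ → Λ) (G : B × M → B × M)
    (As : Λ → EuclideanSpace ℝ (Fin k) →ₗ[ℝ] EuclideanSpace ℝ (Fin k))
    (Au : Λ → EuclideanSpace ℝ (Fin l) ≃ₗ[ℝ] EuclideanSpace ℝ (Fin l))
    (lam mu c ρ δ K L r : ℝ)
    (Y : Λ → EuclideanSpace ℝ (Fin k) × EuclideanSpace ℝ (Fin l) → M →
      EuclideanSpace ℝ (Fin k) × EuclideanSpace ℝ (Fin l)) : Prop where
  continuous_map : Continuous hΛ
  continuous : Continuous G
  injOn : ∀ b, InjOn (φ b) (Metric.closedBall 0 r)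
  continuousOn : ContinuousOn
    (fun p : Λ × (EuclideanSpace ℝ (Fin k) × EuclideanSpace ℝ (Fin l)) => φ p.1 p.2)
    (univ ×ˢ Metric.closedBall 0 r)
  model : ∀ b, IsHyperbolicModel (As b) (Au b) c ρ δ K L (Y b) fun x m => (G (φ b x, m)).2
  norm_stable_le : ∀ b x, ‖As b x‖ ≤ lam * ‖x‖
  norm_unstable_le : ∀ b y, ‖(Au b).symm y‖ ≤ mu * ‖y‖
  chart_eq : ∀ b x m, ‖x‖ ≤ δ → φ (hΛ b) (Y b x m) = (G (φ b x, m)).1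
  radius_le : δ ≤ r
  mul_radius_le : c * δ ≤ r

variable {φ : Λ → EuclideanSpace ℝ (Fin k) × EuclideanSpace ℝ (Fin l) → B}
  {hΛ : Λ → Λ} {G : B × M → B × M}
  {As : Λ → EuclideanSpace ℝ (Fin k) →ₗ[ℝ] EuclideanSpace ℝ (Fin k)}
  {Au : Λ → EuclideanSpace ℝ (Fin l) ≃ₗ[ℝ] EuclideanSpace ℝ (Fin l)}
  {lam mu c ρ δ K L r Lt E q D κ : ℝ}
  {Y : Λ → EuclideanSpace ℝ (Fin k) × EuclideanSpace ℝ (Fin l) → M →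
    EuclideanSpace ℝ (Fin k) × EuclideanSpace ℝ (Fin l)}

theorem norm_ball_prod_le {u : EuclideanSpace ℝ (Fin l)} (y : Q k δ) (hu : ‖u‖ ≤ δ) :
    ‖((y, u) : EuclideanSpace ℝ (Fin k) × EuclideanSpace ℝ (Fin l))‖ ≤ δ := by
  rw [Prod.norm_mk]
  exact max_le (mem_ball_zero_iff.1 y.2).le hu

theorem LeafSpace.norm_le (hδ : 0 ≤ δ) (β : LeafSpace k l M D δ) (p : Q k δ × M) :
    ‖β.1 p‖ ≤ δ :=
  (β.2.1 p).trans (by linarith)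

theorem LeafSpace.nonempty (k l : ℕ) (M : Type*) [EMetricSpace M] (D : ℝ) (hδ : 0 ≤ δ) :
    Nonempty (LeafSpace k l M D δ) :=
  ⟨0, fun p => by simpa using by positivity, fun p q => by simp⟩

theorem LeafSpace.completeSpace (k l : ℕ) (M : Type*) [EMetricSpace M] (D δ : ℝ) :
    CompleteSpace (LeafSpace k l M D δ) := by
  have h1 : IsClosed {β : (Q k δ × M) →ᵇ EuclideanSpace ℝ (Fin l) | ∀ p, ‖β p‖ ≤ δ / 2} := by
    simp only [ofPred_forall]
    exact isClosed_iInter fun p => isClosed_le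
      (continuous_eval_const _).norm continuous_const
  have h2 : IsClosed {β : (Q k δ × M) →ᵇ EuclideanSpace ℝ (Fin l) | ∀ p q, edist (β p) (β q) ≤
      ENNReal.ofReal (D * δ / 2) * (edist p.1 q.1 + edist p.2 q.2)} := by
    simp only [ofPred_forall]
    exact isClosed_iInter fun p => isClosed_iInter fun q => isClosed_le
      ((continuous_eval_const _).edist
        (continuous_eval_const _)) continuous_const
  exact (h1.inter h2).completeSpace_coe

namespace IsHyperbolicFamily

theorem residual_eq_zero_iff (hY : IsHyperbolicFamily φ hΛ G As Au lam mu c ρ δ K L r Y)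
    (hs : IsGraphTransformScale lam mu c ρ K L Lt E q δ) (b : Λ) (β : LeafSpace k l M D δ)
    {x : EuclideanSpace ℝ (Fin k) × EuclideanSpace ℝ (Fin l)} (hx : ‖x‖ ≤ δ) (m : M) :
    residual (Y b) (fun x m => (G (φ b x, m)).2) β x m = 0 ↔
      G (φ b x, m) ∈ leaf φ (hΛ b) β := by
  have hY1 := (hY.model b).norm_fst_lt hs (hY.norm_stable_le b) hx m
  rw [← mem_ball_zero_iff] at hY1
  rw [residual, leafExt_of_mem β hY1, sub_eq_zero]
  constructor
  · intro h
    refine ⟨(⟨_, hY1⟩, (G (φ b x, m)).2), Prod.ext ?_ rfl⟩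
    rw [← hY.chart_eq b x m hx]
    change φ (hΛ b) ((Y b x m).1, _) = _
    rw [← h]
  · rintro ⟨⟨y, n⟩, hyn⟩
    have h1 : φ (hΛ b) (y, β.1 (y, n)) = φ (hΛ b) (Y b x m) := by
      rw [hY.chart_eq b x m hx, ← hyn]
    have h2 : n = (G (φ b x, m)).2 := by rw [← hyn]
    have h3 := hY.injOn (hΛ b)
      (by
        rw [mem_closedBall_zero_iff]
        exact (norm_ball_prod_le y (LeafSpace.norm_le hs.δ_pos.le β _)).trans hY.radius_le)
      (by
        rw [mem_closedBall_zero_iff]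
        exact ((hY.model b).norm_le x m hx).trans hY.mul_radius_le) h1
    have h4 : (y : EuclideanSpace ℝ (Fin k)) = (Y b x m).1 := congrArg Prod.fst h3
    have h5 : β.1 (y, n) = (Y b x m).2 := congrArg Prod.snd h3
    rw [← h5, ← h2]
    congr
    exact Subtype.ext h4

theorem isGraphTransform (hY : IsHyperbolicFamily φ hΛ G As Au lam mu c ρ δ K L r Y)
    (hs : IsGraphTransformScale lam mu c ρ K L Lt E q δ) (b : Λ) {β β' : LeafSpace k l M D δ}
    (h0 : ∀ p, residual (Y b) (fun x m => (G (φ b x, m)).2) β (p.1, β'.1 p) p.2 = 0)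
    (h1 : ∀ p u, ‖u‖ ≤ δ → ‖u - β'.1 p‖ ≤
      κ * ‖residual (Y b) (fun x m => (G (φ b x, m)).2) β (p.1, u) p.2‖) :
    IsGraphTransform φ hΛ G b β β' := by
  refine Subset.antisymm ?_ ?_
  · rintro ⟨z, m⟩ ⟨hz, ⟨⟨y, u⟩, rfl⟩, -⟩
    have hu := (mem_ball_zero_iff.1 u.2).le
    have h2 := h1 (y, m) u hu
    rw [(hY.residual_eq_zero_iff hs b β (norm_ball_prod_le y hu) m).2 hz, norm_zero, mul_zero,
      norm_le_zero_iff, sub_eq_zero] at h2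
    refine ⟨(y, m), Prod.ext ?_ rfl⟩
    change φ b (y, β'.1 (y, m)) = φ b (y, u)
    rw [h2]
  · rintro _ ⟨⟨y, m⟩, rfl⟩
    refine ⟨(hY.residual_eq_zero_iff hs b β
      (norm_ball_prod_le y (LeafSpace.norm_le hs.δ_pos.le β' _)) m).1 (h0 (y, m)),
      ⟨⟨y, ⟨β'.1 (y, m), ?_⟩⟩, rfl⟩, mem_univ _⟩
    rw [mem_ball_zero_iff]
    have := hs.δ_pos
    linarith [β'.2.1 (y, m)]

theorem image_leaf_subset_iff (hY : IsHyperbolicFamily φ hΛ G As Au lam mu c ρ δ K L r Y)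
    (hs : IsGraphTransformScale lam mu c ρ K L Lt E q δ) (b : Λ) {β α β' : LeafSpace k l M D δ}
    (h0 : ∀ p, residual (Y b) (fun x m => (G (φ b x, m)).2) β (p.1, β'.1 p) p.2 = 0)
    (h1 : ∀ p u, ‖u‖ ≤ δ → ‖u - β'.1 p‖ ≤
      κ * ‖residual (Y b) (fun x m => (G (φ b x, m)).2) β (p.1, u) p.2‖) :
    G '' leaf φ b α ⊆ leaf φ (hΛ b) β ↔ β' = α := by
  have hα := LeafSpace.norm_le hs.δ_pos.le α
  constructor
  · intro h
    refine Subtype.ext (BoundedContinuousFunction.ext fun p => ?_)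
    have h2 := h1 p _ (hα p)
    rw [(hY.residual_eq_zero_iff hs b β (norm_ball_prod_le p.1 (hα p)) p.2).2
      (h (mem_image_of_mem G ⟨p, rfl⟩)), norm_zero, mul_zero, norm_le_zero_iff, sub_eq_zero] at h2
    exact h2.symm
  · rintro rfl
    rintro _ ⟨_, ⟨p, rfl⟩, rfl⟩
    exact (hY.residual_eq_zero_iff hs b β (norm_ball_prod_le p.1 (hα p)) p.2).1 (h0 p)

theorem continuous_chart [T2Space B] [CompactSpace Λ]
    (hY : IsHyperbolicFamily φ hΛ G As Au lam mu c ρ δ K L r Y) :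
    Continuous fun p : Λ × (Metric.closedBall
      (0 : EuclideanSpace ℝ (Fin k) × EuclideanSpace ℝ (Fin l)) δ × M) =>
        Y p.1 p.2.1 p.2.2 := by
  set Ψ : Λ × Metric.closedBall (0 : EuclideanSpace ℝ (Fin k) × EuclideanSpace ℝ (Fin l)) r →
    Λ × B := fun p => (p.1, φ p.1 p.2) with hΨ
  have hΨc : Continuous Ψ := continuous_fst.prodMk (hY.continuousOn.comp_continuous
    (continuous_fst.prodMk (continuous_subtype_val.comp continuous_snd)) fun p =>
      ⟨mem_univ _, p.2.2⟩)
  have hΨi : Function.Injective Ψ := by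
    rintro ⟨b, y⟩ ⟨b', y'⟩ h
    obtain rfl : b = b' := congrArg Prod.fst h
    exact Prod.ext rfl (Subtype.ext (hY.injOn b y.2 y'.2 (congrArg Prod.snd h)))
  have hemb := hΨc.isClosedEmbedding hΨi
  have hmem : ∀ p : Λ × (Metric.closedBall
      (0 : EuclideanSpace ℝ (Fin k) × EuclideanSpace ℝ (Fin l)) δ × M),
      Y p.1 p.2.1 p.2.2 ∈
        Metric.closedBall (0 : EuclideanSpace ℝ (Fin k) × EuclideanSpace ℝ (Fin l)) r := fun p => by
    rw [mem_closedBall_zero_iff]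
    exact ((hY.model p.1).norm_le _ _ (mem_closedBall_zero_iff.1 p.2.1.2)).trans hY.mul_radius_le
  have hW : Continuous fun p : Λ × (Metric.closedBall
      (0 : EuclideanSpace ℝ (Fin k) × EuclideanSpace ℝ (Fin l)) δ × M) =>
      ((hΛ p.1, ⟨Y p.1 p.2.1 p.2.2, hmem p⟩) :
        Λ × Metric.closedBall (0 : EuclideanSpace ℝ (Fin k) × EuclideanSpace ℝ (Fin l)) r) := by
    rw [hemb.isInducing.continuous_iff]
    have h1 : Continuous fun p : Λ × (Metric.closedBall
        (0 : EuclideanSpace ℝ (Fin k) × EuclideanSpace ℝ (Fin l)) δ × M) =>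
        φ p.1 (p.2.1 : EuclideanSpace ℝ (Fin k) × EuclideanSpace ℝ (Fin l)) :=
      hY.continuousOn.comp_continuous (continuous_fst.prodMk
        (continuous_subtype_val.comp (continuous_fst.comp continuous_snd))) fun p =>
          ⟨mem_univ _, Metric.closedBall_subset_closedBall hY.radius_le p.2.1.2⟩
    have h2 := (hY.continuous_map.comp continuous_fst).prodMk
      (continuous_fst.comp (hY.continuous.comp (h1.prodMk (continuous_snd.comp continuous_snd))))
    refine h2.congr fun p => ?_
    exact Prod.ext rfl (hY.chart_eq p.1 _ _ (mem_closedBall_zero_iff.1 p.2.1.2)).symm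
  exact continuous_subtype_val.comp (continuous_snd.comp hW)

theorem continuous_snd_comp (hY : IsHyperbolicFamily φ hΛ G As Au lam mu c ρ δ K L r Y) :
    Continuous fun p : Λ × (Metric.closedBall
      (0 : EuclideanSpace ℝ (Fin k) × EuclideanSpace ℝ (Fin l)) δ × M) =>
        (G (φ p.1 p.2.1, p.2.2)).2 := by
  have h1 : Continuous fun p : Λ × (Metric.closedBall
      (0 : EuclideanSpace ℝ (Fin k) × EuclideanSpace ℝ (Fin l)) δ × M) =>
      φ p.1 (p.2.1 : EuclideanSpace ℝ (Fin k) × EuclideanSpace ℝ (Fin l)) :=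
    hY.continuousOn.comp_continuous (continuous_fst.prodMk
      (continuous_subtype_val.comp (continuous_fst.comp continuous_snd))) fun p =>
        ⟨mem_univ _, Metric.closedBall_subset_closedBall hY.radius_le p.2.1.2⟩
  exact continuous_snd.comp (hY.continuous.comp (h1.prodMk (continuous_snd.comp continuous_snd)))

/-- Graph transforms of a lamination depend continuously on the base point. -/
theorem continuous_graphTransform [T2Space B] [CompactSpace Λ] [CompactSpace M]
    (hY : IsHyperbolicFamily φ hΛ G As Au lam mu c ρ δ K L r Y)
    (hs : IsGraphTransformScale lam mu c ρ K L Lt E q δ) (hD : 0 ≤ D) (hκ : 0 ≤ κ)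
    (S : LaminationSpace Λ k l M D δ) {T : Λ → LeafSpace k l M D δ}
    (h0 : ∀ b p, residual (Y b) (fun x m => (G (φ b x, m)).2) (S (hΛ b))
      (p.1, (T b).1 p) p.2 = 0)
    (h1 : ∀ b p u, ‖u‖ ≤ δ → ‖u - (T b).1 p‖ ≤
      κ * ‖residual (Y b) (fun x m => (G (φ b x, m)).2) (S (hΛ b)) (p.1, u) p.2‖) :
    Continuous T := by
  have hδ := hs.δ_pos
  refine continuous_iff_continuousAt.2 fun b₁ => Metric.tendsto_nhds.2 fun ε hε => ?_
  set A := κ * (2 + D * δ) with hA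
  have hA0 : 0 ≤ A := by positivity
  set η := ε / (A + 1) / 2 with hη
  have hη0 : 0 < η := by positivity
  have e1 : ∀ᶠ b in 𝓝 b₁, ∀ c ∈ (univ : Set (Metric.closedBall
      (0 : EuclideanSpace ℝ (Fin k) × EuclideanSpace ℝ (Fin l)) δ × M)),
      ‖Y b c.1 c.2 - Y b₁ c.1 c.2‖ < η := by
    refine isCompact_univ.eventually_forall_of_forall_eventually fun c _ => ?_
    have hc := hY.continuous_chart.sub (hY.continuous_chart.comp
      ((continuous_const (y := b₁)).prodMk continuous_snd))
    refine hc.norm.continuousAt.eventually_lt_const ?_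
    simpa using hη0
  have e2 : ∀ᶠ b in 𝓝 b₁, ∀ c ∈ (univ : Set (Metric.closedBall
      (0 : EuclideanSpace ℝ (Fin k) × EuclideanSpace ℝ (Fin l)) δ × M)),
      edist (G (φ b c.1, c.2)).2 (G (φ b₁ c.1, c.2)).2 < ENNReal.ofReal η := by
    refine isCompact_univ.eventually_forall_of_forall_eventually fun c _ => ?_
    have hc := hY.continuous_snd_comp.edist (hY.continuous_snd_comp.comp
      ((continuous_const (y := b₁)).prodMk continuous_snd))
    refine hc.continuousAt.eventually_lt_const ?_
    simpa using hη0
  have e3 : ∀ᶠ b in 𝓝 b₁, dist (S (hΛ b)) (S (hΛ b₁)) < η :=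
    Metric.tendsto_nhds.1 (S.continuous.comp hY.continuous_map).continuousAt η hη0
  filter_upwards [e1, e2, e3] with b hb1 hb2 hb3
  have hle : dist (T b₁) (T b) ≤ A * η := by
    refine (BoundedContinuousFunction.dist_le (by positivity)).2 fun p => ?_
    rw [dist_eq_norm]
    set u := (T b₁).1 p with hu
    have huδ : ‖u‖ ≤ δ := LeafSpace.norm_le hδ.le (T b₁) p
    have hx : ‖((p.1, u) : EuclideanSpace ℝ (Fin k) × EuclideanSpace ℝ (Fin l))‖ ≤ δ :=
      norm_ball_prod_le p.1 huδ
    refine (h1 b p u huδ).trans ?_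
    rw [hA, mul_assoc]
    refine mul_le_mul_of_nonneg_left ?_ hκ
    set x : EuclideanSpace ℝ (Fin k) × EuclideanSpace ℝ (Fin l) := (p.1, u) with hxd
    have g1 := (hb1 (⟨x, mem_closedBall_zero_iff.2 hx⟩, p.2) (mem_univ _)).le
    have g2 := (hb2 (⟨x, mem_closedBall_zero_iff.2 hx⟩, p.2) (mem_univ _)).le
    change ‖Y b x p.2 - Y b₁ x p.2‖ ≤ η at g1
    change edist (G (φ b x, p.2)).2 (G (φ b₁ x, p.2)).2 ≤ ENNReal.ofReal η at g2
    have g3 := norm_leafExt_sub_le (by positivity) (S (hΛ b))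
      ((hY.model b).norm_fst_lt hs (hY.norm_stable_le b) hx p.2)
      ((hY.model b₁).norm_fst_lt hs (hY.norm_stable_le b₁) hx p.2) hη0.le g2
    have g4 := dist_leafExt_le (S (hΛ b)) (S (hΛ b₁)) (Y b₁ x p.2).1 (G (φ b₁ x, p.2)).2
    have g5 : ‖(Y b x p.2).1 - (Y b₁ x p.2).1‖ ≤ η := (norm_fst_le (Y b x p.2 - Y b₁ x p.2)).trans g1
    have g6 : ‖(Y b x p.2).2 - (Y b₁ x p.2).2‖ ≤ η := (norm_snd_le (Y b x p.2 - Y b₁ x p.2)).trans g1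
    have g0 := h0 b₁ p
    rw [← hu, ← hxd] at g0
    calc _ = ‖residual (Y b) (fun x m => (G (φ b x, m)).2) (S (hΛ b)) x p.2 -
          residual (Y b₁) (fun x m => (G (φ b₁ x, m)).2) (S (hΛ b₁)) x p.2‖ := by
            rw [g0, sub_zero]
      _ = ‖((Y b x p.2).2 - (Y b₁ x p.2).2) -
          ((leafExt (S (hΛ b)) (Y b x p.2).1 (G (φ b x, p.2)).2 -
            leafExt (S (hΛ b)) (Y b₁ x p.2).1 (G (φ b₁ x, p.2)).2) +
          (leafExt (S (hΛ b)) (Y b₁ x p.2).1 (G (φ b₁ x, p.2)).2 -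
            leafExt (S (hΛ b₁)) (Y b₁ x p.2).1 (G (φ b₁ x, p.2)).2))‖ := by
            congr 1; simp only [residual]; abel
      _ ≤ η + (D * δ / 2 * (η + η) + η) := (norm_sub_le _ _).trans (add_le_add g6
            ((norm_add_le _ _).trans (add_le_add (g3.trans (by gcongr)) (g4.trans hb3.le))))
      _ = _ := by ring
  rw [dist_comm]
  refine hle.trans_lt ?_
  have h2 : (A + 1) * η = ε / 2 := by rw [hη]; field_simp
  nlinarith

theorem dist_graphTransform_le
    (hκ : 0 ≤ κ) (hδ : 0 ≤ δ) (b : Λ) {β₀ β₁ β₀' β₁' : LeafSpace k l M D δ}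
    (h0 : ∀ p, residual (Y b) (fun x m => (G (φ b x, m)).2) β₁ (p.1, β₁'.1 p) p.2 = 0)
    (h1 : ∀ p u, ‖u‖ ≤ δ → ‖u - β₀'.1 p‖ ≤
      κ * ‖residual (Y b) (fun x m => (G (φ b x, m)).2) β₀ (p.1, u) p.2‖) :
    dist β₀' β₁' ≤ κ * dist β₀ β₁ := by
  rw [dist_comm, dist_comm β₀]
  refine (BoundedContinuousFunction.dist_le (by positivity)).2 fun p => ?_
  rw [dist_eq_norm]
  refine (h1 p _ (LeafSpace.norm_le hδ β₁' p)).trans (mul_le_mul_of_nonneg_left ?_ hκ)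
  rw [← sub_zero (residual (Y b) _ β₀ _ _), ← h0 p]
  refine le_trans (le_of_eq ?_) (dist_leafExt_le β₁ β₀ (Y b (p.1, β₁'.1 p) p.2).1
    (G (φ b (p.1, β₁'.1 p), p.2)).2)
  congr 1
  simp only [residual]
  abel

/-- The graph transforms of a hyperbolic family are contractions, with a unique fixed point which
is the unique invariant lamination. -/
theorem exists_globalGraphTransform [T2Space B] [CompactSpace Λ] [CompactSpace M]
    (hY : IsHyperbolicFamily φ hΛ G As Au lam mu c ρ δ K L r Y)
    (hs : IsGraphTransformScale lam mu c ρ K L Lt E q δ) (hD : D = 2 * E)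
    (hκ : mu ≤ (1 - δ * q) * κ) (hκ0 : 0 ≤ κ) (hκ1 : κ < 1) :
    ∃ (gb : Λ → LeafSpace k l M D δ → LeafSpace k l M D δ)
      (g : LaminationSpace Λ k l M D δ → LaminationSpace Λ k l M D δ),
      (∀ b β, IsGraphTransform φ hΛ G b β (gb b β)) ∧
      (∀ b β₀ β₁, dist (gb b β₀) (gb b β₁) ≤ κ * dist β₀ β₁) ∧
      (∀ S b, g S b = gb b (S (hΛ b))) ∧
      (∀ S₀ S₁, dist (g S₀) (g S₁) ≤ κ * dist S₀ S₁) ∧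
      (∃! S, g S = S) ∧ ∃! S : LaminationSpace Λ k l M D δ, IsInvariantLamination φ hΛ G S := by
  have hδ := hs.δ_pos
  have hE := hs.E_pos
  have hex : ∀ (b : Λ) (β : LeafSpace k l M D δ), ∃ β' : LeafSpace k l M D δ,
      (∀ p, residual (Y b) (fun x m => (G (φ b x, m)).2) β (p.1, β'.1 p) p.2 = 0) ∧
      ∀ p u, ‖u‖ ≤ δ → ‖u - β'.1 p‖ ≤
        κ * ‖residual (Y b) (fun x m => (G (φ b x, m)).2) β (p.1, u) p.2‖ := fun b β => by
    obtain ⟨β', h0, h1⟩ := (hY.model b).exists_graphTransform hs (hY.norm_stable_le b)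
      (hY.norm_unstable_le b) hD β
    refine ⟨β', h0, fun p u hu => ?_⟩
    have h2 := hs.δq_le
    refine le_of_mul_le_mul_left ((h1 p u hu).trans ?_) (by linarith : 0 < 1 - δ * q)
    rw [← mul_assoc]
    exact mul_le_mul_of_nonneg_right hκ (norm_nonneg _)
  choose gb h0 h1 using hex
  have hcont : ∀ S : LaminationSpace Λ k l M D δ, Continuous fun b => gb b (S (hΛ b)) := fun S =>
    hY.continuous_graphTransform hs (by rw [hD]; positivity) hκ0 S (fun b => h0 b _) fun b => h1 b _
  set g : LaminationSpace Λ k l M D δ → LaminationSpace Λ k l M D δ := fun S =>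
    ⟨fun b => gb b (S (hΛ b)), hcont S⟩ with hg
  have hdist : ∀ b β₀ β₁, dist (gb b β₀) (gb b β₁) ≤ κ * dist β₀ β₁ := fun b β₀ β₁ =>
    dist_graphTransform_le hκ0 hδ.le b (h0 b β₁) (h1 b β₀)
  have hgdist : ∀ S₀ S₁, dist (g S₀) (g S₁) ≤ κ * dist S₀ S₁ := fun S₀ S₁ =>
    (ContinuousMap.dist_le (by positivity)).2 fun b =>
      (hdist b _ _).trans (by gcongr; exact ContinuousMap.dist_apply_le_dist _)
  have hcontr : ContractingWith ⟨κ, hκ0⟩ g :=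
    ⟨by exact_mod_cast hκ1, LipschitzWith.of_dist_le_mul hgdist⟩
  have hfix : ∃! S, g S = S := by
    have := LeafSpace.completeSpace k l M D δ
    obtain ⟨β⟩ := LeafSpace.nonempty k l M D hδ.le
    have : Nonempty (LaminationSpace Λ k l M D δ) := ⟨ContinuousMap.const _ β⟩
    exact ⟨hcontr.fixedPoint g, hcontr.fixedPoint_isFixedPt, fun S hS => hcontr.fixedPoint_unique hS⟩
  have hinv : ∀ S, IsInvariantLamination φ hΛ G S ↔ g S = S := fun S => by
    rw [ContinuousMap.ext_iff]
    exact forall_congr' fun b => hY.image_leaf_subset_iff hs b (h0 b _) (h1 b _)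
  refine ⟨gb, g, fun b β => hY.isGraphTransform hs b (h0 b β) (h1 b β), hdist, fun _ _ => rfl,
    hgdist, hfix, ?_⟩
  simpa only [hinv] using hfix

end IsHyperbolicFamily

end Family

theorem exists_graphTransformScale {lam mu c K L Lt r : ℝ} (hlam : 0 ≤ lam) (hlam1 : lam < 1)
    (hmu : 0 ≤ mu) (hmu1 : mu < 1) (hc : 1 ≤ c) (hK : 0 ≤ K) (hL : 0 ≤ L) (hK' : lam + K ≤ Lt)
    (hL' : L ≤ Lt) (hLt : mu * Lt < 1) (hr : 0 < r) :
    ∃ E > 0, ∃ κ > 0, ∃ ρ₀ > 0, ∀ ρ, 0 < ρ → ρ < ρ₀ → ∃ δ > 0, δ ≤ κ * ρ ∧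
      mu + 2 * E * δ < 1 ∧ c * δ ≤ r ∧ c * δ ≤ 1 ∧ ∃ q,
        IsGraphTransformScale lam mu c ρ K L Lt E q δ ∧
        mu ≤ (1 - δ * q) * (mu + 2 * E * δ) := by
  have hc0 : 0 < c := by linarith
  have hLt0 : 0 ≤ Lt := hL.trans hL'
  set θ := 1 - mu * Lt with hθ
  have hθ0 : 0 < θ := by linarith
  have hθ1 : θ ≤ 1 := by have := mul_nonneg hmu hLt0; linarith
  set σ := min ((1 - lam) / 2) ((1 - mu) / 2) with hσ
  have hσ0 : 0 < σ := lt_min (by linarith) (by linarith)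
  have hσl : σ ≤ (1 - lam) / 2 := min_le_left _ _
  have hσm : σ ≤ (1 - mu) / 2 := min_le_right _ _
  set t := min (min (σ / 2) (θ ^ 2 / 32)) (min (θ * (1 - mu) / 16) (min r 1)) with ht
  have ht0 : 0 < t := by
    have : 0 < θ * (1 - mu) := mul_pos hθ0 (by linarith)
    exact lt_min (lt_min (by positivity) (by positivity)) (lt_min (by positivity)
      (lt_min hr one_pos))
  refine ⟨4 * c / θ, by positivity, 2 * c / σ, by positivity, t / (c * (2 * c / σ)), by positivity,
    fun ρ hρ hρ₀ => ⟨2 * c / σ * ρ, by positivity, le_rfl, ?_⟩⟩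
  set δ := 2 * c / σ * ρ with hδd
  set E := 4 * c / θ with hEd
  have hδ : 0 < δ := by positivity
  have hE : 0 < E := by positivity
  have hδt : c * δ < t := by
    rw [lt_div_iff₀ (by positivity)] at hρ₀
    calc c * δ = ρ * (c * (2 * c / σ)) := by rw [hδd]; ring
      _ < t := hρ₀
  have ht1 : t ≤ σ / 2 := (min_le_left _ _).trans (min_le_left _ _)
  have ht2 : t ≤ θ ^ 2 / 32 := (min_le_left _ _).trans (min_le_right _ _)
  have ht3 : t ≤ θ * (1 - mu) / 16 := (min_le_right _ _).trans (min_le_left _ _)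
  have ht4 : t ≤ r := (min_le_right _ _).trans ((min_le_right _ _).trans (min_le_left _ _))
  have ht5 : t ≤ 1 := (min_le_right _ _).trans ((min_le_right _ _).trans (min_le_right _ _))
  have hEθ : E * θ = 4 * c := by rw [hEd]; field_simp
  have hcρ : c * ρ = σ * δ / 2 := by rw [hδd]; field_simp
  have hcδ : c * (δ ^ 2 + ρ) ≤ σ * δ := by
    have h1 : c * δ * δ ≤ σ / 2 * δ := by gcongr; exact hδt.le.trans ht1
    linarith
  have hEδ : E * δ ≤ θ / 8 := by
    refine le_of_mul_le_mul_left ?_ hθ0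
    calc θ * (E * δ) = E * θ * δ := by ring
      _ = 4 * (c * δ) := by rw [hEθ]; ring
      _ ≤ θ * (θ / 8) := by linarith
  have hρδ : ρ ≤ δ := by
    have h1 : 1 ≤ 2 * c / σ := by
      rw [le_div_iff₀ hσ0]
      linarith
    exact le_mul_of_one_le_left hρ.le h1
  set q := mu * (E * (Lt + c * δ) + c) with hq
  have hq0 : 0 ≤ q := by positivity
  have hcδθ : c * δ ≤ θ / 8 := by
    have h1 : θ * θ ≤ 1 * θ := by gcongr
    linarith
  have hq1 : q ≤ E * (1 - θ / 2) := by
    have h1 : q = E * (1 - θ) + mu * (E * (c * δ) + c) := by rw [hq, hθ]; ring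
    have h2 : mu * (E * (c * δ) + c) ≤ 1 * (E * (c * δ) + c) := by gcongr
    have h3 : E * (c * δ) ≤ E * (θ / 8) := by gcongr
    linarith [mul_pos hE hθ0]
  have hqE : q ≤ E := hq1.trans (by linarith [mul_pos hE hθ0])
  have hδq : δ * q ≤ θ / 8 :=
    (mul_le_mul_of_nonneg_left hqE hδ.le).trans ((mul_comm δ E).trans_le hEδ)
  have hEδq : E * (δ * q) ≤ E * (θ / 8) := by gcongr
  refine ⟨?_, hδt.le.trans ht4, hδt.le.trans ht5, q, ?_, ?_⟩
  · have h1 : θ * (E * δ) < θ * ((1 - mu) / 2) := by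
      have h2 : 0 < θ * (1 - mu) := mul_pos hθ0 (by linarith)
      calc θ * (E * δ) = E * θ * δ := by ring
        _ = 4 * (c * δ) := by rw [hEθ]; ring
        _ < θ * ((1 - mu) / 2) := by linarith
    linarith [lt_of_mul_lt_mul_left h1 hθ0.le]
  · exact {
      lam_nonneg := hlam
      mu_nonneg := hmu
      c_nonneg := hc0.le
      ρ_nonneg := hρ.le
      ρ_le := hρδ
      δ_pos := hδ
      K_nonneg := hK
      L_nonneg := hL
      lam_add_le := hK'
      L_le := hL'
      E_pos := hE
      stable_lt := by
        have h1 : σ * δ ≤ (1 - lam) / 2 * δ := by gcongr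
        have h2 : 0 < (1 - lam) * δ := mul_pos (by linarith) hδ
        linarith
      unstable_le := by
        have h1 : mu * (δ / 2 + c * (δ ^ 2 + ρ)) ≤ mu * (δ / 2 + (1 - mu) / 2 * δ) := by
          refine mul_le_mul_of_nonneg_left (add_le_add le_rfl (hcδ.trans ?_)) hmu
          gcongr
        linarith [mul_nonneg (sq_nonneg (1 - mu)) hδ.le]
      q_eq := hq
      q_le := by linarith [mul_pos hE hθ0]
      δq_le := by linarith }
  · have h1 : q * mu ≤ E := (mul_le_of_le_one_right hq0 hmu1.le).trans hqE
    have h2 : 0 ≤ δ * (2 * E - q * mu - 2 * E * (δ * q)) :=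
      mul_nonneg hδ.le (by linarith [mul_le_mul_of_nonneg_left hθ1 hE.le])
    linarith

end SkewProduct

open SkewProduct

theorem lemma1
    -- the base, a compact Riemannian manifold, possibly with boundary
    {E : Type*} [NormedAddCommGroup E] [NormedSpace ℝ E] [FiniteDimensional ℝ E]
    {H : Type*} [TopologicalSpace H] (I : ModelWithCorners ℝ E H)
    {B : Type*} [TopologicalSpace B] [T2Space B] [CompactSpace B] [ChartedSpace H B]
    [IsManifold I ∞ B] [RiemannianBundle (fun x : B => TangentSpace I x)]
    [IsContMDiffRiemannianBundle I ∞ E (fun x : B => TangentSpace I x)]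
    -- the fiber, a compact Riemannian manifold, possibly with boundary
    {E' : Type*} [NormedAddCommGroup E'] [NormedSpace ℝ E'] [FiniteDimensional ℝ E']
    {H' : Type*} [TopologicalSpace H'] (J : ModelWithCorners ℝ E' H')
    {M : Type*} [EMetricSpace M] [CompactSpace M] [ChartedSpace H' M]
    [IsManifold J ∞ M] [RiemannianBundle (fun x : M => TangentSpace J x)]
    [IsContMDiffRiemannianBundle J ∞ E' (fun x : M => TangentSpace J x)]
    [IsRiemannianManifold J M]
    -- the map of the base and its hyperbolic set, with a trivialized splitting
    (h : B → B) (hh : IsMorphism I 2 h) (Λ : Set B) [CompactSpace Λ]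
    (Es Eu : ∀ b : B, Submodule ℝ (TangentSpace I b)) (lamm lam mum mu : ℝ)
    (hyp : IsHyperbolicSet I h Λ Es Eu lamm lam mum mu)
    (k l : ℕ)
    (φs : ∀ b : Λ, EuclideanSpace ℝ (Fin k) →ₗᵢ[ℝ] TangentSpace I (b : B))
    (φu : ∀ b : Λ, EuclideanSpace ℝ (Fin l) →ₗᵢ[ℝ] TangentSpace I (b : B))
    (hφs : IsIsometricTrivialization I Λ Es φs) (hφu : IsIsometricTrivialization I Λ Eu φu)
    -- the skew product
    (f : B → M → M) (hF : ContMDiff (I.prod J) (I.prod J) 1 (skew h f))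
    (hf : ∀ b : B, IsMorphism J 1 (f b))
    (hdom : ModifiedDominatedSplitting I J f lam mu)
    -- the embedding through which distances of maps are measured
    {N : ℕ} (ι : B × M → EuclideanSpace ℝ (Fin N)) (hι : IsSmoothInjectiveImmersion I J ι) :
    ∃ D > (0 : ℝ), ∃ K > (0 : ℝ), ∃ C > (0 : ℝ), ∃ ρ₀ > (0 : ℝ), ∀ ρ : ℝ, 0 < ρ → ρ < ρ₀ →
      ∃ δ > (0 : ℝ), δ ≤ K * ρ ∧ mu + C * δ < 1 ∧
        IsAdmissibleRadius (baseChart I φs φu) δ ∧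
        ∀ G : B × M → B × M, IsPerturbation I J ι (skew h f) ρ G →
          ∃ (gb : Λ → LeafSpace k l M D δ → LeafSpace k l M D δ)
            (g : LaminationSpace Λ k l M D δ → LaminationSpace Λ k l M D δ),
            -- the pointwise graph transform
            (∀ (b : Λ) (β : LeafSpace k l M D δ),
              IsGraphTransform (baseChart I φs φu) (hyp.mapsTo.restrict h Λ Λ) G b β (gb b β)) ∧
            (∀ (b : Λ) (β₀ β₁ : LeafSpace k l M D δ),
              dist (gb b β₀) (gb b β₁) ≤ (mu + C * δ) * dist β₀ β₁) ∧
            -- the global graph transform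
            (∀ (S : LaminationSpace Λ k l M D δ) (b : Λ),
              g S b = gb b (S (hyp.mapsTo.restrict h Λ Λ b))) ∧
            (∀ S₀ S₁ : LaminationSpace Λ k l M D δ,
              dist (g S₀) (g S₁) ≤ (mu + C * δ) * dist S₀ S₁) ∧
            -- the unique fixed point and the unique invariant lamination
            (∃! S : LaminationSpace Λ k l M D δ, g S = S) ∧
            (∃! S : LaminationSpace Λ k l M D δ,
              IsInvariantLamination (baseChart I φs φu) (hyp.mapsTo.restrict h Λ Λ) G S) := by

  obtain ⟨Ld, hLlam, hLmu, hLd⟩ := hdom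
  have hlam0 := hyp.lamm_nonneg.trans hyp.lamm_le
  have hmu0 := hyp.mum_nonneg.trans hyp.mum_le
  have hlam1 := hyp.lam_lt
  have hmu1 := hyp.mu_lt
  set ν := max lam mu with hν
  have hν0 : 0 ≤ ν := hlam0.trans (le_max_left _ _)
  set L := max Ld ν with hL
  have hLν : ν ≤ L := le_max_right _ _
  have hL0 : 0 ≤ L := hν0.trans hLν
  have hmuL : mu * L < 1 := by
    rcases max_cases Ld ν with ⟨h1, -⟩ | ⟨h1, -⟩
    · rw [hL, h1, mul_comm]; exact hLmu
    · rw [hL, h1]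
      have : ν < 1 := max_lt hlam1 hmu1
      nlinarith
  set ε := (1 - mu * L) / 2 with hε
  have hε0 : 0 < ε := by rw [hε]; linarith
  obtain ⟨c, hc1, hc⟩ := exists_model (φs := φs) (φu := φu) hh.1 hF hι hyp hφs hφu
    (K := L - ν) (L := L) (by linarith) (by linarith)
    (fun b m => by have h1 := (hLd b m).1; have h2 : Ld ≤ L := le_max_left _ _; linarith)
    (fun b m => (hLd b m).2.1.trans (le_max_left _ _)) hε0
  choose As Au hAs hAu hmodel using hc
  obtain ⟨r, hr, hinj, hcont, hadm⟩ := exists_chart_radius hφs hφu hyp.interior hyp.isCompl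
  obtain ⟨E₀, hE₀, K, hK, ρ₀, hρ₀, hscale⟩ := exists_graphTransformScale (K := L - ν + ε)
    (L := L + ε) (Lt := L + ε) hlam0 hlam1 hmu0 hmu1 hc1 (by linarith) (by linarith)
    (by have h1 : lam ≤ ν := le_max_left _ _; linarith) le_rfl (by nlinarith) hr
  refine ⟨2 * E₀, by positivity, K, hK, 2 * E₀, by positivity, ρ₀, hρ₀, fun ρ hρ hρρ₀ => ?_⟩
  obtain ⟨δ, hδ, hδK, hδ1, hcr, hcδ, q, hs, hκ⟩ := hscale ρ hρ hρρ₀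
  have hδr : δ ≤ r := le_trans (by nlinarith) hcr
  refine ⟨δ, hδ, hδK, hδ1, hadm δ hδr, fun G hG => ?_⟩
  have hY := fun b => hmodel b G ρ δ hG.isMorphism.1 hG.dist_lt hρ.le hs.ρ_le
    (by rw [le_div_iff₀ (by linarith), mul_comm]; exact hcδ)
  choose Y hYm hYc using hY
  have hfam : IsHyperbolicFamily (baseChart I φs φu) (hyp.mapsTo.restrict h Λ Λ) G As Au lam mu c ρ
      δ (L - ν + ε) (L + ε) r Y := {
    continuous_map := hh.1.continuous.restrict hyp.mapsTo
    continuous := hG.isMorphism.1.continuous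
    injOn := hinj
    continuousOn := hcont
    model := hYm
    norm_stable_le := hAs
    norm_unstable_le := hAu
    chart_eq := hYc
    radius_le := hδr
    mul_radius_le := hcr }
  exact hfam.exists_globalGraphTransform hs rfl hκ (by positivity) hδ1
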